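/- **Setting.** Let $n\ge 0$ be an integer and let $\mu$ be a Radon (i.e. locally finite positive Borel) measure on $\mathbb{R}^n$, with support $\Sigma=\{x:\mu(B(x,r))>0\text{ for all }r>0\}$, where $B(x,r)$ is the open Euclidean ball. Assume that $\mu$ is doubling: there is a constant $C>0$ with $\mu(B(x,2r))\le C\,\mu(B(x,r))$ for all $x\in\Sigma$ and $r>0$. Put $\mathbb{B}=B(0,1)$, and let $\mathcal{H}^d$ be $d$-dimensional Hausdorff measure, normalized so that $\mathcal{H}^d(\mathbb{R}^d\cap B(0,1))=1$. **Definitions.** - For measures $\sigma,\nu$ on $\mathbb{R}^n$ whose restrictions to $\mathbb{B}$ are probability measures, $\mathbb{W}_1(\sigma,\nu)=\sup_\psi\left|\int\psi\,d\sigma-\int\psi\,d\nu\right|$, the supremum over all $1$-Lipschitz $\psi:\mathbb{R}^n\to\mathbb{R}$ that vanish outside $\mathbb{B}$. - For $x\in\Sigma$ and $r>0$, $\mu_{x,r}(A)=\mu(x+rA)/\mu(B(x,r))$ for Borel $A\subset\mathbb{R}^n$. - For an affine $d$-plane $V$ that meets $B(0,1/2)$, $\nu_V=\mathcal{H}^d(V\cap\mathbb{B})^{-1}\,\mathcal{H}^d|_V$.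 Let $\alpha_d(x,r)$ be the infimum of $\mathbb{W}_1(\mu_{x,r},\nu_V)$ over all such $V$, and let $\alpha(x,r)=\min_{0\le d\le n}\alpha_d(x,r)$. - Weak convergence of measures means convergence of the integrals of every continuous function with compact support. $\mathrm{Tan}(x,\mu)$ is the set of Radon measures that are weak limits of sequences $A\mapsto c_k\,\mu(x+r_kA)$ with $c_k\ge0$, $r_k>0$, $r_k\to0$. - An affine $d$-plane $W$ through $x$ is a tangent $d$-plane to $\Sigma$ at $x$ if $\lim_{r\to0}\frac1r\sup\{\mathrm{dist}(y,W): y\in\Sigma\cap B(x,r)\}=0$. - A $d$-dimensional Lipschitz graph is a set $\{v+f(v): v\in V\}$ with $V$ a $d$-dimensional linear subspace of $\mathbb{R}^n$ and $f:V\to V^\perp$ Lipschitz. A set $A$ is $d$-rectifiable if countably many $d$-dimensional Lipschitz graphs cover $A$ up to an $\mathcal{H}^d$-null set. **Theorem.** Let $$\Sigma_0=\Big\{x\in\Sigma:\int_0^1\alpha(x,r)\,\frac{dr}{r}<\infty\Big\}.$$ Then there are pairwise disjoint Borel sets $\Sigma_0(0),\dots,\Sigma_0(n)$ with $\Sigma_0=\bigcup_{d=0}^n\Sigma_0(d)$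 and the following properties. 1. $\Sigma_0(0)$ is the set of points $x\in\Sigma$ with $\mu(\{x\})>0$; it is at most countable and each of its points is an isolated point of $\Sigma$. 2. For $1\le d\le n$ and $x\in\Sigma_0(d)$, the limit $\theta_d(x)=\lim_{r\to0}r^{-d}\mu(B(x,r))$ exists and $0<\theta_d(x)<\infty$. 3. For $1\le d\le n$ and $x\in\Sigma_0(d)$, $\Sigma$ has a tangent $d$-plane $W$ at $x$ such that, with $W^*=W-x$, $\mathrm{Tan}(x,\mu)=\{c\,\mathcal{H}^d|_{W^*}: c\ge0\}$ and $\mu_{x,r}$ converges weakly to $\mathcal{H}^d|_{W^*}$ as $r\to0^+$. 4. For $1\le d\le n$ and $k\in\mathbb{Z}$, let $\Sigma_0(d,k)=\{x\in\Sigma_0(d):2^k\le\theta_d(x)<2^{k+1}\}$. Then $\Sigma_0(d,k)$ is $d$-rectifiable, $\mathcal{H}^d(\Sigma_0(d,k)\cap B(0,R))<\infty$ for every $R>0$, the restrictions of $\mu$ and $\mathcal{H}^d$ to $\Sigma_0(d,k)$ are mutually absolutely continuous, and $\mu|_{\Sigma_0(d,k)}=\theta_d\,\mathcal{H}^d|_{\Sigma_0(d,k)}$.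 -/

import Mathlib

open MeasureTheory Filter Topology
open scoped NNReal ENNReal

namespace DoublingRect

noncomputable section

/-- `ℝⁿ` with its Euclidean norm. -/
abbrev E (n : ℕ) : Type := EuclideanSpace ℝ (Fin n)

/-- `d`-dimensional Hausdorff measure on `ℝⁿ`, normalized so that the unit ball of `ℝᵈ` has
`d`-dimensional measure `1`. -/
def hausd (n d : ℕ) : Measure (E n) :=
  ((μH[(d : ℝ)] : Measure (E d)) (Metric.ball 0 1))⁻¹ • (μH[(d : ℝ)] : Measure (E n))

/-- `μ` is doubling: `μ(B(x,2r)) ≤ C μ(B(x,r))` for all `x` in the support of `μ` and `r > 0`. -/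
def IsDoubling {n : ℕ} (μ : Measure (E n)) : Prop :=
  ∃ C : ℝ≥0, 0 < C ∧ ∀ x ∈ μ.support, ∀ r : ℝ, 0 < r →
    μ (Metric.ball x (2 * r)) ≤ C * μ (Metric.ball x r)

/-- The measure `A ↦ μ(x + rA)`. -/
def dilate {n : ℕ} (μ : Measure (E n)) (x : E n) (r : ℝ) : Measure (E n) :=
  μ.map (fun y => r⁻¹ • (y - x))

/-- The measure `μ_{x,r} : A ↦ μ(x + rA) / μ(B(x,r))`. -/
def rescale {n : ℕ} (μ : Measure (E n)) (x : E n) (r : ℝ) : Measure (E n) :=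
  (μ (Metric.ball x r))⁻¹ • dilate μ x r

/-- The distance `𝕎₁(μ,ν)`: the supremum of `|∫ψ dμ - ∫ψ dν|` over all `1`-Lipschitz functions
`ψ : ℝⁿ → ℝ` that vanish outside the open unit ball. -/
def W1 {n : ℕ} (μ ν : Measure (E n)) : ℝ≥0∞ :=
  ⨆ (ψ : E n → ℝ) (_ : LipschitzWith 1 ψ) (_ : Function.support ψ ⊆ Metric.ball 0 1),
    ENNReal.ofReal |(∫ y, ψ y ∂μ) - ∫ y, ψ y ∂ν|

/-- The affine `d`-planes of `ℝⁿ` that meet the open ball `B(0,1/2)`. -/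
def centralPlanes (n d : ℕ) : Set (AffineSubspace ℝ (E n)) :=
  {V | Module.finrank ℝ V.direction = d ∧ ((V : Set (E n)) ∩ Metric.ball 0 (1 / 2)).Nonempty}

/-- The flat measure `ν_V`: the restriction of `ℋᵈ` to `V`, divided by `ℋᵈ(V ∩ B(0,1))`. -/
def flatMeasure {n : ℕ} (d : ℕ) (V : AffineSubspace ℝ (E n)) : Measure (E n) :=
  (hausd n d ((V : Set (E n)) ∩ Metric.ball 0 1))⁻¹ • (hausd n d).restrict (V : Set (E n))

/-- The number `α_d(x,r)`. -/
def alphaDim {n : ℕ} (μ : Measure (E n)) (d : ℕ) (x : E n) (r : ℝ) : ℝ≥0∞ :=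
  ⨅ V ∈ centralPlanes n d, W1 (rescale μ x r) (flatMeasure d V)

/-- The number `α(x,r)`, the minimum of `α_d(x,r)` over `d = 0, …, n`. -/
def alpha {n : ℕ} (μ : Measure (E n)) (x : E n) (r : ℝ) : ℝ≥0∞ :=
  ⨅ d : Fin (n + 1), alphaDim μ d x r

/-- The set `Σ₀` of points `x` of the support of `μ` with `∫₀¹ α(x,r) dr/r < ∞`. -/
def goodSet {n : ℕ} (μ : Measure (E n)) : Set (E n) :=
  {x | x ∈ μ.support ∧ ∫⁻ r in Set.Ioo (0 : ℝ) 1, alpha μ x r / ENNReal.ofReal r < ∞}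

/-- The `d`-density `θ_d(x) = lim_{r → 0} r^{-d} μ(B(x,r))` (meaningful where the limit exists). -/
def density {n : ℕ} (μ : Measure (E n)) (d : ℕ) (x : E n) : ℝ≥0∞ :=
  limUnder (𝓝[>] (0 : ℝ)) (fun r : ℝ => μ (Metric.ball x r) / ENNReal.ofReal r ^ d)

/-- Weak convergence of measures, tested on continuous functions with compact support. -/
def WeakLim {n : ℕ} {ι : Type*} (l : Filter ι) (m : ι → Measure (E n)) (ν : Measure (E n)) :
    Prop :=
  ∀ f : E n → ℝ, Continuous f → HasCompactSupport f →
    Tendsto (fun i => ∫ y, f y ∂(m i)) l (𝓝 (∫ y, f y ∂ν))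

/-- `Tan(μ,x)`: the Radon measures that are weak limits of sequences `A ↦ c_k μ(x + r_k A)` with
`c_k ≥ 0`, `r_k > 0` and `r_k → 0`. -/
def tangentMeasures {n : ℕ} (μ : Measure (E n)) (x : E n) : Set (Measure (E n)) :=
  {ν | IsLocallyFiniteMeasure ν ∧ ∃ (c : ℕ → ℝ≥0) (r : ℕ → ℝ), (∀ k, 0 < r k) ∧
    Tendsto r atTop (𝓝 0) ∧ WeakLim atTop (fun k => c k • dilate μ x (r k)) ν}

/-- `W` is a tangent `d`-plane at `x` to the set `S`: it is an affine `d`-plane through `x` with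
`r⁻¹ sup {dist(y,W) : y ∈ S ∩ B(x,r)} → 0` as `r → 0`. -/
def IsTangentPlane {n : ℕ} (S : Set (E n)) (x : E n) (d : ℕ) (W : AffineSubspace ℝ (E n)) :
    Prop :=
  x ∈ W ∧ Module.finrank ℝ W.direction = d ∧
    Tendsto (fun r : ℝ =>
      (⨆ y ∈ S ∩ Metric.ball x r, Metric.infEDist y (W : Set (E n))) / ENNReal.ofReal r)
      (𝓝[>] 0) (𝓝 0)

/-- `Γ` is a `d`-dimensional Lipschitz graph `{v + f(v) : v ∈ V}`, where `V` is a `d`-dimensional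
linear subspace and `f : V → Vᗮ` is Lipschitz. -/
def IsLipschitzGraph {n : ℕ} (d : ℕ) (Γ : Set (E n)) : Prop :=
  ∃ V : Submodule ℝ (E n), Module.finrank ℝ V = d ∧ ∃ (L : ℝ≥0) (f : V → Vᗮ),
    LipschitzWith L f ∧ Γ = Set.range (fun v : V => (v : E n) + (f v : E n))

/-- `A` is a `d`-rectifiable set: countably many `d`-dimensional Lipschitz graphs cover
`ℋᵈ`-almost all of it. -/
def IsRectifiableSet {n : ℕ} (d : ℕ) (A : Set (E n)) : Prop :=
  ∃ Γ : ℕ → Set (E n), (∀ i, IsLipschitzGraph d (Γ i)) ∧ hausd n d (A \ ⋃ i, Γ i) = 0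

/-- The part of `S` where `2^k ≤ θ_d < 2^{k+1}`. -/
def densityLayer {n : ℕ} (μ : Measure (E n)) (d : ℕ) (S : Set (E n)) (k : ℤ) : Set (E n) :=
  {x | x ∈ S ∧ (2 : ℝ≥0∞) ^ k ≤ density μ d x ∧ density μ d x < (2 : ℝ≥0∞) ^ (k + 1)}

end

end DoublingRect

open DoublingRect

namespace DoublingRect

/-! ### Flat measures -/

/-! Finiteness of `∫₀¹ α(x,r) dr/r` provides radii `r k`, one in each dyadic interval, and planes
approximating `μ` in `B(x, r k)` with summable errors `ε k` (`exists_scales_of_lintegral_lt_top`).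
By doubling, the flat measures of two consecutive scales are close to each other on the unit ball
(`Approx.flatClose`). Flat measures that are close enough have the same dimension, and their
directions and coefficients differ by at most a multiple of the error (`FlatClose.dim_le`,
`FlatClose.norm_orthogonal_le`, `FlatClose.coeff_le`). Hence the dimension stabilizes at some `d`,
the directions form a Cauchy sequence, and the consecutive ratios of `c k * μ(B(x, r k)) / r k ^ d`
differ from `1` by summable amounts, so these numbers have a positive limit `θ`
(`exists_flatLimit`).

Every small radius `s` is comparable to some `r k`, so the integrals of `f((y - x)/s)` against `μ`,
divided by `s ^ d`, converge to `θ` times the integral of `f` over the limit plane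
(`FlatLimit.tendsto_integral`). Density, blow-up limit and tangent measures follow. The tangent
plane exists because a point of the support far from the approximating plane would, by doubling,
carry mass that the flat measure does not see (`exists_tilt_bound`).

The dimension at a good point is the only exponent for which the density is positive and finite,
which gives a Borel partition once the good set is known to be Borel; this last fact comes from a
semicontinuous form of `α` (`upperSemicontinuous_alphaAux`). In dimension zero the density is `μ
{x}`, and doubling isolates atoms.

Approximate tangency to a plane at every good point covers the good points of dimension `d` by
countably many pieces of Lipschitz graphs of arbitrarily small slope. On each piece, orthogonal
projection is almost isometric, and differentiation of measures in `ℝᵈ` compares `μ` with `θ ℋᵈ` up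
to a factor tending to `1` (`measure_compare_of_piece`, `measure_eq_withDensity`). -/

theorem hausd_ne_top_coeff (d : ℕ) :
    ((μH[(d : ℝ)] : Measure (E d)) (Metric.ball 0 1))⁻¹ ≠ ∞ ∧
    ((μH[(d : ℝ)] : Measure (E d)) (Metric.ball 0 1))⁻¹ ≠ 0 := by
  have : (μH[(d : ℝ)] : Measure (E d)).IsAddHaarMeasure := by
    simpa using MeasureTheory.isAddHaarMeasure_hausdorffMeasure (E := EuclideanSpace ℝ (Fin d))
  constructor
  · exact ENNReal.inv_ne_top.2 (Metric.measure_ball_pos _ _ one_pos).ne'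
  · exact ENNReal.inv_ne_zero.2 measure_ball_lt_top.ne

instance isAddHaarMeasure_hausd (d : ℕ) : (hausd d d).IsAddHaarMeasure := by
  have : (μH[(d : ℝ)] : Measure (E d)).IsAddHaarMeasure := by
    simpa using MeasureTheory.isAddHaarMeasure_hausdorffMeasure (E := EuclideanSpace ℝ (Fin d))
  exact Measure.IsAddHaarMeasure.smul _ (hausd_ne_top_coeff d).2 (hausd_ne_top_coeff d).1

theorem hausd_unit_ball (d : ℕ) : hausd d d (Metric.ball 0 1) = 1 := by
  have : (μH[(d : ℝ)] : Measure (E d)).IsAddHaarMeasure := by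
    simpa using MeasureTheory.isAddHaarMeasure_hausdorffMeasure (E := EuclideanSpace ℝ (Fin d))
  rw [hausd, Measure.smul_apply, smul_eq_mul]
  exact ENNReal.inv_mul_cancel (Metric.measure_ball_pos _ _ one_pos).ne' measure_ball_lt_top.ne

theorem hausd_ball {d : ℕ} (x : E d) {r : ℝ} (hr : 0 < r) :
    hausd d d (Metric.ball x r) = ENNReal.ofReal r ^ d := by
  rw [Measure.addHaar_ball_of_pos _ _ hr, hausd_unit_ball, mul_one,
    ENNReal.ofReal_pow hr.le]
  simp

theorem hausd_closedBall {d : ℕ} (x : E d) {r : ℝ} (hr : 0 < r) :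
    hausd d d (Metric.closedBall x r) = ENNReal.ofReal r ^ d := by
  rw [Measure.addHaar_closedBall _ _ hr.le, hausd_unit_ball, mul_one,
    ENNReal.ofReal_pow hr.le]
  simp

theorem hausd_real_ball {d : ℕ} (x : E d) {r : ℝ} (hr : 0 < r) :
    (hausd d d).real (Metric.ball x r) = r ^ d := by
  rw [Measure.real, hausd_ball x hr, ENNReal.toReal_pow, ENNReal.toReal_ofReal hr.le]

theorem exists_linearIsometry_range {n d : ℕ} (V : Submodule ℝ (E n))
    (h : Module.finrank ℝ V = d) :
    ∃ L : E d →ₗᵢ[ℝ] E n, LinearMap.range L.toLinearMap = V := by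
  subst h
  refine ⟨V.subtypeₗᵢ.comp (stdOrthonormalBasis ℝ V).repr.symm.toLinearIsometry, ?_⟩
  ext v
  constructor
  · rintro ⟨s, rfl⟩
    simp
  · intro hv
    exact ⟨(stdOrthonormalBasis ℝ V).repr ⟨v, hv⟩, by simp⟩

theorem map_hausd {n d : ℕ} (p : E n) (L : E d →ₗᵢ[ℝ] E n) :
    (hausd d d).map (fun s => p + L s) = (hausd n d).restrict (Set.range fun s => p + L s) := by
  have hi : Isometry (fun s => p + L s) := (isometry_add_left p).comp L.isometry
  rw [hausd, hausd, Measure.map_smul, hi.map_hausdorffMeasure (Or.inl (by positivity)),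
    Measure.restrict_smul]

theorem affineSubspace_eq_range {n d : ℕ} {V : AffineSubspace ℝ (E n)} {p : E n} (hp : p ∈ V)
    {L : E d →ₗᵢ[ℝ] E n} (hL : LinearMap.range L.toLinearMap = V.direction) :
    (V : Set (E n)) = Set.range fun s => p + L s := by
  ext z
  constructor
  · intro hz
    have : z -ᵥ p ∈ V.direction := AffineSubspace.vsub_mem_direction hz hp
    rw [← hL] at this
    obtain ⟨s, hs⟩ := this
    refine ⟨s, ?_⟩
    have hs' : L s = z - p := hs
    simp [hs']
  · rintro ⟨s, rfl⟩
    have : L s ∈ V.direction := by rw [← hL]; exact ⟨s, rfl⟩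
    have := AffineSubspace.vadd_mem_of_mem_direction this hp
    simpa [add_comm] using this

theorem integral_restrict_plane {n d : ℕ} (p : E n) (L : E d →ₗᵢ[ℝ] E n) (f : E n → ℝ) :
    ∫ y, f y ∂((hausd n d).restrict (Set.range fun s => p + L s)) =
      ∫ s, f (p + L s) ∂(hausd d d) := by
  rw [← map_hausd]
  have hi : Isometry (fun s => p + L s) := (isometry_add_left p).comp L.isometry
  exact hi.isClosedEmbedding.measurableEmbedding.integral_map f

theorem integral_plane_scale {n d : ℕ} (p : E n) (L : E d →ₗᵢ[ℝ] E n) (f : E n → ℝ) {t : ℝ}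
    (ht : 0 < t) :
    ∫ s, f (t⁻¹ • (p + L s)) ∂(hausd d d) = t ^ d * ∫ s, f (t⁻¹ • p + L s) ∂(hausd d d) := by
  have := Measure.integral_comp_smul (hausd d d) (fun s => f (t⁻¹ • p + L s)) t⁻¹
  simp only [finrank_euclideanSpace, Fintype.card_fin, smul_eq_mul, map_smul] at this
  simp only [smul_add]
  rw [this, abs_of_pos (by positivity)]
  simp

/-- Flat measures in parametric form. -/
theorem exists_param_of_mem_centralPlanes {n d : ℕ} {V : AffineSubspace ℝ (E n)}
    (hV : V ∈ centralPlanes n d) :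
    ∃ (p : E n) (L : E d →ₗᵢ[ℝ] E n) (c : ℝ), ‖p‖ < 1 / 2 ∧ p ∈ V ∧
      LinearMap.range L.toLinearMap = V.direction ∧
      (2 ^ d)⁻¹ ≤ c ∧ c ≤ 2 ^ d ∧
      ∀ f : E n → ℝ, ∫ y, f y ∂(flatMeasure d V) = c * ∫ s, f (p + L s) ∂(hausd d d) := by
  obtain ⟨hd, p, hpV, hp⟩ := hV
  obtain ⟨L, hL⟩ := exists_linearIsometry_range _ hd
  have hr := affineSubspace_eq_range hpV hL
  have hp' : ‖p‖ < 1 / 2 := by simpa using hp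
  have hi : Isometry (fun s => p + L s) := (isometry_add_left p).comp L.isometry
  have hm : hausd n d ((V : Set (E n)) ∩ Metric.ball 0 1) =
      hausd d d ((fun s => p + L s) ⁻¹' Metric.ball 0 1) := by
    rw [← Measure.map_apply hi.continuous.measurable Metric.isOpen_ball.measurableSet, map_hausd,
      Measure.restrict_apply Metric.isOpen_ball.measurableSet, hr, Set.inter_comm]
  -- The slice of the unit ball contains the `d`-ball of radius `1/2` about `p` and lies in the one
  -- of radius `2`, because `‖p‖ < 1/2`.
  have h1 : ENNReal.ofReal (1 / 2) ^ d ≤ hausd n d ((V : Set (E n)) ∩ Metric.ball 0 1) := by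
    rw [hm, ← hausd_ball (0 : E d) (by norm_num : (0 : ℝ) < 1 / 2)]
    refine measure_mono fun s hs => ?_
    simp only [Metric.mem_ball, dist_zero_right, Set.mem_preimage] at hs ⊢
    calc ‖p + L s‖ ≤ ‖p‖ + ‖L s‖ := norm_add_le _ _
      _ < 1 := by rw [L.norm_map]; linarith
  have h2 : hausd n d ((V : Set (E n)) ∩ Metric.ball 0 1) ≤ ENNReal.ofReal 2 ^ d := by
    rw [hm, ← hausd_ball (0 : E d) (by norm_num : (0 : ℝ) < 2)]
    refine measure_mono fun s hs => ?_
    simp only [Metric.mem_ball, dist_zero_right, Set.mem_preimage] at hs ⊢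
    have : ‖L s‖ ≤ ‖p + L s‖ + ‖p‖ := by
      calc ‖L s‖ = ‖(p + L s) - p‖ := by simp
        _ ≤ _ := norm_sub_le _ _
    rw [L.norm_map] at this
    linarith
  set m := hausd n d ((V : Set (E n)) ∩ Metric.ball 0 1) with hmdef
  have hmtop : m ≠ ∞ := ne_top_of_le_ne_top (by simp) h2
  have h1' : (2 ^ d)⁻¹ ≤ m.toReal := by
    have := ENNReal.toReal_mono hmtop h1
    simpa [ENNReal.toReal_pow] using this
  have h2' : m.toReal ≤ 2 ^ d := by
    have := ENNReal.toReal_mono (by simp) h2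
    simpa [ENNReal.toReal_pow] using this
  have hpos : 0 < m.toReal := lt_of_lt_of_le (by positivity) h1'
  refine ⟨p, L, (m⁻¹).toReal, hp', hpV, hL, ?_, ?_, fun f => ?_⟩
  · rw [ENNReal.toReal_inv]
    exact inv_anti₀ hpos h2'
  · rw [ENNReal.toReal_inv]
    exact inv_le_of_inv_le₀ (by positivity) h1'
  · rw [flatMeasure, integral_smul_measure, smul_eq_mul, hr, integral_restrict_plane]
    rw [hmdef, hr]

theorem integral_rescale {n : ℕ} (μ : Measure (E n)) (x : E n) {r : ℝ} (hr : 0 < r)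
    (f : E n → ℝ) :
    ∫ y, f y ∂(dilate μ x r) = ∫ y, f (r⁻¹ • (y - x)) ∂μ := by
  let e : E n ≃ₜ E n := (Homeomorph.subRight x).trans (Homeomorph.smulOfNeZero r⁻¹ (by positivity))
  exact e.measurableEmbedding.integral_map f

theorem integral_rescale' {n : ℕ} (μ : Measure (E n)) (x : E n) {r : ℝ} (hr : 0 < r)
    (f : E n → ℝ) :
    ∫ y, f y ∂(rescale μ x r) =
      (μ.real (Metric.ball x r))⁻¹ * ∫ y, f (r⁻¹ • (y - x)) ∂μ := by
  rw [rescale, integral_smul_measure, integral_rescale μ x hr, ENNReal.toReal_inv, smul_eq_mul]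
  rfl

theorem le_W1 {n : ℕ} (μ ν : Measure (E n)) {ψ : E n → ℝ} (h : LipschitzWith 1 ψ)
    (hs : Function.support ψ ⊆ Metric.ball 0 1) :
    ENNReal.ofReal |(∫ y, ψ y ∂μ) - ∫ y, ψ y ∂ν| ≤ W1 μ ν := by
  unfold W1
  exact le_iSup_of_le ψ (le_iSup_of_le h (le_iSup_of_le hs le_rfl))

/-- The plane approximation `c ℋᵈ|_{p + range L}` of the rescaled measure, with error `ε`. -/
structure Approx {n : ℕ} (μ : Measure (E n)) (x : E n) (r ε : ℝ) (d : ℕ) (p : E n)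
    (L : E d →ₗᵢ[ℝ] E n) (c : ℝ) : Prop where
  norm_p : ‖p‖ < 1 / 2
  le_n : d ≤ n
  le_c : (2 ^ n)⁻¹ ≤ c
  c_le : c ≤ 2 ^ n
  close : ∀ ψ : E n → ℝ, LipschitzWith 1 ψ → Function.support ψ ⊆ Metric.ball 0 1 →
    |(μ.real (Metric.ball x r))⁻¹ * (∫ y, ψ (r⁻¹ • (y - x)) ∂μ) -
      c * ∫ s, ψ (p + L s) ∂(hausd d d)| ≤ ε

theorem exists_approx {n : ℕ} (μ : Measure (E n)) (x : E n) {r ε : ℝ} (hr : 0 < r)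
    (hε : 0 < ε)
    (h : alpha μ x r < ENNReal.ofReal ε) :
    ∃ (d : ℕ) (p : E n) (L : E d →ₗᵢ[ℝ] E n) (c : ℝ), Approx μ x r ε d p L c := by
  obtain ⟨d, hd⟩ := iInf_lt_iff.1 h
  simp only [alphaDim, iInf_lt_iff] at hd
  obtain ⟨V, hV, hW⟩ := hd
  obtain ⟨p, L, c, hp, hpV, hL, hc1, hc2, hint⟩ := exists_param_of_mem_centralPlanes hV
  have hdn : (d : ℕ) ≤ n := Nat.lt_succ_iff.1 d.2
  have hpow : (2 : ℝ) ^ (d : ℕ) ≤ 2 ^ n := pow_le_pow_right₀ (by norm_num) hdn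
  refine ⟨d, p, L, c, hp, hdn, (inv_anti₀ (by positivity) hpow).trans hc1, hc2.trans hpow, ?_⟩
  intro ψ hψ hs
  have := (le_W1 (rescale μ x r) (flatMeasure d V) hψ hs).trans hW.le
  rw [hint, integral_rescale' μ x hr] at this
  rwa [ENNReal.ofReal_le_ofReal_iff hε.le] at this

/-! ### Comparison of flat measures -/

/-- The linear direction of the plane `p + range L`. -/
noncomputable abbrev dir {n d : ℕ} (L : E d →ₗᵢ[ℝ] E n) : Submodule ℝ (E n) := LinearMap.range L.toLinearMap

/-- The distance of `z` from the plane `p + U`. -/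
noncomputable def planeDist {n : ℕ} (p : E n) (U : Submodule ℝ (E n)) (z : E n) : ℝ :=
  ‖Uᗮ.starProjection (z - p)‖

/-! ### Distance to an affine plane -/

section planeDist
variable {n : ℕ} (p : E n) (U : Submodule ℝ (E n))

theorem starProjection_orthogonal_apply (z : E n) :
    Uᗮ.starProjection z = z - U.starProjection z := by
  rw [Submodule.starProjection_orthogonal_val]

theorem norm_starProjection_le (z : E n) : ‖U.starProjection z‖ ≤ ‖z‖ := by
  simpa using U.starProjection.le_of_opNorm_le U.starProjection_norm_le z

theorem planeDist_nonneg (z : E n) : 0 ≤ planeDist p U z := norm_nonneg _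

theorem planeDist_le (z : E n) : planeDist p U z ≤ ‖z - p‖ := norm_starProjection_le _ _

theorem planeDist_sub_le (z w : E n) : planeDist p U z ≤ planeDist p U w + ‖z - w‖ := by
  have h : Uᗮ.starProjection (z - p) = Uᗮ.starProjection (w - p) + Uᗮ.starProjection (z - w) := by
    rw [← map_add]; congr 1; abel
  rw [planeDist, h]
  exact (norm_add_le _ _).trans (add_le_add le_rfl (norm_starProjection_le _ _))

theorem lipschitzWith_planeDist : LipschitzWith 1 (planeDist p U) :=
  LipschitzWith.of_le_add fun z w => by simpa [dist_eq_norm] using planeDist_sub_le p U z w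

theorem planeDist_add_mem {u : E n} (hu : u ∈ U) (z : E n) :
    planeDist p U (z + u) = planeDist p U z := by
  have : Uᗮ.starProjection u = 0 := by
    rw [starProjection_orthogonal_apply, Submodule.starProjection_eq_self_iff.2 hu, sub_self]
  rw [planeDist, planeDist, add_sub_right_comm, map_add, this, add_zero]

theorem planeDist_self_add_mem {u : E n} (hu : u ∈ U) : planeDist p U (p + u) = 0 := by
  rw [planeDist_add_mem p U hu, planeDist, sub_self, map_zero, norm_zero]

/-- Midpoint convexity of the distance. It bounds the distance at one point by averages over a
symmetric neighbourhood, which integrals control. -/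
theorem two_mul_planeDist_le (y u : E n) :
    2 * planeDist p U y ≤ planeDist p U (y + u) + planeDist p U (y - u) := by
  have : (2 : ℝ) • Uᗮ.starProjection (y - p) =
      Uᗮ.starProjection (y + u - p) + Uᗮ.starProjection (y - u - p) := by
    rw [← map_smul, ← map_add]; congr 1; rw [two_smul]; abel
  calc 2 * planeDist p U y = ‖(2 : ℝ) • Uᗮ.starProjection (y - p)‖ := by
        rw [norm_smul, planeDist]; norm_num
    _ ≤ _ := by rw [this]; exact norm_add_le _ _

end planeDist

theorem hasCompactSupport_of_support_subset_ball {n : ℕ} {ψ : E n → ℝ} {x : E n} {R : ℝ}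
    (hs : Function.support ψ ⊆ Metric.ball x R) : HasCompactSupport ψ :=
  HasCompactSupport.of_support_subset_isCompact (isCompact_closedBall x R)
    (hs.trans Metric.ball_subset_closedBall)

theorem isClosedEmbedding_plane {n d : ℕ} (p : E n) (L : E d →ₗᵢ[ℝ] E n) :
    IsClosedEmbedding (fun s => p + L s) :=
  ((isometry_add_left p).comp L.isometry).isClosedEmbedding

theorem integrable_plane {n d : ℕ} (p : E n) (L : E d →ₗᵢ[ℝ] E n) {f : E n → ℝ}
    (hf : Continuous f) (hs : HasCompactSupport f) :
    Integrable (fun s => f (p + L s)) (hausd d d) :=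
  (hf.comp (isClosedEmbedding_plane p L).continuous).integrable_of_hasCompactSupport
    (hs.comp_isClosedEmbedding (isClosedEmbedding_plane p L))

theorem indicator_ball_integral {d : ℕ} (a : ℝ) {ρ : ℝ} (hρ : 0 < ρ) :
    ∫ u, (Metric.ball (0 : E d) ρ).indicator (fun _ => a) u ∂(hausd d d) = ρ ^ d * a := by
  rw [integral_indicator_const _ Metric.isOpen_ball.measurableSet, hausd_real_ball _ hρ,
    smul_eq_mul]

theorem integrable_indicator_ball {d : ℕ} (a : ℝ) (ρ : ℝ) :
    Integrable ((Metric.ball (0 : E d) ρ).indicator (fun _ => a)) (hausd d d) :=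
  (integrable_indicator_iff Metric.isOpen_ball.measurableSet).2
    (integrableOn_const measure_ball_lt_top.ne)

theorem lipschitzWith_cone {n : ℕ} (y : E n) (R : ℝ) :
    LipschitzWith 1 (fun z : E n => max 0 (R - ‖z - y‖)) := by
  refine LipschitzWith.of_le_add fun z w => ?_
  have h1 := norm_sub_norm_le (w - y) (z - y)
  rw [sub_sub_sub_cancel_right] at h1
  rw [dist_comm, dist_eq_norm]
  have h2 := norm_nonneg (w - z)
  apply max_le
  · exact add_nonneg (le_max_left _ _) h2
  · have := le_max_right 0 (R - ‖w - y‖)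
    linarith

theorem support_cone {n : ℕ} (y : E n) (R : ℝ) :
    Function.support (fun z : E n => max 0 (R - ‖z - y‖)) ⊆ Metric.ball y R := by
  intro z hz
  rw [Function.mem_support] at hz
  rw [Metric.mem_ball, dist_eq_norm]
  by_contra h
  exact hz (max_eq_left (by linarith))

/-- Two flat measures are `ε`-close on the unit ball. -/
def FlatClose {n d d' : ℕ} (ε : ℝ) (p : E n) (L : E d →ₗᵢ[ℝ] E n) (c : ℝ)
    (p' : E n) (L' : E d' →ₗᵢ[ℝ] E n) (c' : ℝ) : Prop :=
  ∀ ψ : E n → ℝ, LipschitzWith 1 ψ → Function.support ψ ⊆ Metric.ball 0 1 →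
    |c * (∫ s, ψ (p + L s) ∂(hausd d d)) - c' * ∫ s, ψ (p' + L' s) ∂(hausd d' d')| ≤ ε

theorem FlatClose.symm {n d d' : ℕ} {ε : ℝ} {p : E n} {L : E d →ₗᵢ[ℝ] E n} {c : ℝ}
    {p' : E n} {L' : E d' →ₗᵢ[ℝ] E n} {c' : ℝ} (h : FlatClose ε p L c p' L' c') :
    FlatClose ε p' L' c' p L c := fun ψ h1 h2 => by
  rw [abs_sub_comm]; exact h ψ h1 h2

section FlatClose
variable {n d d' : ℕ} {ε K : ℝ} {p : E n} {L : E d →ₗᵢ[ℝ] E n} {c : ℝ}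
    {p' : E n} {L' : E d' →ₗᵢ[ℝ] E n} {c' : ℝ}

/-- The truncated distance to the first plane is an admissible test function whose integral over the
first plane is zero, so its integral over the second plane is at most `K * ε`. Convexity turns this
into a bound at each point with the linear power of `ε`, not a root of it. -/
theorem FlatClose.planeDist_le (h : FlatClose ε p L c p' L' c') (hK : 0 < K) (hc' : K⁻¹ ≤ c')
    (hd' : d' ≤ n) (hp : ‖p‖ < 1 / 2) {s : E d'} (hs : ‖p' + L' s‖ ≤ 3 / 4) :
    planeDist p (dir L) (p' + L' s) ≤ 16 * 8 ^ n * K * ε := by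
  set g := planeDist p (dir L) with hg
  set y := p' + L' s with hy
  set ψ : E n → ℝ := fun z => min (g z) (max 0 (1 - ‖z - 0‖)) with hψ
  have hψL : LipschitzWith 1 ψ := by
    simpa [hψ] using (lipschitzWith_planeDist p (dir L)).min (lipschitzWith_cone 0 1)
  have hψs : Function.support ψ ⊆ Metric.ball 0 1 := by
    intro z hz
    refine support_cone 0 1 ?_
    rw [Function.mem_support] at hz ⊢
    intro h0
    refine hz ?_
    simp only [hψ, h0]
    exact min_eq_right (planeDist_nonneg _ _ _)
  have hψ0 : ∀ z, 0 ≤ ψ z := fun z => le_min (planeDist_nonneg _ _ _) (le_max_left _ _)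
  have hcs := hasCompactSupport_of_support_subset_ball hψs
  have h0 : ∀ t, ψ (p + L t) = 0 := fun t => by
    have : g (p + L t) = 0 := planeDist_self_add_mem _ _ ⟨t, rfl⟩
    simp only [hψ, this]
    exact min_eq_left (le_max_left _ _)
  have h1 := h ψ hψL hψs
  simp only [h0, integral_zero, mul_zero, zero_sub, abs_neg] at h1
  have hi1 := integrable_plane y L' hψL.continuous hcs
  have hi2 : Integrable (fun u => ψ (y - L' u)) (hausd d' d') := by
    simpa [sub_eq_add_neg] using hi1.comp_neg
  have e1 : ∫ u, ψ (y + L' u) ∂(hausd d' d') = ∫ t, ψ (p' + L' t) ∂(hausd d' d') := by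
    rw [← integral_add_left_eq_self (fun t => ψ (p' + L' t)) s]
    simp [hy, add_assoc]
  have e2 : ∫ u, ψ (y - L' u) ∂(hausd d' d') = ∫ t, ψ (p' + L' t) ∂(hausd d' d') := by
    rw [← e1, ← integral_neg_eq_self (fun t => ψ (y + L' t))]
    simp [sub_eq_add_neg]
  -- Here `g z ≤ 7/8 + 1/2 < 2`, so `g z / 16 < 1/8 < 1 - ‖z‖` and the truncation is harmless.
  have hlow : ∀ z : E n, ‖z‖ < 7 / 8 → g z / 16 ≤ ψ z := by
    intro z hz
    have h2 : g z ≤ ‖z - p‖ := DoublingRect.planeDist_le _ _ _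
    have h3 := norm_sub_le z p
    have h4 := planeDist_nonneg p (dir L) z
    refine le_min (by linarith) (le_max_of_le_right ?_)
    rw [sub_zero]
    linarith
  have hpt : ∀ u, (Metric.ball (0 : E d') (1 / 8)).indicator (fun _ => g y / 8) u ≤
      ψ (y + L' u) + ψ (y - L' u) := by
    intro u
    by_cases hu : u ∈ Metric.ball (0 : E d') (1 / 8)
    · rw [Set.indicator_of_mem hu]
      have hu' : ‖L' u‖ < 1 / 8 := by simpa using hu
      have h2 := hlow (y + L' u) (by linarith [norm_add_le y (L' u)])
      have h3 := hlow (y - L' u) (by linarith [norm_sub_le y (L' u)])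
      have h4 := two_mul_planeDist_le p (dir L) y (L' u)
      rw [← hg] at h4
      linarith
    · rw [Set.indicator_of_notMem hu]
      exact add_nonneg (hψ0 _) (hψ0 _)
  have hint := integral_mono (integrable_indicator_ball (d := d') (g y / 8) (1 / 8))
    (hi1.add hi2) hpt
  simp only [Pi.add_apply] at hint
  rw [indicator_ball_integral _ (by norm_num), integral_add hi1 hi2, e1, e2] at hint
  set I := ∫ t, ψ (p' + L' t) ∂(hausd d' d') with hI
  have hI0 : 0 ≤ I := integral_nonneg fun t => hψ0 _
  have hc0 : 0 < c' := lt_of_lt_of_le (by positivity) hc'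
  rw [abs_of_nonneg (mul_nonneg hc0.le hI0)] at h1
  have h5 : K⁻¹ * I ≤ ε := (mul_le_mul_of_nonneg_right hc' hI0).trans h1
  have h6 : I ≤ K * ε := by
    have := mul_le_mul_of_nonneg_left h5 hK.le
    rwa [← mul_assoc, mul_inv_cancel₀ hK.ne', one_mul] at this
  have h7 : ((8 : ℝ) ^ n)⁻¹ ≤ (1 / 8) ^ d' := by
    rw [one_div, inv_pow]
    exact inv_anti₀ (by positivity) (pow_le_pow_right₀ (by norm_num) hd')
  have h8 : ((8 : ℝ) ^ n)⁻¹ * (g y / 8) ≤ 2 * (K * ε) :=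
    (mul_le_mul_of_nonneg_right h7 (by have := planeDist_nonneg p (dir L) y; positivity)).trans
      (by linarith)
  rw [inv_mul_le_iff₀ (by positivity)] at h8
  linarith

/-- A direction vector of length `1/4` is the difference of two points of the second plane in `B(0,
3/4)`, both close to the first plane. Homogeneity gives the factor `8 = 2 * 4`. -/
theorem FlatClose.norm_orthogonal_le (h : FlatClose ε p L c p' L' c') (hK : 0 < K)
    (hc' : K⁻¹ ≤ c') (hd' : d' ≤ n) (hp : ‖p‖ < 1 / 2) (hp' : ‖p'‖ < 1 / 2) (u : E d') :
    ‖(dir L)ᗮ.starProjection (L' u)‖ ≤ 8 * (16 * 8 ^ n * K * ε) * ‖u‖ := by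
  by_cases hu : u = 0
  · simp [hu]
  have hu0 : 0 < ‖u‖ := norm_pos_iff.2 hu
  set v := (4 * ‖u‖)⁻¹ • u with hv
  have hvn : ‖v‖ = 1 / 4 := by
    rw [hv, norm_smul, norm_inv, norm_mul, norm_norm]
    field_simp
    norm_num
  have h1 := h.planeDist_le hK hc' hd' hp (s := v) (by
    have := norm_add_le p' (L' v)
    rw [L'.norm_map, hvn] at this
    linarith)
  have h2 := h.planeDist_le hK hc' hd' hp (s := 0) (by
    simp only [map_zero, add_zero]; linarith)
  have h3 : (dir L)ᗮ.starProjection (L' v) =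
      (dir L)ᗮ.starProjection (p' + L' v - p) - (dir L)ᗮ.starProjection (p' + L' 0 - p) := by
    rw [← map_sub]; congr 1; simp
  have h4 : ‖(dir L)ᗮ.starProjection (L' v)‖ ≤ 2 * (16 * 8 ^ n * K * ε) := by
    rw [h3]
    refine (norm_sub_le _ _).trans ?_
    rw [two_mul]
    exact add_le_add h1 h2
  rw [hv, map_smul, map_smul, norm_smul, norm_inv, norm_mul, norm_norm, Real.norm_ofNat,
    inv_mul_le_iff₀ (by positivity)] at h4
  linarith

/-- The orthogonal component of a nonzero direction vector is shorter than the vector itself, so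
projection onto `dir L` is injective on the second direction. -/
theorem FlatClose.dim_le (h : FlatClose ε p L c p' L' c') (hK : 0 < K)
    (hc' : K⁻¹ ≤ c') (hd' : d' ≤ n) (hp : ‖p‖ < 1 / 2) (hp' : ‖p'‖ < 1 / 2)
    (hε : 8 * (16 * 8 ^ n * K * ε) < 1) : d' ≤ d := by
  have hinj : Function.Injective
      ((dir L).starProjection.toLinearMap.comp L'.toLinearMap) := by
    rw [← LinearMap.ker_eq_bot, LinearMap.ker_eq_bot']
    intro u hu
    have hu' : (dir L).starProjection (L' u) = 0 := hu
    have h1 := h.norm_orthogonal_le hK hc' hd' hp hp' u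
    rw [starProjection_orthogonal_apply, hu', sub_zero, L'.norm_map] at h1
    by_contra hne
    have : 0 < ‖u‖ := norm_pos_iff.2 hne
    nlinarith
  have hrange : LinearMap.range ((dir L).starProjection.toLinearMap.comp L'.toLinearMap) ≤
      dir L := by
    rintro _ ⟨u, rfl⟩
    exact Submodule.starProjection_apply_mem _ _
  have h1 := LinearMap.finrank_range_of_inj hinj
  have h2 := Submodule.finrank_mono hrange
  have h3 : Module.finrank ℝ (dir L) = d := by
    rw [LinearMap.finrank_range_of_inj L.injective]; simp
  rw [h1, h3] at h2
  simpa using h2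

/-- For projections `P`, `P'` one has `P - P' = P(1 - P') - (1 - P)P'`. The last term is controlled
by `h1`; the other is the adjoint of `(1 - P')P`, controlled by `h2`. -/
theorem starProjection_dist_le {κ : ℝ}
    (h1 : ∀ u, ‖(dir L)ᗮ.starProjection (L' u)‖ ≤ κ * ‖u‖)
    (h2 : ∀ u, ‖(dir L')ᗮ.starProjection (L u)‖ ≤ κ * ‖u‖) (hκ : 0 ≤ κ) :
    ‖(dir L).starProjection - (dir L').starProjection‖ ≤ 2 * κ := by
  have key : ∀ {a : ℕ} {M : E a →ₗᵢ[ℝ] E n} {U : Submodule ℝ (E n)},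
      (∀ u, ‖Uᗮ.starProjection (M u)‖ ≤ κ * ‖u‖) → ∀ z ∈ dir M,
      ‖Uᗮ.starProjection z‖ ≤ κ * ‖z‖ := by
    rintro a M U h z ⟨u, rfl⟩
    have : ‖M u‖ = ‖u‖ := M.norm_map u
    rw [← this] at *
    simpa using h u
  refine ContinuousLinearMap.opNorm_le_bound _ (by positivity) fun z => ?_
  have e : ((dir L).starProjection - (dir L').starProjection) z =
      (dir L).starProjection ((dir L')ᗮ.starProjection z) -
      (dir L)ᗮ.starProjection ((dir L').starProjection z) := by
    rw [starProjection_orthogonal_apply, starProjection_orthogonal_apply, map_sub,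
      sub_apply]
    abel
  have b1 : ‖(dir L)ᗮ.starProjection ((dir L').starProjection z)‖ ≤ κ * ‖z‖ :=
    (key h1 _ (Submodule.starProjection_apply_mem _ _)).trans
      (mul_le_mul_of_nonneg_left (norm_starProjection_le _ _) hκ)
  -- Duality written out: `‖w‖² = ⟪z, (1 - P')w⟫ ≤ ‖z‖ κ ‖w‖`.
  have b2 : ‖(dir L).starProjection ((dir L')ᗮ.starProjection z)‖ ≤ κ * ‖z‖ := by
    set w := (dir L).starProjection ((dir L')ᗮ.starProjection z) with hw
    have hwm : w ∈ dir L := Submodule.starProjection_apply_mem _ _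
    have hwd := key h2 w hwm
    have e1 : inner ℝ w w = inner ℝ z ((dir L')ᗮ.starProjection w) := by
      conv_lhs => enter [2]; rw [hw]
      rw [hw, ← Submodule.inner_starProjection_left_eq_right,
        Submodule.starProjection_eq_self_iff.2 hwm, ← hw,
        ← Submodule.inner_starProjection_left_eq_right, real_inner_comm]
    rw [real_inner_self_eq_norm_sq] at e1
    have e2 : ‖w‖ ^ 2 ≤ ‖z‖ * (κ * ‖w‖) := by
      rw [e1]
      exact (real_inner_le_norm _ _).trans (mul_le_mul_of_nonneg_left hwd (norm_nonneg _))
    by_cases h0 : ‖w‖ = 0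
    · rw [h0]; positivity
    · have : 0 < ‖w‖ := lt_of_le_of_ne (norm_nonneg _) (Ne.symm h0)
      by_contra hcon
      push Not at hcon
      nlinarith
  rw [e]
  refine (norm_sub_le _ _).trans ?_
  linarith

end FlatClose

/-- A tent of radius `1/8` around `p'` is tested. Its integral over the second plane is a constant
`κ`; over the first plane it is `κ` up to the distance `δ` from `p'` to that plane. As `κ` is
bounded below, the coefficients are close. -/
theorem FlatClose.coeff_le {n d : ℕ} {ε K : ℝ} {p : E n} {L : E d →ₗᵢ[ℝ] E n} {c : ℝ}
    {p' : E n} {L' : E d →ₗᵢ[ℝ] E n} {c' : ℝ} (h : FlatClose ε p L c p' L' c') (hK : 0 < K)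
    (hc : K⁻¹ ≤ c) (hcK : c ≤ K) (hc' : K⁻¹ ≤ c') (hd : d ≤ n) (hp : ‖p‖ < 1 / 2)
    (hp' : ‖p'‖ < 1 / 2) (hε : 8 * (16 * 8 ^ n * K * ε) < 1) :
    |c - c'| ≤ 16 ^ (n + 1) * (ε + K * (16 * 8 ^ n * K * ε)) := by
  set δ := 16 * 8 ^ n * K * ε with hδ
  set φ : E n → ℝ := fun z => max 0 (1 / 8 - ‖z - p'‖) with hφ
  have hφL : LipschitzWith 1 φ := lipschitzWith_cone p' (1 / 8)
  have hφb := support_cone p' (1 / 8)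
  have hφs : Function.support φ ⊆ Metric.ball 0 1 := by
    refine hφb.trans (Metric.ball_subset_ball' ?_)
    rw [dist_zero_right]; linarith
  have hcs := hasCompactSupport_of_support_subset_ball hφs
  have hmain := h φ hφL hφs
  have hdist := h.planeDist_le hK hc' hd hp (s := 0) (by simp only [map_zero, add_zero]; linarith)
  rw [map_zero, add_zero, ← hδ] at hdist
  -- The point `q` is the foot of the perpendicular from `p'` to the first plane; translating the
  -- parameter by `s0` recentres the integral at `q`.
  obtain ⟨s0, hs0⟩ : ∃ s0, L s0 = (dir L).starProjection (p' - p) :=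
    Submodule.starProjection_apply_mem (dir L) (p' - p)
  set q := p + L s0 with hq
  have hqp : ‖p' - q‖ ≤ δ := by
    rw [hq, hs0]
    rw [planeDist, starProjection_orthogonal_apply] at hdist
    rwa [← sub_sub]
  set κ := ∫ u, max 0 (1 / 8 - ‖u‖) ∂(hausd d d) with hκ
  have e1 : ∫ u, φ (p' + L' u) ∂(hausd d d) = κ := by
    simp [hφ, hκ]
  have e2 : ∫ u, φ (p + L u) ∂(hausd d d) = ∫ u, φ (q + L u) ∂(hausd d d) := by
    rw [← integral_add_left_eq_self (fun t => φ (p + L t)) s0]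
    simp [hq, add_assoc]
  have hi1 := integrable_plane q L hφL.continuous hcs
  have hi2 : Integrable (fun u : E d => max 0 (1 / 8 - ‖u‖)) (hausd d d) := by
    simpa [hφ] using integrable_plane p' L' hφL.continuous hcs
  have hpt : ∀ u, |φ (q + L u) - max 0 (1 / 8 - ‖u‖)| ≤
      (Metric.ball (0 : E d) 1).indicator (fun _ => δ) u := by
    intro u
    have h1 : φ (p' + L u) = max 0 (1 / 8 - ‖u‖) := by simp [hφ]
    by_cases hu : u ∈ Metric.ball (0 : E d) 1
    · rw [Set.indicator_of_mem hu, ← h1]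
      have := hφL.dist_le_mul (q + L u) (p' + L u)
      rw [Real.dist_eq, dist_add_right, dist_comm, dist_eq_norm] at this
      refine this.trans ?_
      simpa using hqp
    · rw [Set.indicator_of_notMem hu]
      have hu' : 1 ≤ ‖u‖ := by simpa using hu
      have h2 : max 0 (1 / 8 - ‖u‖) = 0 := max_eq_left (by linarith)
      have h3 : φ (q + L u) = 0 := by
        refine max_eq_left ?_
        have h4 : ‖L u‖ ≤ ‖q + L u - p'‖ + ‖p' - q‖ := by
          calc ‖L u‖ = ‖(q + L u - p') + (p' - q)‖ := by congr 1; abel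
            _ ≤ _ := norm_add_le _ _
        rw [L.norm_map] at h4
        linarith
      rw [h2, h3]; simp
  have hdiff : |∫ u, φ (q + L u) ∂(hausd d d) - κ| ≤ δ := by
    rw [hκ, ← integral_sub hi1 hi2]
    refine (abs_integral_le_integral_abs).trans ?_
    refine (integral_mono (hi1.sub hi2).abs (integrable_indicator_ball δ 1) hpt).trans ?_
    rw [indicator_ball_integral _ one_pos]; simp
  have hκlow : ((16 : ℝ) ^ (n + 1))⁻¹ ≤ κ := by
    have h1 : ∀ u : E d, (Metric.ball (0 : E d) (1 / 16)).indicator (fun _ => (1 / 16 : ℝ)) u ≤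
        max 0 (1 / 8 - ‖u‖) := by
      intro u
      by_cases hu : u ∈ Metric.ball (0 : E d) (1 / 16)
      · rw [Set.indicator_of_mem hu]
        have hu' : ‖u‖ < 1 / 16 := by simpa using hu
        exact le_max_of_le_right (by linarith)
      · rw [Set.indicator_of_notMem hu]; exact le_max_left _ _
    have h2 := integral_mono (integrable_indicator_ball _ _) hi2 h1
    rw [indicator_ball_integral _ (by norm_num)] at h2
    refine le_trans ?_ h2
    rw [← pow_succ, one_div, inv_pow]
    exact inv_anti₀ (by positivity) (pow_le_pow_right₀ (by norm_num) (by omega))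
  rw [e1, e2] at hmain
  have hc0 : 0 < c := lt_of_lt_of_le (by positivity) hc
  have hδ0 : 0 ≤ δ := (norm_nonneg _).trans hqp
  have h3 : |(c - c') * κ| ≤ ε + K * δ := by
    have : (c - c') * κ = (c * (∫ u, φ (q + L u) ∂(hausd d d)) - c' * κ) -
        c * ((∫ u, φ (q + L u) ∂(hausd d d)) - κ) := by ring
    rw [this]
    refine (abs_sub _ _).trans (add_le_add hmain ?_)
    rw [abs_mul, abs_of_pos hc0]
    exact mul_le_mul hcK hdiff (abs_nonneg _) hK.le
  have hκ0 : 0 < κ := lt_of_lt_of_le (by positivity) hκlow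
  rw [abs_mul, abs_of_pos hκ0] at h3
  have h4 : |c - c'| * ((16 : ℝ) ^ (n + 1))⁻¹ ≤ ε + K * δ :=
    (mul_le_mul_of_nonneg_left hκlow (abs_nonneg _)).trans h3
  rw [mul_inv_le_iff₀ (by positivity)] at h4
  linarith

/-! ### Doubling measures and plane approximations at comparable scales -/

section Doubling
variable {n : ℕ} {μ : Measure (E n)}

theorem measure_ball_pos_of_mem_support {x : E n} (hx : x ∈ μ.support) {r : ℝ} (hr : 0 < r) :
    0 < μ (Metric.ball x r) :=
  (Measure.mem_support_iff_forall x).1 hx _ (Metric.ball_mem_nhds x hr)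

theorem measureReal_ball_pos [IsLocallyFiniteMeasure μ] {x : E n} (hx : x ∈ μ.support) {r : ℝ} (hr : 0 < r) :
    0 < μ.real (Metric.ball x r) :=
  ENNReal.toReal_pos (measure_ball_pos_of_mem_support hx hr).ne' measure_ball_lt_top.ne

/-- Doubling with a real constant `C`. -/
def DoublingWith (μ : Measure (E n)) (C : ℝ) : Prop :=
  1 ≤ C ∧ ∀ x ∈ μ.support, ∀ r : ℝ, 0 < r →
    μ.real (Metric.ball x (2 * r)) ≤ C * μ.real (Metric.ball x r)

theorem IsDoubling.exists_doublingWith [IsLocallyFiniteMeasure μ] (h : IsDoubling μ) : ∃ C : ℝ, DoublingWith μ C := by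
  obtain ⟨C, -, h⟩ := h
  refine ⟨max 1 C, le_max_left _ _, fun x hx r hr => ?_⟩
  have h1 := ENNReal.toReal_mono (ENNReal.mul_ne_top ENNReal.coe_ne_top measure_ball_lt_top.ne)
    (h x hx r hr)
  rw [ENNReal.toReal_mul] at h1
  exact h1.trans (mul_le_mul_of_nonneg_right (le_max_right _ _) measureReal_nonneg)

variable {C : ℝ}

theorem DoublingWith.pow (h : DoublingWith μ C) {x : E n} (hx : x ∈ μ.support) {r : ℝ}
    (hr : 0 < r) (m : ℕ) :
    μ.real (Metric.ball x (2 ^ m * r)) ≤ C ^ m * μ.real (Metric.ball x r) := by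
  induction m with
  | zero => simp
  | succ m ih =>
    have h1 := h.2 x hx (2 ^ m * r) (by positivity)
    have h0 : 0 ≤ C := zero_le_one.trans h.1
    rw [pow_succ', mul_assoc, pow_succ', mul_assoc]
    exact h1.trans (mul_le_mul_of_nonneg_left ih h0)

theorem measureReal_ball_mono [IsLocallyFiniteMeasure μ] {x y : E n} {r s : ℝ}
    (h : Metric.ball x r ⊆ Metric.ball y s) :
    μ.real (Metric.ball x r) ≤ μ.real (Metric.ball y s) :=
  ENNReal.toReal_mono measure_ball_lt_top.ne (measure_mono h)

end Doubling

/-! ### Plane approximations at one scale and at two comparable scales -/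

section Approx
variable {n d d' : ℕ} {μ : Measure (E n)} {x : E n} {r ε : ℝ} {p : E n}
    {L : E d →ₗᵢ[ℝ] E n} {c : ℝ}

theorem Approx.mono (h : Approx μ x r ε d p L c) {ε' : ℝ} (hε : ε ≤ ε') :
    Approx μ x r ε' d p L c :=
  ⟨h.norm_p, h.le_n, h.le_c, h.c_le, fun ψ h1 h2 => (h.close ψ h1 h2).trans hε⟩

theorem integral_plane_rebase (f : E n → ℝ) (p : E n) (L : E d →ₗᵢ[ℝ] E n) :
    ∫ s, f ((dir L)ᗮ.starProjection p + L s) ∂(hausd d d) =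
      ∫ s, f (p + L s) ∂(hausd d d) := by
  obtain ⟨s0, hs0⟩ : ∃ s0, L s0 = (dir L).starProjection p :=
    Submodule.starProjection_apply_mem (dir L) p
  rw [← integral_sub_right_eq_self (fun t => f (p + L t)) s0]
  refine integral_congr_ae (Eventually.of_forall fun s => ?_)
  simp only [map_sub, hs0, starProjection_orthogonal_apply]
  congr 1
  abel

/-- Taking the foot of the perpendicular from the origin as base point makes the norm of the base
point equal to the distance from the origin to the plane (`norm_rebase`). The parametrized integral
is unchanged by translation invariance. -/
theorem Approx.rebase (h : Approx μ x r ε d p L c) :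
    Approx μ x r ε d ((dir L)ᗮ.starProjection p) L c :=
  ⟨(norm_starProjection_le _ _).trans_lt h.norm_p, h.le_n, h.le_c, h.c_le, fun ψ h1 h2 => by
    rw [integral_plane_rebase]; exact h.close ψ h1 h2⟩

theorem norm_rebase (p : E n) (U : Submodule ℝ (E n)) :
    ‖Uᗮ.starProjection p‖ = planeDist p U 0 := by
  rw [planeDist, zero_sub, map_neg, norm_neg]

variable {C : ℝ}

/-- A tent of radius `η` around a point farther than `η` from the plane vanishes on the plane. Its
`μ`-integral is at least `η / 2` times the mass of a ball around a support point, and doubling makes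
that mass a fixed fraction of `μ(B(x,r))`. -/
theorem exists_tilt_bound [IsLocallyFiniteMeasure μ] (h : DoublingWith μ C) {η : ℝ} (hη : 0 < η) (hη2 : η ≤ 1 / 2) :
    ∃ ε₀ : ℝ, 0 < ε₀ ∧ ∀ {x : E n} {r : ℝ} {d : ℕ} {p : E n} {L : E d →ₗᵢ[ℝ] E n} {c : ℝ},
      x ∈ μ.support → 0 < r → Approx μ x r ε₀ d p L c →
      ∀ y ∈ μ.support ∩ Metric.ball x (r / 2), planeDist p (dir L) (r⁻¹ • (y - x)) ≤ η := by
  -- With `2 ^ m > 4 / η`, doubling the radius `η * r / 2` around `y` `m` times gives more than `2 *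
  -- r`, hence a ball containing `B(x,r)`.
  obtain ⟨m, hm⟩ : ∃ m : ℕ, 4 / η < 2 ^ m := pow_unbounded_of_one_lt _ (by norm_num)
  have hC0 : 0 < C := zero_lt_one.trans_le h.1
  refine ⟨η / 4 * (C ^ m)⁻¹, by positivity, ?_⟩
  intro x r d p L c hx hr ha y ⟨hy, hyx⟩
  by_contra hcon
  push Not at hcon
  set w := r⁻¹ • (y - x) with hw
  have hwn : ‖w‖ < 1 / 2 := by
    rw [hw, norm_smul, norm_inv, Real.norm_of_nonneg hr.le, inv_mul_lt_iff₀ hr]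
    rw [Metric.mem_ball, dist_eq_norm] at hyx
    linarith
  set ψ : E n → ℝ := fun z => max 0 (η - ‖z - w‖) with hψ
  have hψL : LipschitzWith 1 ψ := lipschitzWith_cone w η
  have hψs : Function.support ψ ⊆ Metric.ball 0 1 := by
    refine (support_cone w η).trans (Metric.ball_subset_ball' ?_)
    rw [dist_zero_right]; linarith
  have h1 := ha.close ψ hψL hψs
  have h0 : ∀ s, ψ (p + L s) = 0 := fun s => by
    refine max_eq_left ?_
    have h2 := planeDist_sub_le p (dir L) w (p + L s)
    have h3 : planeDist p (dir L) (p + L s) = 0 := planeDist_self_add_mem p (dir L) ⟨s, rfl⟩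
    rw [norm_sub_rev] at h2
    linarith
  simp only [h0, integral_zero, mul_zero, sub_zero] at h1
  have hlow : (Metric.ball y (η * r / 2)).indicator (fun _ => η / 2) ≤
      fun y' => ψ (r⁻¹ • (y' - x)) := by
    intro y'
    by_cases hy' : y' ∈ Metric.ball y (η * r / 2)
    · rw [Set.indicator_of_mem hy']
      refine le_max_of_le_right ?_
      have : r⁻¹ • (y' - x) - w = r⁻¹ • (y' - y) := by
        rw [hw, ← smul_sub]; congr 1; abel
      rw [this, norm_smul, norm_inv, Real.norm_of_nonneg hr.le]
      rw [Metric.mem_ball, dist_eq_norm] at hy'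
      have : r⁻¹ * ‖y' - y‖ ≤ η / 2 := by
        rw [inv_mul_le_iff₀ hr]; linarith
      linarith
    · rw [Set.indicator_of_notMem hy']; exact le_max_left _ _
  have hcont : Continuous fun y' => ψ (r⁻¹ • (y' - x)) :=
    hψL.continuous.comp (by fun_prop)
  have hcs : HasCompactSupport fun y' => ψ (r⁻¹ • (y' - x)) := by
    let e : E n ≃ₜ E n := (Homeomorph.subRight x).trans (Homeomorph.smulOfNeZero r⁻¹ (by positivity))
    exact (hasCompactSupport_of_support_subset_ball hψs).comp_homeomorph e
  have h2 := integral_mono (μ := μ) ((integrable_indicator_iff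
    Metric.isOpen_ball.measurableSet).2 (integrableOn_const measure_ball_lt_top.ne))
    (hcont.integrable_of_hasCompactSupport hcs) hlow
  rw [integral_indicator_const _ Metric.isOpen_ball.measurableSet, smul_eq_mul] at h2
  have hmx := measureReal_ball_pos hx hr
  have hmy := measureReal_ball_pos hy (r := η * r / 2) (by positivity)
  have h3 : μ.real (Metric.ball x r) ≤ C ^ m * μ.real (Metric.ball y (η * r / 2)) := by
    refine le_trans (measureReal_ball_mono (Metric.ball_subset_ball' ?_))
      (h.pow hy (r := η * r / 2) (by positivity) m)
    rw [Metric.mem_ball, dist_comm] at hyx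
    rw [div_lt_iff₀ hη] at hm
    nlinarith
  have hI := (le_abs_self _).trans h1
  rw [inv_mul_le_iff₀ hmx] at hI
  have h4 : μ.real (Metric.ball y (η * r / 2)) * (η / 2) ≤
      C ^ m * μ.real (Metric.ball y (η * r / 2)) * (η / 4 * (C ^ m)⁻¹) :=
    h2.trans (hI.trans (mul_le_mul_of_nonneg_right h3 (by positivity)))
  have h5 : C ^ m * μ.real (Metric.ball y (η * r / 2)) * (η / 4 * (C ^ m)⁻¹) =
      μ.real (Metric.ball y (η * r / 2)) * (η / 4) := by
    field_simp
  rw [h5] at h4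
  nlinarith

/-- The rescaled form of a plane approximation: it describes `μ` at scale `t r`. -/
theorem Approx.close_scaled (h : Approx μ x r ε d p L c) {t : ℝ} (ht : 0 < t)
    {ℓ : ℝ≥0} (hℓ : 0 < ℓ) {ψ : E n → ℝ} (hψ : LipschitzWith ℓ ψ)
    (hs : Function.support ψ ⊆ Metric.ball 0 t⁻¹) :
    |(μ.real (Metric.ball x r))⁻¹ * (∫ y, ψ ((t * r)⁻¹ • (y - x)) ∂μ) -
      c * t ^ d * ∫ s, ψ (t⁻¹ • p + L s) ∂(hausd d d)| ≤ ε * (ℓ / t) := by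
  have hℓ0 : 0 < (ℓ : ℝ) := NNReal.coe_pos.2 hℓ
  -- The function `z ↦ ψ (t⁻¹ • z)` is `ℓ / t`-Lipschitz; the factor `k` makes it admissible.
  set k : ℝ := t / ℓ with hk
  have hk0 : 0 < k := by positivity
  have hφL : LipschitzWith 1 (fun z => k * ψ (t⁻¹ • z)) := by
    refine LipschitzWith.of_dist_le_mul fun z w => ?_
    have h1 := hψ.dist_le_mul (t⁻¹ • z) (t⁻¹ • w)
    rw [dist_smul₀, norm_inv, Real.norm_of_nonneg ht.le] at h1
    rw [Real.dist_eq, ← mul_sub, abs_mul, abs_of_pos hk0, ← Real.dist_eq]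
    refine (mul_le_mul_of_nonneg_left h1 hk0.le).trans (le_of_eq ?_)
    rw [hk]; simp only [NNReal.coe_one, one_mul]; field_simp
  have hφs : Function.support (fun z => k * ψ (t⁻¹ • z)) ⊆ Metric.ball 0 1 := by
    intro z hz
    rw [Function.mem_support] at hz
    have := hs (Function.mem_support.2 (right_ne_zero_of_mul hz))
    rw [Metric.mem_ball, dist_zero_right, norm_smul, norm_inv, Real.norm_of_nonneg ht.le] at this
    rw [Metric.mem_ball, dist_zero_right]
    have := (mul_lt_mul_iff_right₀ ht).2 this
    rwa [← mul_assoc, mul_inv_cancel₀ ht.ne', one_mul] at this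
  have h1 := h.close _ hφL hφs
  rw [integral_const_mul, integral_const_mul, integral_plane_scale p L ψ ht] at h1
  simp only [smul_smul, ← mul_inv] at h1
  have h2 : (μ.real (Metric.ball x r))⁻¹ * (k * ∫ y, ψ ((t * r)⁻¹ • (y - x)) ∂μ) -
      c * (k * (t ^ d * ∫ s, ψ (t⁻¹ • p + L s) ∂(hausd d d))) =
      k * ((μ.real (Metric.ball x r))⁻¹ * (∫ y, ψ ((t * r)⁻¹ • (y - x)) ∂μ) -
      c * t ^ d * ∫ s, ψ (t⁻¹ • p + L s) ∂(hausd d d)) := by ring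
  rw [h2, abs_mul, abs_of_pos hk0, mul_comm, ← le_div_iff₀ hk0] at h1
  refine h1.trans (le_of_eq ?_)
  rw [hk]; field_simp

/-- Both flat measures approximate `μ` at scale `r'`. Passing from `r` to `r'` costs `C ^ 2` for the
ratio of masses (two doublings) and `4` for the Lipschitz constant after rescaling. -/
theorem Approx.flatClose [IsLocallyFiniteMeasure μ] (hx : x ∈ μ.support) (hC : DoublingWith μ C)
    (h : Approx μ x r ε d p L c) {r' ε' : ℝ} {p' : E n} {L' : E d' →ₗᵢ[ℝ] E n} {c' : ℝ}
    (h' : Approx μ x r' ε' d' p' L' c') (hr' : 0 < r') (h1 : r' ≤ r) (h2 : r ≤ 4 * r') :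
    FlatClose (4 * C ^ 2 * ε + ε') ((r' / r)⁻¹ • p) L
      (c * (r' / r) ^ d * (μ.real (Metric.ball x r) / μ.real (Metric.ball x r'))) p' L' c' := by
  intro ψ hψ hs
  have hr : 0 < r := hr'.trans_le h1
  set t := r' / r with ht
  have ht0 : 0 < t := by positivity
  have ht1 : t ≤ 1 := (div_le_one hr).2 h1
  have htr : t * r = r' := div_mul_cancel₀ _ hr.ne'
  have hs' : Function.support ψ ⊆ Metric.ball 0 t⁻¹ :=
    hs.trans (Metric.ball_subset_ball ((one_le_inv₀ ht0).2 ht1))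
  have a1 := h.close_scaled ht0 one_pos hψ hs'
  have a2 := h'.close ψ hψ hs
  rw [htr] at a1
  set m := μ.real (Metric.ball x r)
  set m' := μ.real (Metric.ball x r')
  have hm : 0 < m := measureReal_ball_pos hx hr
  have hm' : 0 < m' := measureReal_ball_pos hx hr'
  have hε : 0 ≤ ε := by
    have := h.close (fun _ => 0) (LipschitzWith.const' 0) (by simp)
    exact (abs_nonneg _).trans this
  set I := ∫ y, ψ (r'⁻¹ • (y - x)) ∂μ
  set J := ∫ s, ψ (t⁻¹ • p + L s) ∂(hausd d d)
  set J' := ∫ s, ψ (p' + L' s) ∂(hausd d' d')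
  have e : c * t ^ d * (m / m') * J - c' * J' =
      (m'⁻¹ * I - c' * J') - (m / m') * (m⁻¹ * I - c * t ^ d * J) := by
    field_simp
    ring
  have hmm : m / m' ≤ C ^ 2 := by
    rw [div_le_iff₀ hm']
    refine le_trans (measureReal_ball_mono (Metric.ball_subset_ball ?_)) (hC.pow hx hr' 2)
    linarith
  have hti : t⁻¹ ≤ 4 := by
    rw [ht, inv_div, div_le_iff₀ hr']; exact h2
  rw [e]
  refine (abs_sub _ _).trans ?_
  rw [add_comm (4 * C ^ 2 * ε)]
  refine add_le_add a2 ?_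
  rw [abs_mul, abs_of_pos (div_pos hm hm')]
  calc m / m' * |m⁻¹ * I - c * t ^ d * J| ≤ C ^ 2 * (ε * ((1 : ℝ≥0) / t)) :=
        mul_le_mul hmm a1 (abs_nonneg _) (by positivity)
    _ ≤ C ^ 2 * (ε * 4) := by
        rw [NNReal.coe_one, one_div]; gcongr
    _ = _ := by ring

end Approx

/-! ### Good scales and the limiting plane -/

/-- Chebyshev's inequality on each dyadic interval: some radius has value at most about twice the
integral over the interval, and the integrals are summable. -/
theorem exists_scales_of_lintegral_lt_top {f : ℝ → ℝ≥0∞}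
    (hf : ∫⁻ r in Set.Ioo (0 : ℝ) 1, f r / ENNReal.ofReal r < ∞) :
    ∃ r ε : ℕ → ℝ, (∀ k, (1 / 2) ^ (k + 1) < r k ∧ r k < (1 / 2) ^ k) ∧ (∀ k, 0 < ε k) ∧
      Summable ε ∧ ∀ k, f (r k) < ENNReal.ofReal (ε k) := by
  set J : ℕ → Set ℝ := fun k => Set.Ioo ((1 / 2) ^ (k + 1)) ((1 / 2) ^ k) with hJ
  have hdisj : Pairwise (Function.onFun Disjoint J) := by
    refine (pairwise_disjoint_on J).2 fun i j hij => ?_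
    rw [Set.disjoint_left]
    intro z hz hz'
    have : (1 / 2 : ℝ) ^ j ≤ (1 / 2) ^ (i + 1) :=
      pow_le_pow_of_le_one (by norm_num) (by norm_num) hij
    exact absurd (hz.1.trans hz'.2) (not_lt.2 this)
  have hsub : (⋃ k, J k) ⊆ Set.Ioo 0 1 := by
    refine Set.iUnion_subset fun k z hz => ⟨?_, ?_⟩
    · exact lt_trans (by positivity) hz.1
    · exact hz.2.trans_le (pow_le_one₀ (by norm_num) (by norm_num))
  set b : ℕ → ℝ≥0∞ := fun k => ∫⁻ r in J k, f r / ENNReal.ofReal r with hb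
  have hsum : ∑' k, b k ≠ ∞ := by
    rw [hb, ← lintegral_iUnion (fun k => measurableSet_Ioo) hdisj]
    exact ((lintegral_mono_set hsub).trans_lt hf).ne
  have hbtop : ∀ k, b k ≠ ∞ := fun k => ENNReal.ne_top_of_tsum_ne_top hsum k
  -- `J k` has length `(1/2) ^ k / 2` and the weight is at least `2 ^ k` there, so a lower bound on
  -- `f` contributes half of itself to `b k`. The summand `(1/2) ^ k` makes the contradiction strict
  -- even if `b k = 0`.
  have hex : ∀ k, ∃ r ∈ J k, f r ≤ 2 * b k + ENNReal.ofReal ((1 / 2) ^ k) := by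
    intro k
    by_contra hcon
    push Not at hcon
    set δ : ℝ := (1 / 2) ^ k with hδ
    have hδ0 : 0 < δ := by positivity
    have hlow : ∀ r ∈ J k, (2 * b k + ENNReal.ofReal δ) / ENNReal.ofReal δ ≤
        f r / ENNReal.ofReal r := fun r hr =>
      ENNReal.div_le_div (hcon r hr).le (ENNReal.ofReal_le_ofReal hr.2.le)
    have h1 : ∫⁻ r in J k, (2 * b k + ENNReal.ofReal δ) / ENNReal.ofReal δ ≤ b k :=
      setLIntegral_mono' measurableSet_Ioo hlow
    rw [lintegral_const, Measure.restrict_apply_univ, hJ, Real.volume_Ioo] at h1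
    have h2 : (1 / 2 : ℝ) ^ k - (1 / 2) ^ (k + 1) = δ * (1 / 2) := by rw [pow_succ]; ring
    rw [h2, ENNReal.ofReal_mul hδ0.le, ← mul_assoc,
      ENNReal.div_mul_cancel (by simpa using hδ0) ENNReal.ofReal_ne_top] at h1
    have h3 : (2 * b k + ENNReal.ofReal δ) * ENNReal.ofReal (1 / 2) =
        b k + ENNReal.ofReal (δ * (1 / 2)) := by
      rw [add_mul, ENNReal.ofReal_mul hδ0.le, mul_comm 2, mul_assoc]
      congr 1
      have : (2 : ℝ≥0∞) * ENNReal.ofReal (1 / 2) = 1 := by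
        rw [← ENNReal.ofReal_ofNat, ← ENNReal.ofReal_mul (by norm_num)]; norm_num
      rw [this, mul_one]
    rw [h3] at h1
    exact absurd h1 (not_le.2 (ENNReal.lt_add_right (hbtop k) (by simpa using hδ0)))
  choose r hr hfr using hex
  refine ⟨r, fun k => 2 * (b k).toReal + 2 * (1 / 2) ^ k, hr, fun k => ?_, ?_, fun k => ?_⟩
  · have : 0 ≤ (b k).toReal := ENNReal.toReal_nonneg
    positivity
  · exact ((ENNReal.summable_toReal hsum).mul_left 2).add
      ((summable_geometric_of_lt_one (by norm_num) (by norm_num)).mul_left 2)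
  · refine (hfr k).trans_lt ?_
    rw [ENNReal.ofReal_add (by positivity) (by positivity),
      ENNReal.ofReal_mul (by norm_num), ENNReal.ofReal_toReal (hbtop k), ENNReal.ofReal_ofNat]
    refine ENNReal.add_lt_add_left (ENNReal.mul_ne_top (by simp) (hbtop k)) ?_
    rw [ENNReal.ofReal_lt_ofReal_iff (by positivity)]
    have : (0 : ℝ) < (1 / 2) ^ k := by positivity
    linarith

/-- The logarithms have summable increments, of size at most `2 * b k` once `b k ≤ 1/2`; the
exponential of their limit is positive. -/
theorem exists_tendsto_pos_of_ratio {D b : ℕ → ℝ} (hD : ∀ k, 0 < D k) (hb : Summable b)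
    (h : ∀ k, |D k - D (k + 1)| ≤ b k * D (k + 1)) :
    ∃ θ, 0 < θ ∧ Tendsto D atTop (𝓝 θ) := by
  have hsm : ∀ᶠ k in atTop, b k ≤ 1 / 2 :=
    (hb.tendsto_atTop_zero.eventually (gt_mem_nhds (by norm_num : (0 : ℝ) < 1 / 2))).mono
      fun k hk => le_of_lt hk
  have hsumm : Summable fun k => dist (Real.log (D k)) (Real.log (D (k + 1))) := by
    refine Summable.of_norm_bounded_eventually_nat (g := fun k => 2 * b k) (hb.mul_left 2) ?_
    filter_upwards [hsm] with k hk
    set q := D k / D (k + 1) with hq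
    have hq0 : 0 < q := div_pos (hD _) (hD _)
    have hqb : |q - 1| ≤ b k := by
      have : q - 1 = (D k - D (k + 1)) / D (k + 1) := by
        rw [hq, sub_div, div_self (hD _).ne']
      rw [this, abs_div, abs_of_pos (hD (k + 1)), div_le_iff₀ (hD _)]
      exact h k
    have hb0 : 0 ≤ b k := (abs_nonneg _).trans hqb
    rw [abs_le] at hqb
    rw [Real.norm_of_nonneg dist_nonneg, Real.dist_eq,
      ← Real.log_div (hD _).ne' (hD _).ne', ← hq, abs_le]
    constructor
    · have h1 := Real.one_sub_inv_le_log_of_pos hq0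
      have h2 : -(2 * b k) ≤ 1 - q⁻¹ := by
        have : q⁻¹ ≤ 1 + 2 * b k := by
          rw [inv_le_iff_one_le_mul₀ hq0]
          nlinarith
        linarith
      linarith
    · have h1 := Real.log_le_sub_one_of_pos hq0
      linarith
  obtain ⟨l, hl⟩ := cauchySeq_tendsto_of_complete (cauchySeq_of_summable_dist hsumm)
  refine ⟨Real.exp l, Real.exp_pos _, ?_⟩
  refine ((Real.continuous_exp.tendsto l).comp hl).congr fun k => ?_
  exact Real.exp_log (hD k)

/-- The formula `P = L L*` makes the projection a continuous function of the isometry. -/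
theorem starProjection_dir {n d : ℕ} (L : E d →ₗᵢ[ℝ] E n) :
    (dir L).starProjection =
      L.toContinuousLinearMap ∘L ContinuousLinearMap.adjoint L.toContinuousLinearMap := by
  ext1 z
  have hmem : (L.toContinuousLinearMap ∘L ContinuousLinearMap.adjoint L.toContinuousLinearMap) z ∈
      dir L := ⟨ContinuousLinearMap.adjoint L.toContinuousLinearMap z, rfl⟩
  refine Submodule.eq_starProjection_of_mem_orthogonal hmem ?_
  rw [Submodule.mem_orthogonal]
  rintro _ ⟨u, rfl⟩
  rw [inner_sub_right, sub_eq_zero]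
  have h1 : inner ℝ (L u) z = inner ℝ u
      (ContinuousLinearMap.adjoint L.toContinuousLinearMap z) :=
    (ContinuousLinearMap.adjoint_inner_right L.toContinuousLinearMap u z).symm
  have h2 := L.inner_map_map u (ContinuousLinearMap.adjoint L.toContinuousLinearMap z)
  exact h1.trans h2.symm

/-- Compactness of the unit ball of a finite-dimensional operator space; preservation of norms
passes to the limit. -/
theorem exists_subseq_linearIsometry {n d : ℕ} (L : ℕ → E d →ₗᵢ[ℝ] E n) :
    ∃ (L' : E d →ₗᵢ[ℝ] E n) (φ : ℕ → ℕ), StrictMono φ ∧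
      Tendsto (fun k => (L (φ k)).toContinuousLinearMap) atTop (𝓝 L'.toContinuousLinearMap) := by
  have : ProperSpace (E d →L[ℝ] E n) := FiniteDimensional.proper ℝ _
  obtain ⟨M, -, φ, hφ, hM⟩ := tendsto_subseq_of_bounded
    (Metric.isBounded_closedBall (x := (0 : E d →L[ℝ] E n)) (r := 1))
    (x := fun k => (L k).toContinuousLinearMap) (fun k => by
      rw [mem_closedBall_zero_iff]
      exact (L k).norm_toContinuousLinearMap_le)
  have hnorm : ∀ u, ‖M u‖ = ‖u‖ := by
    intro u
    have h1 : Tendsto (fun k => ‖L (φ k) u‖) atTop (𝓝 ‖M u‖) :=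
      (((ContinuousLinearMap.apply ℝ (E n) u).continuous.tendsto M).comp hM).norm
    simp only [LinearIsometry.norm_map] at h1
    exact tendsto_nhds_unique h1 tendsto_const_nhds
  exact ⟨⟨M.toLinearMap, hnorm⟩, φ, hφ, hM⟩

theorem tendsto_starProjection_dir {n d : ℕ} {ι : Type*} {l : Filter ι}
    {L : ι → E d →ₗᵢ[ℝ] E n} {L' : E d →ₗᵢ[ℝ] E n}
    (h : Tendsto (fun k => (L k).toContinuousLinearMap) l (𝓝 L'.toContinuousLinearMap)) :
    Tendsto (fun k => (dir (L k)).starProjection) l (𝓝 (dir L').starProjection) := by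
  simp only [starProjection_dir]
  have h2 : Tendsto (fun k => ContinuousLinearMap.adjoint (L k).toContinuousLinearMap) l
      (𝓝 (ContinuousLinearMap.adjoint L'.toContinuousLinearMap)) :=
    ((ContinuousLinearMap.adjoint (𝕜 := ℝ) (E := E d) (F := E n)).continuous.tendsto _).comp h
  have h3 : Continuous fun q : (E d →L[ℝ] E n) × (E n →L[ℝ] E d) => q.1 ∘L q.2 :=
    continuous_fst.clm_comp continuous_snd
  exact (h3.tendsto _).comp (h.prodMk_nhds h2)

/-- The data of a sequence of plane approximations of `μ` at `x` along scales `r k → 0`, with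
stabilized dimension, converging direction and converging density. -/
structure FlatLimit {n : ℕ} (μ : Measure (E n)) (x : E n) (d : ℕ) (r ε : ℕ → ℝ) (p : ℕ → E n)
    (L : ℕ → E d →ₗᵢ[ℝ] E n) (c : ℕ → ℝ) (M : E d →ₗᵢ[ℝ] E n) (θ : ℝ) : Prop where
  le_n : d ≤ n
  θ_pos : 0 < θ
  r_pos : ∀ k, 0 < r k
  r_anti : ∀ k, r (k + 1) ≤ r k
  r_le : ∀ k, r k ≤ 4 * r (k + 1)
  r_tendsto : Tendsto r atTop (𝓝 0)
  ε_tendsto : Tendsto ε atTop (𝓝 0)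
  approx : ∀ k, Approx μ x (r k) (ε k) d (p k) (L k) (c k)
  p_tendsto : Tendsto p atTop (𝓝 0)
  density : Tendsto (fun k => c k * μ.real (Metric.ball x (r k)) / r k ^ d) atTop (𝓝 θ)
  proj : Tendsto (fun k => (dir (L k)).starProjection) atTop (𝓝 (dir M).starProjection)

section
variable {n : ℕ} {μ : Measure (E n)} [IsLocallyFiniteMeasure μ] {x : E n} {C : ℝ}

theorem Approx.inv_le_coeff {μ : Measure (E n)} {x : E n} {C r ε c : ℝ} {d : ℕ} {p : E n}
    {L : E d →ₗᵢ[ℝ] E n} (h : Approx μ x r ε d p L c) (hC : 1 ≤ C) : (8 ^ n * C ^ 2)⁻¹ ≤ c := by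
  refine (inv_anti₀ (by positivity) ?_).trans h.le_c
  exact (pow_le_pow_left₀ (by norm_num) (by norm_num) n).trans
    (le_mul_of_one_le_right (by positivity) (one_le_pow₀ hC))

/-- In the constant, `8 ^ n` is `2 ^ n` from the bounds on `c` times `4 ^ n` from `(r' / r) ^ d`,
and `C ^ 2` bounds the ratio of masses. The same constant serves for both flat measures in each
comparison. -/
theorem Approx.scaled_coeff_bounds (hx : x ∈ μ.support) (hC : DoublingWith μ C)
    {r ε c : ℝ} {d : ℕ} {p : E n} {L : E d →ₗᵢ[ℝ] E n}
    (h : Approx μ x r ε d p L c) {r' : ℝ} (hr' : 0 < r') (h1 : r' ≤ r) (h2 : r ≤ 4 * r') :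
    (8 ^ n * C ^ 2)⁻¹ ≤
      c * (r' / r) ^ d * (μ.real (Metric.ball x r) / μ.real (Metric.ball x r')) ∧
    c * (r' / r) ^ d * (μ.real (Metric.ball x r) / μ.real (Metric.ball x r')) ≤
      8 ^ n * C ^ 2 := by
  have hr : 0 < r := hr'.trans_le h1
  set t := r' / r with ht
  have ht0 : 0 < t := div_pos hr' hr
  have ht4 : t⁻¹ ≤ 4 := by rw [ht, inv_div, div_le_iff₀ hr']; exact h2
  have ht1 : t ≤ 1 := (div_le_one hr).2 h1
  have hm : 0 < μ.real (Metric.ball x r) := measureReal_ball_pos hx hr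
  have hm' : 0 < μ.real (Metric.ball x r') := measureReal_ball_pos hx hr'
  have hmm : 1 ≤ μ.real (Metric.ball x r) / μ.real (Metric.ball x r') :=
    (one_le_div hm').2 (measureReal_ball_mono (Metric.ball_subset_ball h1))
  have hmm2 : μ.real (Metric.ball x r) / μ.real (Metric.ball x r') ≤ C ^ 2 := by
    rw [div_le_iff₀ hm']
    refine le_trans (measureReal_ball_mono (Metric.ball_subset_ball ?_)) (hC.pow hx hr' 2)
    linarith
  have hc0 : 0 ≤ c := (by positivity : (0 : ℝ) ≤ (2 ^ n)⁻¹).trans h.le_c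
  constructor
  · have h8 : ((8 : ℝ) ^ n)⁻¹ = (2 ^ n)⁻¹ * (4 ^ n)⁻¹ := by
      rw [← mul_inv, ← mul_pow]; norm_num
    have hK1 : (8 ^ n * C ^ 2)⁻¹ ≤ ((8 : ℝ) ^ n)⁻¹ := inv_anti₀ (by positivity)
      (le_mul_of_one_le_right (by positivity) (one_le_pow₀ hC.1))
    have h3 : ((4 : ℝ) ^ n)⁻¹ ≤ t ^ d := by
      have h2 : ((4 : ℝ) ^ n)⁻¹ ≤ t ^ n := by
        rw [← inv_pow]
        exact pow_le_pow_left₀ (by norm_num) (inv_le_of_inv_le₀ ht0 ht4) _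
      exact h2.trans (pow_le_pow_of_le_one ht0.le ht1 h.le_n)
    refine hK1.trans ?_
    rw [h8]
    refine (mul_le_mul h.le_c h3 (by positivity) hc0).trans ?_
    exact le_mul_of_one_le_right (mul_nonneg hc0 (by positivity)) hmm
  · refine mul_le_mul ?_ hmm2 (by positivity) (by positivity)
    calc c * t ^ d ≤ c * 1 := mul_le_mul_of_nonneg_left (pow_le_one₀ ht0.le ht1) hc0
      _ ≤ 2 ^ n := by rw [mul_one]; exact h.c_le
      _ ≤ 8 ^ n := pow_le_pow_left₀ (by norm_num) (by norm_num) n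

theorem exists_approx_seq (hC : DoublingWith μ C) (hx : x ∈ goodSet μ) :
    ∃ (d : ℕ) (r ε : ℕ → ℝ) (p : ℕ → E n) (L : ℕ → E d →ₗᵢ[ℝ] E n) (c : ℕ → ℝ),
      (∀ k, 0 < r k ∧ r (k + 1) ≤ r k ∧ r k ≤ 4 * r (k + 1)) ∧ Tendsto r atTop (𝓝 0) ∧
      Summable ε ∧ (∀ k, 0 < ε k) ∧
      (∀ k, Approx μ x (r k) (ε k) d (p k) (L k) (c k)) ∧ Tendsto p atTop (𝓝 0) ∧
      (∀ k, ‖p k‖ < 1 / 8) ∧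
      ∀ k, 8 * (16 * 8 ^ n * (8 ^ n * C ^ 2) * (4 * C ^ 2 * ε k + ε (k + 1))) < 1 := by
  obtain ⟨hxs, hint⟩ := hx
  obtain ⟨r, ε, hr, hε, hsum, ha⟩ := exists_scales_of_lintegral_lt_top hint
  have hC0 : 0 < C := zero_lt_one.trans_le hC.1
  have hr0 : ∀ k, 0 < r k := fun k => lt_trans (by positivity) (hr k).1
  have hr1 : ∀ k, r (k + 1) ≤ r k := fun k => ((hr (k + 1)).2.trans (hr k).1).le
  have hr2 : ∀ k, r k ≤ 4 * r (k + 1) := fun k => by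
    have h1 := (hr k).2
    have h2 := (hr (k + 1)).1
    have : (1 / 2 : ℝ) ^ (k + 1 + 1) = (1 / 2) ^ k * (1 / 4) := by rw [pow_succ, pow_succ]; ring
    linarith
  have hrt : Tendsto r atTop (𝓝 0) :=
    squeeze_zero (fun k => (hr0 k).le) (fun k => (hr k).2.le)
      (tendsto_pow_atTop_nhds_zero_of_lt_one (by norm_num) (by norm_num))
  have hεt := hsum.tendsto_atTop_zero
  choose d p0 L c hap0 using fun k => exists_approx μ x (hr0 k) (hε k) (ha k)
  set p : ℕ → E n := fun k => (dir (L k))ᗮ.starProjection (p0 k) with hp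
  have hap : ∀ k, Approx μ x (r k) (ε k) (d k) (p k) (L k) (c k) := fun k => (hap0 k).rebase
  have hpt : Tendsto p atTop (𝓝 0) := by
    rw [Metric.tendsto_atTop']
    intro η hη
    obtain ⟨ε₀, hε₀, htilt⟩ := exists_tilt_bound hC (η := min (η / 2) (1 / 2))
      (lt_min (by linarith) (by norm_num)) (min_le_right _ _)
    obtain ⟨N, hN⟩ := eventually_atTop.1 (hεt.eventually (gt_mem_nhds hε₀))
    refine ⟨N, fun k hk => ?_⟩
    -- The tilt bound is applied to the support point `x` itself, whose rescaled position is the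
    -- origin: the planes pass closer and closer to it.
    have h1 := htilt hxs (hr0 k) ((hap0 k).mono (hN k hk.le).le) x
      ⟨hxs, Metric.mem_ball_self (by have := hr0 k; linarith)⟩
    rw [sub_self, smul_zero, ← norm_rebase] at h1
    rw [dist_zero_right]
    have := min_le_left (η / 2) (1 / 2)
    exact (h1.trans this).trans_lt (by linarith)
  set K : ℝ := 8 ^ n * C ^ 2 with hK
  have hK0 : 0 < K := by positivity
  have het : Tendsto (fun k => 8 * (16 * 8 ^ n * K * (4 * C ^ 2 * ε k + ε (k + 1)))) atTop
      (𝓝 0) := by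
    have h1 := ((hεt.const_mul (4 * C ^ 2)).add ((tendsto_add_atTop_iff_nat 1).2 hεt)).const_mul
      (8 * (16 * 8 ^ n * K))
    simp only [mul_zero, add_zero] at h1
    refine h1.congr fun k => by ring
  -- Below `1/8` the base point stays below `1/2` after rescaling to the next scale, a factor of at
  -- most `4`.
  obtain ⟨N, hN⟩ := eventually_atTop.1
    ((het.eventually (gt_mem_nhds one_pos)).and
      (hpt.norm.eventually (gt_mem_nhds (by norm_num : ‖(0 : E n)‖ < 1 / 8))))
  have hstep : ∀ k, N ≤ k → d (k + 1) = d k := by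
    intro k hk
    set t := r (k + 1) / r k with ht
    have ht0 : 0 < t := div_pos (hr0 _) (hr0 _)
    have ht4 : t⁻¹ ≤ 4 := by rw [ht, inv_div, div_le_iff₀ (hr0 _)]; exact hr2 k
    have ht1 : t ≤ 1 := (div_le_one (hr0 _)).2 (hr1 k)
    have hfc := (hap k).flatClose hxs hC (hap (k + 1)) (hr0 _) (hr1 k) (hr2 k)
    rw [← ht] at hfc
    have hcl := ((hap k).scaled_coeff_bounds hxs hC (hr0 (k + 1)) (hr1 k) (hr2 k)).1
    rw [← ht] at hcl
    have hc'l : K⁻¹ ≤ c (k + 1) := (hap (k + 1)).inv_le_coeff hC.1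
    have hpn : ‖t⁻¹ • p k‖ < 1 / 2 := by
      rw [norm_smul, Real.norm_of_nonneg (by positivity)]
      have := (hN k hk).2
      nlinarith [norm_nonneg (p k)]
    exact le_antisymm
      (hfc.dim_le hK0 hc'l (hap _).le_n hpn (hap _).norm_p (hN k hk).1)
      (hfc.symm.dim_le hK0 hcl (hap _).le_n (hap _).norm_p hpn (hN k hk).1)
  have hdN : ∀ k, d (k + N) = d N := by
    intro k
    induction k with
    | zero => simp
    | succ k ih => rw [← ih, ← hstep (k + N) (by omega)]; congr 1; omega
  -- The type of `L (k + N)` depends on `d (k + N)`; the isometry is transported along the equality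
  -- with `d N`.
  have hcast : ∀ k, ∃ L' : E (d N) →ₗᵢ[ℝ] E n,
      Approx μ x (r (k + N)) (ε (k + N)) (d N) (p (k + N)) L' (c (k + N)) := by
    intro k
    have h1 := hap (k + N)
    generalize L (k + N) = L0 at h1
    revert h1 L0
    rw [hdN k]
    exact fun L0 h1 => ⟨L0, h1⟩
  choose L' hL' using hcast
  refine ⟨d N, fun k => r (k + N), fun k => ε (k + N), fun k => p (k + N), L',
    fun k => c (k + N), fun k => ⟨hr0 _, ?_, ?_⟩, (tendsto_add_atTop_iff_nat N).2 hrt,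
    (summable_nat_add_iff N).2 hsum, fun k => hε _, hL', (tendsto_add_atTop_iff_nat N).2 hpt,
    fun k => (hN (k + N) (by omega)).2, fun k => ?_⟩
  · have := hr1 (k + N); rwa [show k + N + 1 = k + 1 + N by omega] at this
  · have := hr2 (k + N); rwa [show k + N + 1 = k + 1 + N by omega] at this
  · have := (hN (k + N) (by omega)).1; rwa [show k + N + 1 = k + 1 + N by omega] at this

theorem exists_flatLimit (hC : DoublingWith μ C) (hx : x ∈ goodSet μ) :
    ∃ (d : ℕ) (r ε : ℕ → ℝ) (p : ℕ → E n) (L : ℕ → E d →ₗᵢ[ℝ] E n) (c : ℕ → ℝ)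
      (M : E d →ₗᵢ[ℝ] E n) (θ : ℝ), FlatLimit μ x d r ε p L c M θ := by
  obtain ⟨d, r, ε, p, L, c, hr, hrt, hsum, hε, hap, hpt, hp8, hsmall⟩ := exists_approx_seq hC hx
  have hxs := hx.1
  have hC0 : 0 < C := zero_lt_one.trans_le hC.1
  set K : ℝ := 8 ^ n * C ^ 2 with hK
  have hK0 : 0 < K := by positivity
  set e : ℕ → ℝ := fun k => 4 * C ^ 2 * ε k + ε (k + 1) with he
  have hes : Summable e := (hsum.mul_left _).add ((summable_nat_add_iff 1).2 hsum)
  have he0 : ∀ k, 0 ≤ e k := fun k => by have := hε k; have := hε (k + 1); positivity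
  have hfc : ∀ k, FlatClose (e k) ((r (k + 1) / r k)⁻¹ • p k) (L k)
      (c k * (r (k + 1) / r k) ^ d *
        (μ.real (Metric.ball x (r k)) / μ.real (Metric.ball x (r (k + 1)))))
      (p (k + 1)) (L (k + 1)) (c (k + 1)) := fun k =>
    (hap k).flatClose hxs hC (hap (k + 1)) (hr _).1 (hr k).2.1 (hr k).2.2
  have hpn : ∀ k, ‖(r (k + 1) / r k)⁻¹ • p k‖ < 1 / 2 := fun k => by
    have ht4 : (r (k + 1) / r k)⁻¹ ≤ 4 := by
      rw [inv_div, div_le_iff₀ (hr _).1]; exact (hr k).2.2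
    have : 0 < (r (k + 1) / r k)⁻¹ := inv_pos.2 (div_pos (hr _).1 (hr _).1)
    rw [norm_smul, Real.norm_of_nonneg this.le]
    have := hp8 k
    nlinarith [norm_nonneg (p k)]
  have hb := fun k => (hap k).scaled_coeff_bounds hxs hC (hr (k + 1)).1 (hr k).2.1 (hr k).2.2
  have hc' := fun k => (hap k).inv_le_coeff hC.1
  have hcpos : ∀ k, 0 < c k := fun k => lt_of_lt_of_le (by positivity) (hap k).le_c
  have hmpos : ∀ k, 0 < μ.real (Metric.ball x (r k)) := fun k =>
    measureReal_ball_pos hxs (hr k).1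
  have hrpos : ∀ k, 0 < r k := fun k => (hr k).1
  -- convergence of the densities
  have hD : ∀ k, |c k * μ.real (Metric.ball x (r k)) / r k ^ d -
      c (k + 1) * μ.real (Metric.ball x (r (k + 1))) / r (k + 1) ^ d| ≤
      (2 ^ n * (16 ^ (n + 1) * (1 + K * (16 * 8 ^ n * K)))) * e k *
        (c (k + 1) * μ.real (Metric.ball x (r (k + 1))) / r (k + 1) ^ d) := by
    intro k
    have h1 := (hfc k).coeff_le hK0 (hb k).1 (hb k).2 (hc' (k + 1)) (hap k).le_n (hpn k)
      (hap (k + 1)).norm_p (hsmall k)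
    set m := μ.real (Metric.ball x (r k))
    set m' := μ.real (Metric.ball x (r (k + 1))) with hm'
    have e1 : c k * m / r k ^ d - c (k + 1) * m' / r (k + 1) ^ d =
        (c k * (r (k + 1) / r k) ^ d * (m / m') - c (k + 1)) * (m' / r (k + 1) ^ d) := by
      have := hrpos k
      have := hrpos (k + 1)
      have := hmpos (k + 1)
      rw [← hm'] at this
      rw [div_pow]
      field_simp
    have hq : 0 < m' / r (k + 1) ^ d := div_pos (hmpos _) (pow_pos (hrpos _) _)
    rw [e1, abs_mul, abs_of_pos hq]
    -- This inserts `c (k + 1)` on the right, turning the absolute error into one relative to the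
    -- next density.
    have h2 : (1 : ℝ) ≤ 2 ^ n * c (k + 1) := by
      have := (hap (k + 1)).le_c
      rwa [inv_le_iff_one_le_mul₀' (by positivity)] at this
    have h3 : 16 ^ (n + 1) * (e k + K * (16 * 8 ^ n * K * e k)) =
      (16 ^ (n + 1) * (1 + K * (16 * 8 ^ n * K))) * e k := by ring
    change _ ≤ 16 ^ (n + 1) * (e k + K * (16 * 8 ^ n * K * e k)) at h1
    rw [h3] at h1
    set G := (16 ^ (n + 1) * (1 + K * (16 * 8 ^ n * K))) with hG
    have hGe : 0 ≤ G * e k := mul_nonneg (by positivity) (he0 k)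
    calc _ ≤ G * e k * (m' / r (k + 1) ^ d) := mul_le_mul_of_nonneg_right h1 hq.le
      _ ≤ G * e k * (m' / r (k + 1) ^ d) * (2 ^ n * c (k + 1)) :=
        le_mul_of_one_le_right (mul_nonneg hGe hq.le) h2
      _ = _ := by ring
  obtain ⟨θ, hθ, hθt⟩ := exists_tendsto_pos_of_ratio
    (fun k => div_pos (mul_pos (hcpos k) (hmpos k)) (pow_pos (hrpos k) d))
    (hes.mul_left _) hD
  -- convergence of the directions
  have hA : ∀ k, dist (dir (L k)).starProjection (dir (L (k + 1))).starProjection ≤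
      2 * (8 * (16 * 8 ^ n * K)) * e k := by
    intro k
    have h1 := (hfc k).norm_orthogonal_le hK0 (hc' (k + 1)) (hap k).le_n (hpn k)
      (hap (k + 1)).norm_p
    have h2 := (hfc k).symm.norm_orthogonal_le hK0 (hb k).1 (hap k).le_n (hap (k + 1)).norm_p
      (hpn k)
    have := starProjection_dist_le h1 h2 (mul_nonneg (by norm_num)
      (mul_nonneg (by positivity) (he0 k)))
    rw [dist_eq_norm]
    refine this.trans (le_of_eq (by ring))
  obtain ⟨A, hAt⟩ := cauchySeq_tendsto_of_complete
    (cauchySeq_of_dist_le_of_summable _ hA (hes.mul_left _))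
  -- The limit of the projections is again the projection onto a `d`-plane, since the isometries
  -- converge along a subsequence.
  obtain ⟨M, φ, hφ, hM⟩ := exists_subseq_linearIsometry L
  have hAM : A = (dir M).starProjection :=
    tendsto_nhds_unique (hAt.comp hφ.tendsto_atTop) (tendsto_starProjection_dir hM)
  exact ⟨d, r, ε, p, L, c, M, θ, (hap 0).le_n, hθ, hrpos, fun k => (hr k).2.1,
    fun k => (hr k).2.2, hrt, hsum.tendsto_atTop_zero, hap, hpt, hθt, hAM ▸ hAt⟩

end

/-! ### Convergence of the blow-ups -/

theorem integral_plane_eq_of_dir_eq {n d : ℕ} {L M : E d →ₗᵢ[ℝ] E n} (h : dir L = dir M)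
    (f : E n → ℝ) : ∫ s, f (L s) ∂(hausd d d) = ∫ s, f (M s) ∂(hausd d d) := by
  have h1 := integral_restrict_plane 0 L f
  have h2 := integral_restrict_plane 0 M f
  simp only [zero_add] at h1 h2
  rw [← h1, ← h2]
  have : Set.range L = Set.range M := by
    ext z
    exact SetLike.ext_iff.1 h z
  rw [this]

/-- Only the ranges of the `L i` converge, not the parametrizations. Along subsequences the
parametrizations do converge, to an isometry with range `dir M`, and the integral depends only on
the range. -/
theorem tendsto_integral_plane {n d : ℕ} {ι : Type*} {l : Filter ι} [l.IsCountablyGenerated]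
    {q : ι → E n} {L : ι → E d →ₗᵢ[ℝ] E n} {M : E d →ₗᵢ[ℝ] E n} (hq : Tendsto q l (𝓝 0))
    (hL : Tendsto (fun i => (dir (L i)).starProjection) l (𝓝 (dir M).starProjection))
    {f : E n → ℝ} (hf : Continuous f) (hs : HasCompactSupport f) :
    Tendsto (fun i => ∫ s, f (q i + L i s) ∂(hausd d d)) l
      (𝓝 (∫ s, f (M s) ∂(hausd d d))) := by
  refine tendsto_of_subseq_tendsto fun ns hns => ?_
  obtain ⟨M', φ, hφ, hM'⟩ := exists_subseq_linearIsometry fun k => L (ns k)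
  refine ⟨φ, ?_⟩
  have hdir : dir M' = dir M :=
    Submodule.starProjection_inj.1 (tendsto_nhds_unique (tendsto_starProjection_dir hM')
      (hL.comp (hns.comp hφ.tendsto_atTop)))
  rw [← integral_plane_eq_of_dir_eq hdir]
  obtain ⟨B, hB⟩ := hf.bounded_above_of_compact_support hs
  obtain ⟨R, hR⟩ := hs.isCompact.isBounded.subset_ball 0
  have hqφ : Tendsto (fun k => q (ns (φ k))) atTop (𝓝 0) := hq.comp (hns.comp hφ.tendsto_atTop)
  refine tendsto_integral_filter_of_dominated_convergence
    ((Metric.ball (0 : E d) (R + 1)).indicator fun _ => B) ?_ ?_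
    (integrable_indicator_ball B (R + 1)) ?_
  · exact Eventually.of_forall fun k =>
      (integrable_plane _ (L (ns (φ k))) hf hs).aestronglyMeasurable
  · filter_upwards [Metric.tendsto_nhds.1 hqφ 1 one_pos] with k hk
    refine Eventually.of_forall fun s => ?_
    by_cases h0 : f (q (ns (φ k)) + L (ns (φ k)) s) = 0
    · rw [h0, norm_zero]
      exact Set.indicator_nonneg (fun _ _ => (norm_nonneg _).trans (hB 0)) _
    · have h1 : q (ns (φ k)) + L (ns (φ k)) s ∈ Metric.ball (0 : E n) R :=
        hR (subset_tsupport f h0)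
      rw [Metric.mem_ball, dist_zero_right] at h1
      rw [dist_zero_right] at hk
      rw [Set.indicator_of_mem]
      · exact hB _
      · rw [Metric.mem_ball, dist_zero_right, ← (L (ns (φ k))).norm_map s]
        calc ‖L (ns (φ k)) s‖ = ‖(q (ns (φ k)) + L (ns (φ k)) s) - q (ns (φ k))‖ := by
              rw [add_sub_cancel_left]
          _ ≤ _ := norm_sub_le _ _
          _ < R + 1 := by linarith
  · refine Eventually.of_forall fun s => ?_
    have h1 : Tendsto (fun k => q (ns (φ k)) + L (ns (φ k)) s) atTop (𝓝 (0 + M' s)) :=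
      hqφ.add (((ContinuousLinearMap.apply ℝ (E n) s).continuous.tendsto _).comp hM')
    rw [zero_add] at h1
    exact (hf.tendsto _).comp h1

/-- Mollification at a scale `ρ ≤ 1` enlarges the support by at most `1`, and a compactly supported
smooth function is Lipschitz. -/
theorem exists_lipschitz_approx {n : ℕ} {f : E n → ℝ} (hf : Continuous f) {R : ℝ}
    (hs : Function.support f ⊆ Metric.ball 0 R) {η : ℝ} (hη : 0 < η) :
    ∃ (ℓ : ℝ≥0) (g : E n → ℝ), 0 < ℓ ∧ LipschitzWith ℓ g ∧
      Function.support g ⊆ Metric.ball 0 (R + 1) ∧ ∀ z, |f z - g z| ≤ η := by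
  have hcs := hasCompactSupport_of_support_subset_ball hs
  obtain ⟨δ, hδ, hfδ⟩ := Metric.uniformContinuous_iff.1
    (hcs.uniformContinuous_of_continuous hf) η hη
  set ρ := min δ 1
  have hρ : 0 < ρ := lt_min hδ one_pos
  obtain ⟨g, hg, hgf⟩ := hf.exists_contDiff_dist_le_of_forall_mem_ball_dist_le hρ
  have hgs : Function.support g ⊆ Metric.ball 0 (R + 1) := by
    intro z hz
    by_contra hzn
    rw [Metric.mem_ball, dist_zero_right, not_lt] at hzn
    have h0 : ∀ w ∈ Metric.ball z ρ, f w = 0 := by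
      intro w hw
      by_contra hne
      have h1 := hs hne
      rw [Metric.mem_ball, dist_zero_right] at h1
      rw [Metric.mem_ball, dist_eq_norm, norm_sub_rev] at hw
      have h2 := norm_sub_norm_le z w
      have h3 : ρ ≤ 1 := min_le_right _ _
      linarith
    have hz0 := h0 z (Metric.mem_ball_self hρ)
    have := hgf z 0 fun w hw => by rw [h0 w hw, hz0, dist_self]
    rw [hz0] at this
    exact hz (dist_le_zero.1 this)
  obtain ⟨ℓ, hℓ⟩ := hg.lipschitzWith_of_hasCompactSupport
    (hasCompactSupport_of_support_subset_ball hgs) (by simp)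
  refine ⟨ℓ + 1, g, by positivity, hℓ.weaken (by simp), hgs, fun z => ?_⟩
  rw [← Real.dist_eq, dist_comm]
  exact hgf z η fun w hw => (hfδ (hw.trans_le (min_le_left _ _))).le

/-! ### From the discrete scales `r k` to all small radii -/

section FlatLimit
variable {n d : ℕ} {μ : Measure (E n)} {x : E n} {r ε : ℕ → ℝ} {p : ℕ → E n}
    {L : ℕ → E d →ₗᵢ[ℝ] E n} {c : ℕ → ℝ} {M : E d →ₗᵢ[ℝ] E n} {θ : ℝ}

theorem FlatLimit.antitone (h : FlatLimit μ x d r ε p L c M θ) : Antitone r :=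
  antitone_nat_of_succ_le h.r_anti

/-- The index is the last one with `R * s ≤ r k`; then `r k ≤ 4 * r (k + 1) < 4 * (R * s)`. -/
theorem FlatLimit.exists_index (h : FlatLimit μ x d r ε p L c M θ) {R : ℝ} (hR : 0 < R) :
    ∃ k : ℝ → ℕ, Tendsto k (𝓝[>] 0) atTop ∧
      ∀ᶠ s in 𝓝[>] (0 : ℝ), 0 < s ∧ R * s ≤ r (k s) ∧ r (k s) ≤ 4 * (R * s) := by
  have hex : ∀ s : ℝ, ∃ k, 0 < s → R * s ≤ r 0 → R * s ≤ r k ∧ r (k + 1) < R * s := by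
    intro s
    by_cases hs : 0 < s ∧ R * s ≤ r 0
    · have hRs : 0 < R * s := mul_pos hR hs.1
      have hlt : ∃ k, r k < R * s := (h.r_tendsto.eventually (gt_mem_nhds hRs)).exists
      classical
      have hspec := Nat.find_spec hlt
      have hne : Nat.find hlt ≠ 0 := fun h0 => by
        rw [h0] at hspec; exact absurd hspec (not_lt.2 hs.2)
      obtain ⟨k, hk⟩ := Nat.exists_eq_succ_of_ne_zero hne
      refine ⟨k, fun _ _ => ⟨?_, ?_⟩⟩
      · exact not_lt.1 (Nat.find_min hlt (by omega))
      · rw [hk] at hspec; exact hspec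
    · exact ⟨0, fun h1 h2 => absurd ⟨h1, h2⟩ hs⟩
  choose k hk using hex
  have hev : ∀ N, ∀ᶠ s in 𝓝[>] (0 : ℝ), 0 < s ∧ R * s ≤ r N := by
    intro N
    have : 0 < r N / R := div_pos (h.r_pos N) hR
    filter_upwards [Ioo_mem_nhdsGT this] with s hs
    refine ⟨hs.1, ?_⟩
    have := hs.2.le
    rw [le_div_iff₀ hR] at this
    linarith
  refine ⟨k, ?_, ?_⟩
  · rw [tendsto_atTop]
    intro N
    filter_upwards [hev N] with s hs
    have h0 := hk s hs.1 (hs.2.trans (h.antitone (Nat.zero_le N)))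
    by_contra hcon
    push Not at hcon
    exact absurd (hs.2.trans (h.antitone (by omega : k s + 1 ≤ N))) (not_le.2 h0.2)
  · filter_upwards [hev 0] with s hs
    have h0 := hk s hs.1 hs.2
    refine ⟨hs.1, h0.1, (h.r_le _).trans ?_⟩
    linarith [h0.2]

theorem FlatLimit.tendsto_integral_lipschitz (h : FlatLimit μ x d r ε p L c M θ)
    (hm : ∀ s, 0 < s → 0 < μ.real (Metric.ball x s))
    {ℓ : ℝ≥0} (hℓ : 0 < ℓ) {f : E n → ℝ} (hf : LipschitzWith ℓ f) {R : ℝ} (hR : 0 < R)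
    (hs : Function.support f ⊆ Metric.ball 0 R) :
    Tendsto (fun s : ℝ => (s ^ d)⁻¹ * ∫ y, f (s⁻¹ • (y - x)) ∂μ) (𝓝[>] 0)
      (𝓝 (θ * ∫ u, f (M u) ∂(hausd d d))) := by
  obtain ⟨k, hk, hks⟩ := h.exists_index hR
  have hcs := hasCompactSupport_of_support_subset_ball hs
  have hq : Tendsto (fun s : ℝ => (s / r (k s))⁻¹ • p (k s)) (𝓝[>] 0) (𝓝 0) := by
    have h1 : Tendsto (fun s => 4 * R * ‖p (k s)‖) (𝓝[>] (0 : ℝ)) (𝓝 0) := by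
      simpa using ((h.p_tendsto.comp hk).norm).const_mul (4 * R)
    refine squeeze_zero_norm' ?_ h1
    filter_upwards [hks] with s hs
    have : (s / r (k s))⁻¹ ≤ 4 * R := by
      rw [inv_div, div_le_iff₀ hs.1]; linarith [hs.2.2]
    rw [norm_smul, Real.norm_of_nonneg (inv_nonneg.2 (div_nonneg hs.1.le (h.r_pos _).le))]
    exact mul_le_mul_of_nonneg_right this (norm_nonneg _)
  have hmain := (h.density.comp hk).mul
    (tendsto_integral_plane hq (h.proj.comp hk) hf.continuous hcs)
  have herr : Tendsto (fun s => 4 * R * ℓ * ε (k s) * ((2 ^ n * (4 * R) ^ d) *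
      (c (k s) * μ.real (Metric.ball x (r (k s))) / r (k s) ^ d))) (𝓝[>] 0) (𝓝 0) := by
    have := ((h.ε_tendsto.comp hk).const_mul (4 * R * (ℓ : ℝ))).mul
      ((h.density.comp hk).const_mul (2 ^ n * (4 * R) ^ d))
    simpa using this
  refine hmain.congr_dist (squeeze_zero' (Eventually.of_forall fun _ => dist_nonneg) ?_ herr)
  filter_upwards [hks] with s hss
  obtain ⟨hs0, hs1, hs2⟩ := hss
  set j := k s with hj
  have hrj := h.r_pos j
  set t := s / r j with ht
  have ht0 : 0 < t := div_pos hs0 hrj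
  have htr : t * r j = s := div_mul_cancel₀ _ hrj.ne'
  have hti : t⁻¹ ≤ 4 * R := by rw [ht, inv_div, div_le_iff₀ hs0]; linarith
  have hRt : R ≤ t⁻¹ := by rw [ht, inv_div, le_div_iff₀ hs0]; exact hs1
  have hcl := (h.approx j).close_scaled ht0 hℓ hf (hs.trans (Metric.ball_subset_ball hRt))
  rw [htr] at hcl
  have hε : 0 ≤ ε j := by
    have := (h.approx j).close (fun _ => 0) (LipschitzWith.const' 0) (by simp)
    exact (abs_nonneg _).trans this
  set m := μ.real (Metric.ball x (r j)) with hmdef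
  have hm0 : 0 < m := hm _ hrj
  set I := ∫ y, f (s⁻¹ • (y - x)) ∂μ with hI
  set J := ∫ u, f (t⁻¹ • p j + L j u) ∂(hausd d d) with hJ
  have hc0 : 0 < c j := lt_of_lt_of_le (by positivity) (h.approx j).le_c
  have hc2 : (1 : ℝ) ≤ 2 ^ n * c j := by
    have := (h.approx j).le_c
    rwa [inv_le_iff_one_le_mul₀' (by positivity)] at this
  have hst : s = t * r j := htr.symm
  have e : c j * m / r j ^ d * J - (s ^ d)⁻¹ * I =
      -((m / s ^ d) * (m⁻¹ * I - c j * t ^ d * J)) := by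
    rw [hst, mul_pow]
    field_simp
    ring
  -- The approximation error is relative to the mass `m`; this bounds `m / s ^ d` by a multiple of a
  -- convergent sequence, so the error still tends to zero.
  have hms : m / s ^ d ≤ (2 ^ n * (4 * R) ^ d) * (c j * m / r j ^ d) := by
    have e1 : m / s ^ d = (t⁻¹) ^ d * (m / r j ^ d) := by
      rw [hst, mul_pow, inv_pow]; field_simp
    rw [e1]
    have h1 : t⁻¹ ^ d ≤ (4 * R) ^ d := pow_le_pow_left₀ (by positivity) hti d
    have h2 : 0 < m / r j ^ d := by positivity
    calc t⁻¹ ^ d * (m / r j ^ d) ≤ (4 * R) ^ d * (m / r j ^ d) :=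
          mul_le_mul_of_nonneg_right h1 h2.le
      _ ≤ (4 * R) ^ d * (m / r j ^ d) * (2 ^ n * c j) :=
          le_mul_of_one_le_right (by positivity) hc2
      _ = _ := by ring
  simp only [Function.comp_apply, ← hj]
  rw [Real.dist_eq]
  change |c j * m / r j ^ d * J - (s ^ d)⁻¹ * I| ≤ _
  rw [e, abs_neg, abs_mul, abs_of_pos (by positivity : 0 < m / s ^ d), mul_comm]
  refine mul_le_mul ?_ hms (by positivity) (by positivity)
  calc _ ≤ ε j * (ℓ / t) := hcl
    _ = ε j * ℓ * t⁻¹ := by ring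
    _ ≤ ε j * ℓ * (4 * R) := mul_le_mul_of_nonneg_left hti (by positivity)
    _ = _ := by ring

end FlatLimit

/-- A Lipschitz cutoff: `1` on `B(0, a - η)` and `0` outside of `B(0, a)`. -/
noncomputable def cutoff {n : ℕ} (a η : ℝ) (z : E n) : ℝ := min 1 (η⁻¹ * max 0 (a - ‖z‖))

section cutoff
variable {n : ℕ} {a η : ℝ}

theorem cutoff_nonneg (hη : 0 < η) (z : E n) : 0 ≤ cutoff a η z :=
  le_min zero_le_one (mul_nonneg (inv_nonneg.2 hη.le) (le_max_left _ _))

theorem cutoff_le_one (z : E n) : cutoff a η z ≤ 1 := min_le_left _ _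

theorem cutoff_eq_one (hη : 0 < η) {z : E n} (hz : ‖z‖ ≤ a - η) : cutoff a η z = 1 := by
  refine min_eq_left ?_
  have : η ≤ max 0 (a - ‖z‖) := le_max_of_le_right (by linarith)
  calc (1 : ℝ) = η⁻¹ * η := (inv_mul_cancel₀ hη.ne').symm
    _ ≤ _ := mul_le_mul_of_nonneg_left this (inv_nonneg.2 hη.le)

theorem support_cutoff : Function.support (cutoff a η : E n → ℝ) ⊆ Metric.ball 0 a := by
  intro z hz
  rw [Metric.mem_ball, dist_zero_right]
  by_contra hcon
  refine hz ?_
  have : max 0 (a - ‖z‖) = 0 := max_eq_left (by linarith)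
  rw [cutoff, this, mul_zero]
  norm_num

theorem lipschitzWith_cutoff (hη : 0 < η) :
    LipschitzWith (Real.toNNReal η⁻¹) (cutoff a η : E n → ℝ) := by
  have h1 : LipschitzWith (Real.toNNReal η⁻¹) fun z : E n => η⁻¹ * max 0 (a - ‖z - 0‖) := by
    refine LipschitzWith.of_dist_le_mul fun z w => ?_
    have h := (lipschitzWith_cone (0 : E n) a).dist_le_mul z w
    rw [Real.dist_eq, ← mul_sub, abs_mul, abs_of_pos (inv_pos.2 hη), ← Real.dist_eq,
      Real.coe_toNNReal _ (inv_pos.2 hη).le]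
    refine mul_le_mul_of_nonneg_left (h.trans (by simp)) (inv_pos.2 hη).le
  simp only [sub_zero] at h1
  exact h1.const_min 1

theorem le_integral_cutoff_plane {d : ℕ} (M : E d →ₗᵢ[ℝ] E n) (hη : 0 < η) (ha : η < a) :
    (a - η) ^ d ≤ ∫ u, cutoff a η (M u) ∂(hausd d d) := by
  have h1 := integrable_plane 0 M (lipschitzWith_cutoff (n := n) (a := a) hη).continuous
    (hasCompactSupport_of_support_subset_ball support_cutoff)
  simp only [zero_add] at h1
  have h2 := integral_mono (integrable_indicator_ball (1 : ℝ) (a - η)) h1 fun u => by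
    by_cases hu : u ∈ Metric.ball (0 : E d) (a - η)
    · rw [Set.indicator_of_mem hu, cutoff_eq_one hη]
      rw [M.norm_map]
      exact (mem_ball_zero_iff.1 hu).le
    · rw [Set.indicator_of_notMem hu]; exact cutoff_nonneg hη _
  rwa [indicator_ball_integral _ (by linarith), mul_one] at h2

theorem integral_cutoff_plane_le {d : ℕ} (M : E d →ₗᵢ[ℝ] E n) (hη : 0 < η) (ha : 0 < a) :
    ∫ u, cutoff a η (M u) ∂(hausd d d) ≤ a ^ d := by
  have h1 := integrable_plane 0 M (lipschitzWith_cutoff (n := n) (a := a) hη).continuous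
    (hasCompactSupport_of_support_subset_ball support_cutoff)
  simp only [zero_add] at h1
  have h2 := integral_mono h1 (integrable_indicator_ball (1 : ℝ) a) fun u => by
    by_cases hu : u ∈ Metric.ball (0 : E d) a
    · rw [Set.indicator_of_mem hu]; exact cutoff_le_one _
    · rw [Set.indicator_of_notMem hu]
      refine le_of_eq (Function.notMem_support.1 fun hc => hu ?_)
      have := support_cutoff hc
      rw [mem_ball_zero_iff, M.norm_map] at this
      exact mem_ball_zero_iff.2 this
  rwa [indicator_ball_integral _ ha, mul_one] at h2

end cutoff

section
variable {n d : ℕ} {μ : Measure (E n)} [IsLocallyFiniteMeasure μ] {x : E n}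

theorem integrable_rescaled (μ : Measure (E n)) [IsLocallyFiniteMeasure μ] (x : E n) {s : ℝ}
    (hs : 0 < s) {f : E n → ℝ} (hf : Continuous f)
    (hc : HasCompactSupport f) : Integrable (fun y => f (s⁻¹ • (y - x))) μ := by
  let e : E n ≃ₜ E n := (Homeomorph.subRight x).trans (Homeomorph.smulOfNeZero s⁻¹ (by positivity))
  exact (hf.comp e.continuous).integrable_of_hasCompactSupport (hc.comp_homeomorph e)

theorem norm_rescale_lt_iff {x y : E n} {s a : ℝ} (hs : 0 < s) :
    ‖s⁻¹ • (y - x)‖ < a ↔ y ∈ Metric.ball x (a * s) := by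
  rw [norm_smul, norm_inv, Real.norm_of_nonneg hs.le, inv_mul_lt_iff₀ hs, Metric.mem_ball,
    dist_eq_norm, mul_comm]

theorem integrable_indicator_ball' (μ : Measure (E n)) [IsLocallyFiniteMeasure μ] (x : E n)
    (a ρ : ℝ) : Integrable ((Metric.ball x ρ).indicator fun _ => a) μ :=
  (integrable_indicator_iff Metric.isOpen_ball.measurableSet).2
    (integrableOn_const measure_ball_lt_top.ne)

theorem integral_cutoff_rescaled_le (x : E n) {s a η : ℝ} (hs : 0 < s) (hη : 0 < η) :
    ∫ y, cutoff a η (s⁻¹ • (y - x)) ∂μ ≤ μ.real (Metric.ball x (a * s)) := by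
  have h1 := integrable_rescaled μ x hs (lipschitzWith_cutoff (n := n) (a := a) hη).continuous
    (hasCompactSupport_of_support_subset_ball support_cutoff)
  have h2 := integral_mono h1 (integrable_indicator_ball' μ x 1 (a * s)) fun y => by
    by_cases hy : y ∈ Metric.ball x (a * s)
    · rw [Set.indicator_of_mem hy]; exact cutoff_le_one _
    · rw [Set.indicator_of_notMem hy]
      refine le_of_eq (Function.notMem_support.1 fun hc => hy ?_)
      rw [← norm_rescale_lt_iff hs]
      exact mem_ball_zero_iff.1 (support_cutoff hc)
  rwa [integral_indicator_const _ Metric.isOpen_ball.measurableSet, smul_eq_mul, mul_one] at h2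

theorem le_integral_cutoff_rescaled (x : E n) {s a η : ℝ} (hs : 0 < s) (hη : 0 < η) :
    μ.real (Metric.ball x ((a - η) * s)) ≤ ∫ y, cutoff a η (s⁻¹ • (y - x)) ∂μ := by
  have h1 := integrable_rescaled μ x hs (lipschitzWith_cutoff (n := n) (a := a) hη).continuous
    (hasCompactSupport_of_support_subset_ball support_cutoff)
  have h2 := integral_mono (integrable_indicator_ball' μ x 1 ((a - η) * s)) h1 fun y => by
    by_cases hy : y ∈ Metric.ball x ((a - η) * s)
    · rw [Set.indicator_of_mem hy, cutoff_eq_one hη]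
      exact ((norm_rescale_lt_iff hs).2 hy).le
    · rw [Set.indicator_of_notMem hy]; exact cutoff_nonneg hη _
  rwa [integral_indicator_const _ Metric.isOpen_ball.measurableSet, smul_eq_mul, mul_one] at h2

variable {r ε : ℕ → ℝ} {p : ℕ → E n}
    {L : ℕ → E d →ₗᵢ[ℝ] E n} {c : ℕ → ℝ} {M : E d →ₗᵢ[ℝ] E n} {θ : ℝ}

/-- Indicators of balls are squeezed between the cutoffs `cutoff 1 η` and `cutoff (1 + η) η`, whose
plane integrals are at least `(1 - η) ^ d` and at most `(1 + η) ^ d`. -/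
theorem FlatLimit.tendsto_density (h : FlatLimit μ x d r ε p L c M θ)
    (hm : ∀ s, 0 < s → 0 < μ.real (Metric.ball x s)) :
    Tendsto (fun s : ℝ => μ.real (Metric.ball x s) / s ^ d) (𝓝[>] 0) (𝓝 θ) := by
  have hcut : ∀ a η : ℝ, 0 < a → 0 < η → Tendsto
      (fun s : ℝ => (s ^ d)⁻¹ * ∫ y, cutoff a η (s⁻¹ • (y - x)) ∂μ) (𝓝[>] 0)
      (𝓝 (θ * ∫ u, cutoff a η (M u) ∂(hausd d d))) := fun a η ha hη =>
    h.tendsto_integral_lipschitz hm (Real.toNNReal_pos.2 (inv_pos.2 hη))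
      (lipschitzWith_cutoff hη) ha support_cutoff
  have hpos : ∀ᶠ s in 𝓝[>] (0 : ℝ), 0 < s := eventually_mem_nhdsWithin
  refine tendsto_order.2 ⟨fun u hu => ?_, fun u hu => ?_⟩
  · have h1 : Tendsto (fun η : ℝ => θ * (1 - η) ^ d) (𝓝[>] 0) (𝓝 θ) := by
      have : Continuous fun η : ℝ => θ * (1 - η) ^ d := by fun_prop
      simpa using (this.tendsto 0).mono_left nhdsWithin_le_nhds
    obtain ⟨η, hηu, hη0, hη1⟩ := ((h1.eventually (lt_mem_nhds hu)).and
      (Ioo_mem_nhdsGT (one_pos : (0 : ℝ) < 1))).exists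
    have h2 : u < θ * ∫ u, cutoff 1 η (M u) ∂(hausd d d) :=
      hηu.trans_le (mul_le_mul_of_nonneg_left (le_integral_cutoff_plane M hη0 hη1) h.θ_pos.le)
    filter_upwards [(hcut 1 η one_pos hη0).eventually (lt_mem_nhds h2), hpos] with s hs hs0
    refine hs.trans_le ?_
    rw [div_eq_inv_mul]
    refine mul_le_mul_of_nonneg_left ?_ (by positivity)
    simpa using integral_cutoff_rescaled_le (μ := μ) x (a := 1) hs0 hη0
  · have h1 : Tendsto (fun η : ℝ => θ * (1 + η) ^ d) (𝓝[>] 0) (𝓝 θ) := by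
      have : Continuous fun η : ℝ => θ * (1 + η) ^ d := by fun_prop
      simpa using (this.tendsto 0).mono_left nhdsWithin_le_nhds
    obtain ⟨η, hηu, hη0⟩ := ((h1.eventually (gt_mem_nhds hu)).and hpos).exists
    have h2 : θ * (∫ u, cutoff (1 + η) η (M u) ∂(hausd d d)) < u :=
      (mul_le_mul_of_nonneg_left (integral_cutoff_plane_le M hη0 (by linarith))
        h.θ_pos.le).trans_lt hηu
    filter_upwards [(hcut (1 + η) η (by linarith) hη0).eventually (gt_mem_nhds h2), hpos]
      with s hs hs0
    refine lt_of_le_of_lt ?_ hs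
    rw [div_eq_inv_mul]
    refine mul_le_mul_of_nonneg_left ?_ (by positivity)
    simpa using le_integral_cutoff_rescaled (μ := μ) x (a := 1 + η) hs0 hη0

theorem FlatLimit.tendsto_integral (h : FlatLimit μ x d r ε p L c M θ)
    (hm : ∀ s, 0 < s → 0 < μ.real (Metric.ball x s)) {f : E n → ℝ} (hf : Continuous f)
    (hs : HasCompactSupport f) :
    Tendsto (fun s : ℝ => (s ^ d)⁻¹ * ∫ y, f (s⁻¹ • (y - x)) ∂μ) (𝓝[>] 0)
      (𝓝 (θ * ∫ u, f (M u) ∂(hausd d d))) := by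
  obtain ⟨R0, hR0⟩ := hs.isCompact.isBounded.subset_ball 0
  set R := max R0 1 with hRdef
  have hR : 0 < R := lt_max_of_lt_right one_pos
  have hsR : Function.support f ⊆ Metric.ball 0 R :=
    (subset_tsupport f).trans (hR0.trans (Metric.ball_subset_ball (le_max_left _ _)))
  have hpos : ∀ᶠ s in 𝓝[>] (0 : ℝ), 0 < s := eventually_mem_nhdsWithin
  have hdens : Tendsto (fun s : ℝ => (s ^ d)⁻¹ * μ.real (Metric.ball x ((R + 1) * s))) (𝓝[>] 0)
      (𝓝 (θ * (R + 1) ^ d)) := by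
    have h1 : Tendsto (fun s : ℝ => (R + 1) * s) (𝓝[>] 0) (𝓝[>] 0) := by
      refine tendsto_nhdsWithin_iff.2 ⟨?_, ?_⟩
      · have : Continuous fun s : ℝ => (R + 1) * s := by fun_prop
        simpa using (this.tendsto 0).mono_left nhdsWithin_le_nhds
      · filter_upwards [hpos] with s hs
        exact mul_pos (by linarith) hs
    have h2 := ((h.tendsto_density hm).comp h1).mul_const ((R + 1) ^ d)
    refine h2.congr' ?_
    filter_upwards [hpos] with s hs
    simp only [Function.comp_apply]
    rw [mul_pow]
    have : 0 < R + 1 := by linarith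
    field_simp
  rw [Metric.tendsto_nhds]
  intro e he
  set B := θ * (R + 1) ^ d with hB
  have hB0 : 0 < B := mul_pos h.θ_pos (pow_pos (by linarith) _)
  -- Replacing `f` by `g` costs at most `e / 4` on each side, `B + 1` bounding the normalized mass
  -- of the supports; `e / 2` is left for the convergence for `g`.
  set η := e / (4 * (B + 1)) with hη
  have hη0 : 0 < η := by positivity
  obtain ⟨ℓ, g, hℓ, hg, hgs, hfg⟩ := exists_lipschitz_approx hf hsR hη0
  have hgcs := hasCompactSupport_of_support_subset_ball hgs
  have hdiff : ∀ z, |f z - g z| ≤ (Metric.ball (0 : E n) (R + 1)).indicator (fun _ => η) z := by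
    intro z
    by_cases hz : z ∈ Metric.ball (0 : E n) (R + 1)
    · rw [Set.indicator_of_mem hz]; exact hfg z
    · rw [Set.indicator_of_notMem hz]
      have h1 : f z = 0 := Function.notMem_support.1 fun hc =>
        hz (Metric.ball_subset_ball (by linarith) (hsR hc))
      have h2 : g z = 0 := Function.notMem_support.1 fun hc => hz (hgs hc)
      rw [h1, h2]; simp
  have hlim : |(∫ u, f (M u) ∂(hausd d d)) - ∫ u, g (M u) ∂(hausd d d)| ≤ (R + 1) ^ d * η := by
    have i1 := integrable_plane 0 M hf hs
    have i2 := integrable_plane 0 M hg.continuous hgcs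
    simp only [zero_add] at i1 i2
    rw [← integral_sub i1 i2]
    have hpt : ∀ u, |f (M u) - g (M u)| ≤
        (Metric.ball (0 : E d) (R + 1)).indicator (fun _ => η) u := fun u => by
      have h1 := hdiff (M u)
      have h2 : M u ∈ Metric.ball (0 : E n) (R + 1) ↔ u ∈ Metric.ball (0 : E d) (R + 1) := by
        rw [mem_ball_zero_iff, mem_ball_zero_iff, M.norm_map]
      by_cases hu : u ∈ Metric.ball (0 : E d) (R + 1)
      · rw [Set.indicator_of_mem (h2.2 hu)] at h1
        rwa [Set.indicator_of_mem hu]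
      · rw [Set.indicator_of_notMem (fun hc => hu (h2.1 hc))] at h1
        rwa [Set.indicator_of_notMem hu]
    exact abs_integral_le_integral_abs.trans ((integral_mono (i1.sub i2).abs
      (integrable_indicator_ball η (R + 1)) hpt).trans
      (indicator_ball_integral _ (by linarith)).le)
  filter_upwards [hpos, (Metric.tendsto_nhds.1 (h.tendsto_integral_lipschitz hm hℓ hg
      (by linarith : 0 < R + 1) hgs)) (e / 2) (by linarith),
    hdens.eventually (gt_mem_nhds (by linarith : B < B + 1))] with s hs0 hs1 hs2
  have i1 := integrable_rescaled μ x hs0 hf hs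
  have i2 := integrable_rescaled μ x hs0 hg.continuous hgcs
  have hμ : |(∫ y, f (s⁻¹ • (y - x)) ∂μ) - ∫ y, g (s⁻¹ • (y - x)) ∂μ| ≤
      μ.real (Metric.ball x ((R + 1) * s)) * η := by
    rw [← integral_sub i1 i2]
    have hpt : ∀ y, |f (s⁻¹ • (y - x)) - g (s⁻¹ • (y - x))| ≤
        (Metric.ball x ((R + 1) * s)).indicator (fun _ => η) y := fun y => by
      have h1 := hdiff (s⁻¹ • (y - x))
      have h2 : s⁻¹ • (y - x) ∈ Metric.ball (0 : E n) (R + 1) ↔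
          y ∈ Metric.ball x ((R + 1) * s) := by
        rw [mem_ball_zero_iff, norm_rescale_lt_iff hs0]
      by_cases hy : y ∈ Metric.ball x ((R + 1) * s)
      · rw [Set.indicator_of_mem (h2.2 hy)] at h1
        rwa [Set.indicator_of_mem hy]
      · rw [Set.indicator_of_notMem (fun hc => hy (h2.1 hc))] at h1
        rwa [Set.indicator_of_notMem hy]
    refine abs_integral_le_integral_abs.trans ((integral_mono (i1.sub i2).abs
      (integrable_indicator_ball' μ x η ((R + 1) * s)) hpt).trans (le_of_eq ?_))
    rw [integral_indicator_const _ Metric.isOpen_ball.measurableSet, smul_eq_mul]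
  set If := ∫ y, f (s⁻¹ • (y - x)) ∂μ
  set Ig := ∫ y, g (s⁻¹ • (y - x)) ∂μ
  set Jf := ∫ u, f (M u) ∂(hausd d d)
  set Jg := ∫ u, g (M u) ∂(hausd d d)
  rw [Real.dist_eq] at hs1 ⊢
  have hsd : 0 < (s ^ d)⁻¹ := by positivity
  have e1 : |(s ^ d)⁻¹ * If - (s ^ d)⁻¹ * Ig| ≤ (B + 1) * η := by
    rw [← mul_sub, abs_mul, abs_of_pos hsd]
    calc _ ≤ (s ^ d)⁻¹ * (μ.real (Metric.ball x ((R + 1) * s)) * η) :=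
          mul_le_mul_of_nonneg_left hμ hsd.le
      _ = (s ^ d)⁻¹ * μ.real (Metric.ball x ((R + 1) * s)) * η := by ring
      _ ≤ _ := mul_le_mul_of_nonneg_right hs2.le hη0.le
  have e2 : |θ * Jg - θ * Jf| ≤ (B + 1) * η := by
    rw [← mul_sub, abs_mul, abs_of_pos h.θ_pos, abs_sub_comm]
    calc _ ≤ θ * ((R + 1) ^ d * η) := mul_le_mul_of_nonneg_left hlim h.θ_pos.le
      _ = B * η := by rw [hB]; ring
      _ ≤ _ := mul_le_mul_of_nonneg_right (by linarith) hη0.le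
  have e3 : (B + 1) * η = e / 4 := by rw [hη]; field_simp
  rw [e3] at e1 e2
  calc |(s ^ d)⁻¹ * If - θ * Jf| =
      |((s ^ d)⁻¹ * If - (s ^ d)⁻¹ * Ig) + ((s ^ d)⁻¹ * Ig - θ * Jg) + (θ * Jg - θ * Jf)| := by
        congr 1; ring
    _ ≤ |(s ^ d)⁻¹ * If - (s ^ d)⁻¹ * Ig| + |(s ^ d)⁻¹ * Ig - θ * Jg| + |θ * Jg - θ * Jf| :=
        abs_add_three _ _ _
    _ < e := by linarith

end

/-! ### Density, tangent plane and tangent measures at a good point -/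

theorem isLocallyFiniteMeasure_restrict_dir {n d : ℕ} (M : E d →ₗᵢ[ℝ] E n) :
    IsLocallyFiniteMeasure ((hausd n d).restrict (dir M : Set (E n))) := by
  refine ⟨fun z => ⟨Metric.ball z 1, Metric.ball_mem_nhds z one_pos, ?_⟩⟩
  have h : (dir M : Set (E n)) = Set.range fun s => (0 : E n) + M s := by
    ext w; simp [LinearMap.mem_range]
  have hc : Continuous fun s => (0 : E n) + M s := by fun_prop
  rw [h, ← map_hausd, Measure.map_apply hc.measurable Metric.isOpen_ball.measurableSet]
  refine (measure_mono fun s hs => ?_).trans_lt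
    (measure_ball_lt_top (μ := hausd d d) (x := 0) (r := ‖z‖ + 1))
  simp only [zero_add, Set.mem_preimage, Metric.mem_ball, dist_eq_norm] at hs
  rw [mem_ball_zero_iff, ← M.norm_map]
  calc ‖M s‖ = ‖(M s - z) + z‖ := by rw [sub_add_cancel]
    _ ≤ ‖M s - z‖ + ‖z‖ := norm_add_le _ _
    _ < _ := by linarith

theorem integral_restrict_dir {n d : ℕ} (M : E d →ₗᵢ[ℝ] E n) (f : E n → ℝ) :
    ∫ y, f y ∂((hausd n d).restrict (dir M : Set (E n))) = ∫ s, f (M s) ∂(hausd d d) := by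
  have h : (dir M : Set (E n)) = Set.range fun s => (0 : E n) + M s := by
    ext w; simp [LinearMap.mem_range]
  rw [h, integral_restrict_plane]
  simp

theorem ext_of_integral_eq {n : ℕ} {ν ρ : Measure (E n)} [IsLocallyFiniteMeasure ν]
    [IsLocallyFiniteMeasure ρ]
    (h : ∀ f : E n → ℝ, Continuous f → HasCompactSupport f → ∫ y, f y ∂ν = ∫ y, f y ∂ρ) :
    ν = ρ :=
  Measure.ext_of_integral_eq_on_compactlySupported fun f => h f f.continuous f.hasCompactSupport

section
variable {n d : ℕ} {μ : Measure (E n)} [IsLocallyFiniteMeasure μ] {x : E n}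
  {r ε : ℕ → ℝ} {p : ℕ → E n}
    {L : ℕ → E d →ₗᵢ[ℝ] E n} {c : ℕ → ℝ} {M : E d →ₗᵢ[ℝ] E n} {θ : ℝ}

theorem FlatLimit.tendsto_density_ennreal (h : FlatLimit μ x d r ε p L c M θ)
    (hx : x ∈ μ.support) :
    Tendsto (fun s : ℝ => μ (Metric.ball x s) / ENNReal.ofReal s ^ d) (𝓝[>] 0)
      (𝓝 (ENNReal.ofReal θ)) := by
  have h1 := ENNReal.tendsto_ofReal (h.tendsto_density fun s hs => measureReal_ball_pos hx hs)
  refine h1.congr' ?_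
  filter_upwards [(eventually_mem_nhdsWithin : ∀ᶠ s in 𝓝[>] (0 : ℝ), s ∈ Set.Ioi 0)] with s hs
  have hs' : 0 < s := hs
  rw [ENNReal.ofReal_div_of_pos (by positivity), ENNReal.ofReal_pow hs'.le,
    ofReal_measureReal measure_ball_lt_top.ne]

theorem FlatLimit.finrank_dir : Module.finrank ℝ (dir M) = d := by
  rw [LinearMap.finrank_range_of_inj M.injective]; simp

theorem FlatLimit.eventually_orthogonal_le {C : ℝ} (h : FlatLimit μ x d r ε p L c M θ)
    (hC : DoublingWith μ C) (hx : x ∈ μ.support) {e : ℝ} (he : 0 < e) :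
    ∀ᶠ s in 𝓝[>] (0 : ℝ), ∀ y ∈ μ.support ∩ Metric.ball x s,
      ‖(dir M)ᗮ.starProjection (y - x)‖ ≤ e * s := by
  -- With `R = 2`, `B(x,s)` lies in `B(x, r j / 2)` and `r j ≤ 8 * s`, so the offsets contribute at
  -- most `8 * s * (e/24 + e/24)` and the turning of the plane the remaining `e/3 * s`.
  obtain ⟨k, hk, hks⟩ := h.exists_index (R := 2) two_pos
  set η := min (e / 24) (1 / 2) with hη
  have hη0 : 0 < η := lt_min (by linarith) (by norm_num)
  have hηe : η ≤ e / 24 := min_le_left _ _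
  obtain ⟨ε₀, hε₀, htilt⟩ := exists_tilt_bound hC hη0 (min_le_right _ _)
  have hA : ∀ᶠ j in atTop, ‖(dir (L j)).starProjection - (dir M).starProjection‖ < e / 3 := by
    have := Metric.tendsto_nhds.1 h.proj (e / 3) (by linarith)
    simpa only [dist_eq_norm] using this
  have hp : ∀ᶠ j in atTop, ‖p j‖ < e / 24 := by
    have := Metric.tendsto_nhds.1 h.p_tendsto (e / 24) (by linarith)
    simpa only [dist_zero_right] using this
  have hev := (h.ε_tendsto.eventually (gt_mem_nhds hε₀)).and (hA.and hp)
  filter_upwards [hks, hk.eventually hev] with s hs hj y hy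
  obtain ⟨hs0, hs1, hs2⟩ := hs
  obtain ⟨hj1, hj2, hj3⟩ := hj
  set j := k s
  have hrj := h.r_pos j
  have hys : ‖y - x‖ < s := by rw [← dist_eq_norm]; exact hy.2
  have ht := htilt hx hrj ((h.approx j).mono hj1.le) y
    ⟨hy.1, Metric.ball_subset_ball (by linarith) hy.2⟩
  have e1 : (dir (L j))ᗮ.starProjection (y - x) =
      r j • ((dir (L j))ᗮ.starProjection ((r j)⁻¹ • (y - x) - p j) +
        (dir (L j))ᗮ.starProjection (p j)) := by
    rw [← map_add, sub_add_cancel, ← map_smul, smul_smul, mul_inv_cancel₀ hrj.ne', one_smul]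
  have e2 : (dir M)ᗮ.starProjection (y - x) = (dir (L j))ᗮ.starProjection (y - x) +
      ((dir (L j)).starProjection - (dir M).starProjection) (y - x) := by
    rw [starProjection_orthogonal_apply, starProjection_orthogonal_apply, sub_apply]
    abel
  have b1 : ‖(dir (L j))ᗮ.starProjection (y - x)‖ ≤ r j * (e / 24 + e / 24) := by
    rw [e1, norm_smul, Real.norm_of_nonneg hrj.le]
    refine mul_le_mul_of_nonneg_left ((norm_add_le _ _).trans (add_le_add ?_ ?_)) hrj.le
    · exact ht.trans hηe
    · exact (norm_starProjection_le _ _).trans hj3.le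
  have b2 : ‖((dir (L j)).starProjection - (dir M).starProjection) (y - x)‖ ≤ e / 3 * s :=
    (ContinuousLinearMap.le_opNorm _ _).trans
      (mul_le_mul hj2.le hys.le (norm_nonneg _) (by linarith))
  rw [e2]
  refine (norm_add_le _ _).trans ?_
  nlinarith

theorem FlatLimit.isTangentPlane {C : ℝ} (h : FlatLimit μ x d r ε p L c M θ)
    (hC : DoublingWith μ C) (hx : x ∈ μ.support) :
    IsTangentPlane μ.support x d (AffineSubspace.mk' x (dir M)) := by
  refine ⟨AffineSubspace.self_mem_mk' _ _, ?_, ?_⟩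
  · rw [AffineSubspace.direction_mk']; exact FlatLimit.finrank_dir
  rw [ENNReal.tendsto_nhds_zero]
  intro e he
  by_cases hetop : e = ∞
  · exact Eventually.of_forall fun s => hetop ▸ le_top
  have he' : 0 < e.toReal := ENNReal.toReal_pos he.ne' hetop
  filter_upwards [h.eventually_orthogonal_le hC hx he',
    (eventually_mem_nhdsWithin : ∀ᶠ s in 𝓝[>] (0 : ℝ), s ∈ Set.Ioi 0)] with s hs hs0
  have hs0' : 0 < s := hs0
  refine ENNReal.div_le_of_le_mul (iSup₂_le fun y hy => ?_)
  have hmem : x + (dir M).starProjection (y - x) ∈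
      (AffineSubspace.mk' x (dir M) : Set (E n)) := by
    rw [SetLike.mem_coe, AffineSubspace.mem_mk', vsub_eq_sub, add_sub_cancel_left]
    exact Submodule.starProjection_apply_mem _ _
  refine (Metric.infEDist_le_edist_of_mem hmem).trans ?_
  rw [edist_dist, dist_eq_norm, ← sub_sub, ← starProjection_orthogonal_apply]
  refine (ENNReal.ofReal_le_ofReal (hs y hy)).trans ?_
  rw [ENNReal.ofReal_mul he'.le, ENNReal.ofReal_toReal hetop]

theorem FlatLimit.weakLim_rescale (h : FlatLimit μ x d r ε p L c M θ) (hx : x ∈ μ.support) :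
    WeakLim (𝓝[>] (0 : ℝ)) (fun s => rescale μ x s)
      ((hausd n d).restrict (dir M : Set (E n))) := by
  intro f hf hs
  have hm : ∀ s, 0 < s → 0 < μ.real (Metric.ball x s) := fun s hs => measureReal_ball_pos hx hs
  rw [integral_restrict_dir]
  have h1 := ((h.tendsto_density hm).inv₀ h.θ_pos.ne').mul (h.tendsto_integral hm hf hs)
  rw [← mul_assoc, inv_mul_cancel₀ h.θ_pos.ne', one_mul] at h1
  refine h1.congr' ?_
  filter_upwards [(eventually_mem_nhdsWithin : ∀ᶠ s in 𝓝[>] (0 : ℝ), s ∈ Set.Ioi 0)] with s hs0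
  have hs0' : 0 < s := hs0
  rw [integral_rescale' μ x hs0', inv_div]
  field_simp

theorem FlatLimit.tangentMeasures_eq (h : FlatLimit μ x d r ε p L c M θ) (hx : x ∈ μ.support) :
    tangentMeasures μ x =
      {ν | ∃ c : ℝ≥0, ν = c • (hausd n d).restrict (dir M : Set (E n))} := by
  have hloc := isLocallyFiniteMeasure_restrict_dir M
  have hm : ∀ s, 0 < s → 0 < μ.real (Metric.ball x s) := fun s hs => measureReal_ball_pos hx hs
  ext ν
  constructor
  · rintro ⟨hν, b, s, hs0, hst, hw⟩
    have hst' : Tendsto s atTop (𝓝[>] 0) :=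
      tendsto_nhdsWithin_iff.2 ⟨hst, Eventually.of_forall hs0⟩
    have hw' : ∀ f : E n → ℝ, Continuous f → HasCompactSupport f →
        Tendsto (fun k => (b k : ℝ) * ∫ y, f ((s k)⁻¹ • (y - x)) ∂μ) atTop
          (𝓝 (∫ y, f y ∂ν)) := by
      intro f hf hfs
      refine (hw f hf hfs).congr fun k => ?_
      rw [integral_smul_nnreal_measure, integral_rescale μ x (hs0 k), NNReal.smul_def, smul_eq_mul]
    set f₀ : E n → ℝ := cutoff 1 (1 / 2) with hf₀
    have hf₀c : Continuous f₀ := (lipschitzWith_cutoff (by norm_num)).continuous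
    have hf₀s : HasCompactSupport f₀ := hasCompactSupport_of_support_subset_ball support_cutoff
    set J := ∫ u, f₀ (M u) ∂(hausd d d) with hJ
    have hJ0 : 0 < J := lt_of_lt_of_le (by norm_num)
      (le_integral_cutoff_plane M (a := 1) (η := 1 / 2) (by norm_num) (by norm_num))
    have hθJ : 0 < θ * J := mul_pos h.θ_pos hJ0
    set a := (∫ y, f₀ y ∂ν) / (θ * J) with ha
    have ha0 : 0 ≤ a :=
      div_nonneg (integral_nonneg fun z => cutoff_nonneg (by norm_num) z) hθJ.le
    -- One test function with nonzero integral over the plane determines the limit of the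
    -- normalizing constants; all other integrals of `ν` are then forced.
    have hat : Tendsto (fun k => (b k : ℝ) * s k ^ d) atTop (𝓝 a) := by
      have h1 := (h.tendsto_integral hm hf₀c hf₀s).comp hst'
      have h2 := (hw' f₀ hf₀c hf₀s).div h1 hθJ.ne'
      refine h2.congr' ?_
      filter_upwards [h1.eventually_ne hθJ.ne'] with k hk
      have hsk := hs0 k
      simp only [Function.comp_apply, Pi.div_apply] at hk ⊢
      have h3 : (∫ y, f₀ ((s k)⁻¹ • (y - x)) ∂μ) ≠ 0 := right_ne_zero_of_mul hk
      generalize (∫ y, f₀ ((s k)⁻¹ • (y - x)) ∂μ) = I at h3 ⊢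
      field_simp
    refine ⟨(a * θ).toNNReal, ?_⟩
    refine ext_of_integral_eq fun f hf hfs => ?_
    rw [integral_smul_nnreal_measure, integral_restrict_dir, NNReal.smul_def, smul_eq_mul,
      Real.coe_toNNReal _ (mul_nonneg ha0 h.θ_pos.le), mul_assoc]
    refine tendsto_nhds_unique (hw' f hf hfs) ?_
    refine (hat.mul ((h.tendsto_integral hm hf hfs).comp hst')).congr fun k => ?_
    have hsk := hs0 k
    simp only [Function.comp_apply]
    field_simp
  · rintro ⟨c, rfl⟩
    have hs0 : ∀ k : ℕ, (0 : ℝ) < 1 / ((k : ℝ) + 1) := fun k => Nat.one_div_pos_of_nat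
    -- These coefficients turn the dilations into `c` times the measures `rescale μ x (r k)`.
    refine ⟨inferInstance, fun k => c * (μ (Metric.ball x (1 / ((k : ℝ) + 1)))).toNNReal⁻¹,
      fun k => 1 / ((k : ℝ) + 1), hs0, tendsto_one_div_add_atTop_nhds_zero_nat, ?_⟩
    intro f hf hfs
    have hst' : Tendsto (fun k : ℕ => 1 / ((k : ℝ) + 1)) atTop (𝓝[>] 0) :=
      tendsto_nhdsWithin_iff.2 ⟨tendsto_one_div_add_atTop_nhds_zero_nat, Eventually.of_forall hs0⟩
    have h1 := ((h.weakLim_rescale hx f hf hfs).comp hst').const_mul (c : ℝ)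
    rw [integral_smul_nnreal_measure, NNReal.smul_def, smul_eq_mul]
    refine h1.congr fun k => ?_
    simp only [Function.comp_apply]
    rw [integral_smul_nnreal_measure, integral_rescale μ x (hs0 k), integral_rescale' μ x (hs0 k),
      NNReal.smul_def, smul_eq_mul, ← mul_assoc]
    rfl

end

/-! ### Measurability of the set of good points -/

theorem measurable_measure_ball {n : ℕ} (μ : Measure (E n)) [SFinite μ] :
    Measurable fun z : E n × ℝ => μ (Metric.ball z.1 z.2) := by
  have hopen : IsOpen {w : (E n × ℝ) × E n | dist w.2 w.1.1 < w.1.2} :=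
    isOpen_lt (by fun_prop) (by fun_prop)
  exact measurable_measure_prodMk_left hopen.measurableSet

/-- The function vanishes at a point of the unit sphere. For `n = 0` there is no sphere, and the
vanishing condition is empty. -/
theorem abs_le_two_of_lipschitz {n : ℕ} (hn : n ≠ 0) {ψ : E n → ℝ} (h : LipschitzWith 1 ψ)
    (hs : Function.support ψ ⊆ Metric.ball 0 1) (z : E n) : |ψ z| ≤ 2 := by
  have : Nonempty (Fin n) := ⟨⟨0, Nat.pos_of_ne_zero hn⟩⟩
  by_cases hz : z ∈ Metric.ball (0 : E n) 1
  · obtain ⟨w, hw⟩ := exists_norm_eq (E n) (zero_le_one : (0 : ℝ) ≤ 1)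
    have hw0 : ψ w = 0 := Function.notMem_support.1 fun hc => by
      have := hs hc
      rw [mem_ball_zero_iff, hw] at this
      exact lt_irrefl _ this
    have h1 := h.dist_le_mul z w
    rw [hw0, Real.dist_eq, sub_zero, NNReal.coe_one, one_mul, dist_eq_norm] at h1
    have h2 := norm_sub_le z w
    rw [mem_ball_zero_iff] at hz
    linarith
  · rw [Function.notMem_support.1 fun hc => hz (hs hc)]; norm_num

/-- The function `α` in terms of the normalizing factor `a`, the center and the logarithm of the
radius, taken as independent variables. -/
noncomputable def alphaAux {n : ℕ} (μ : Measure (E n)) (z : ℝ × E n × ℝ) : ℝ≥0∞ :=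
  ⨅ d : Fin (n + 1), ⨅ V ∈ centralPlanes n d,
    ⨆ (ψ : E n → ℝ) (_ : LipschitzWith 1 ψ) (_ : Function.support ψ ⊆ Metric.ball 0 1),
      ENNReal.ofReal |z.1 * (∫ y, ψ ((Real.exp z.2.2)⁻¹ • (y - z.2.1)) ∂μ) -
        ∫ y, ψ y ∂(flatMeasure d V)|

theorem alpha_eq_alphaAux {n : ℕ} (μ : Measure (E n)) (x : E n) {r : ℝ} (hr : 0 < r) :
    alpha μ x r = alphaAux μ ((μ.real (Metric.ball x r))⁻¹, x, Real.log r) := by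
  simp only [alpha, alphaDim, W1, alphaAux, integral_rescale' μ x hr, Real.exp_log hr]

/-- The uniformity in `ψ` is the point: only the bounds `|ψ| ≤ 2` and the Lipschitz constant enter.
-/
theorem eventually_integral_close {n : ℕ} (hn : n ≠ 0) (μ : Measure (E n))
    [IsLocallyFiniteMeasure μ] (z₀ : ℝ × E n × ℝ) {e : ℝ} (he : 0 < e) :
    ∀ᶠ z in 𝓝 z₀, ∀ ψ : E n → ℝ, LipschitzWith 1 ψ → Function.support ψ ⊆ Metric.ball 0 1 →
      |z.1 * (∫ y, ψ ((Real.exp z.2.2)⁻¹ • (y - z.2.1)) ∂μ) -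
        z₀.1 * (∫ y, ψ ((Real.exp z₀.2.2)⁻¹ • (y - z₀.2.1)) ∂μ)| ≤ e := by
  obtain ⟨a₀, x₀, ρ₀⟩ := z₀
  set R := 2 * Real.exp ρ₀ + 1 with hR
  set m := μ.real (Metric.ball x₀ R) with hm
  have hexp : 0 < Real.exp ρ₀ := Real.exp_pos _
  have hcont : Continuous fun z : ℝ × E n × ℝ =>
      |z.1 - a₀| * (m * 2) + |a₀| * (m * (|(Real.exp z.2.2)⁻¹ - (Real.exp ρ₀)⁻¹| * R +
        (Real.exp z.2.2)⁻¹ * ‖z.2.1 - x₀‖)) := by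
    have : Continuous fun z : ℝ × E n × ℝ => (Real.exp z.2.2)⁻¹ :=
      (by fun_prop : Continuous fun z : ℝ × E n × ℝ => Real.exp z.2.2).inv₀
        fun z => (Real.exp_pos _).ne'
    fun_prop
  have h1 := hcont.tendsto (a₀, x₀, ρ₀)
  simp only [sub_self, abs_zero, zero_mul, norm_zero, mul_zero, add_zero] at h1
  have h2 : ∀ᶠ z : ℝ × E n × ℝ in 𝓝 (a₀, x₀, ρ₀), Real.exp z.2.2 < 2 * Real.exp ρ₀ :=
    (by fun_prop : Continuous fun z : ℝ × E n × ℝ => Real.exp z.2.2).continuousAt.eventually_lt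
      continuousAt_const (by simp only; linarith)
  have h3 : ∀ᶠ z : ℝ × E n × ℝ in 𝓝 (a₀, x₀, ρ₀), ‖z.2.1 - x₀‖ < 1 :=
    (by fun_prop : Continuous fun z : ℝ × E n × ℝ => ‖z.2.1 - x₀‖).continuousAt.eventually_lt
      continuousAt_const (by simp)
  filter_upwards [h1.eventually (gt_mem_nhds he), h2, h3]
  rintro ⟨a, x, ρ⟩ hz1 hz2 hz3 ψ hψ hs
  simp only at hz1 hz2 hz3 ⊢
  have hcs := hasCompactSupport_of_support_subset_ball hs
  have hr : 0 < Real.exp ρ := Real.exp_pos _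
  have i1 := integrable_rescaled μ x hr hψ.continuous hcs
  have i2 := integrable_rescaled μ x₀ hexp hψ.continuous hcs
  have hsub : ∀ y, y ∉ Metric.ball x₀ R → ψ ((Real.exp ρ)⁻¹ • (y - x)) = 0 ∧
      ψ ((Real.exp ρ₀)⁻¹ • (y - x₀)) = 0 := by
    intro y hy
    rw [Metric.mem_ball, dist_eq_norm, not_lt] at hy
    constructor
    · refine Function.notMem_support.1 fun hc => ?_
      have := hs hc
      rw [mem_ball_zero_iff, norm_rescale_lt_iff hr, one_mul, Metric.mem_ball, dist_eq_norm] at this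
      have h4 : ‖y - x₀‖ ≤ ‖y - x‖ + ‖x - x₀‖ := by
        calc ‖y - x₀‖ = ‖(y - x) + (x - x₀)‖ := by congr 1; abel
          _ ≤ _ := norm_add_le _ _
      linarith
    · refine Function.notMem_support.1 fun hc => ?_
      have := hs hc
      rw [mem_ball_zero_iff, norm_rescale_lt_iff hexp, one_mul, Metric.mem_ball,
        dist_eq_norm] at this
      linarith
  set I := ∫ y, ψ ((Real.exp ρ)⁻¹ • (y - x)) ∂μ with hI
  set I₀ := ∫ y, ψ ((Real.exp ρ₀)⁻¹ • (y - x₀)) ∂μ with hI₀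
  have b1 : |I| ≤ m * 2 := by
    have hpt : ∀ y, |ψ ((Real.exp ρ)⁻¹ • (y - x))| ≤
        (Metric.ball x₀ R).indicator (fun _ => (2 : ℝ)) y := by
      intro y
      by_cases hy : y ∈ Metric.ball x₀ R
      · rw [Set.indicator_of_mem hy]; exact abs_le_two_of_lipschitz hn hψ hs _
      · rw [Set.indicator_of_notMem hy, (hsub y hy).1, abs_zero]
    refine abs_integral_le_integral_abs.trans ((integral_mono i1.abs
      (integrable_indicator_ball' μ x₀ 2 R) hpt).trans (le_of_eq ?_))
    rw [integral_indicator_const _ Metric.isOpen_ball.measurableSet, smul_eq_mul]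
  have b2 : |I - I₀| ≤ m * (|(Real.exp ρ)⁻¹ - (Real.exp ρ₀)⁻¹| * R +
      (Real.exp ρ)⁻¹ * ‖x - x₀‖) := by
    have hpt : ∀ y, |ψ ((Real.exp ρ)⁻¹ • (y - x)) - ψ ((Real.exp ρ₀)⁻¹ • (y - x₀))| ≤
        (Metric.ball x₀ R).indicator (fun _ => |(Real.exp ρ)⁻¹ - (Real.exp ρ₀)⁻¹| * R +
          (Real.exp ρ)⁻¹ * ‖x - x₀‖) y := by
      intro y
      by_cases hy : y ∈ Metric.ball x₀ R
      · rw [Set.indicator_of_mem hy]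
        have h4 := hψ.dist_le_mul ((Real.exp ρ)⁻¹ • (y - x)) ((Real.exp ρ₀)⁻¹ • (y - x₀))
        rw [Real.dist_eq, NNReal.coe_one, one_mul, dist_eq_norm] at h4
        have h5 : (Real.exp ρ)⁻¹ • (y - x) - (Real.exp ρ₀)⁻¹ • (y - x₀) =
            ((Real.exp ρ)⁻¹ - (Real.exp ρ₀)⁻¹) • (y - x₀) - (Real.exp ρ)⁻¹ • (x - x₀) := by
          module
        rw [h5] at h4
        refine h4.trans ((norm_sub_le _ _).trans (add_le_add ?_ ?_))
        · rw [norm_smul, Real.norm_eq_abs]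
          rw [Metric.mem_ball, dist_eq_norm] at hy
          exact mul_le_mul_of_nonneg_left hy.le (abs_nonneg _)
        · rw [norm_smul, Real.norm_of_nonneg (by positivity)]
      · rw [Set.indicator_of_notMem hy, (hsub y hy).1, (hsub y hy).2, sub_zero, abs_zero]
    rw [hI, hI₀, ← integral_sub i1 i2]
    refine abs_integral_le_integral_abs.trans ((integral_mono (i1.sub i2).abs
      (integrable_indicator_ball' μ x₀ _ R) hpt).trans (le_of_eq ?_))
    rw [integral_indicator_const _ Metric.isOpen_ball.measurableSet, smul_eq_mul]
  have e1 : a * I - a₀ * I₀ = (a - a₀) * I + a₀ * (I - I₀) := by ring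
  rw [e1]
  refine (abs_add_le _ _).trans (le_trans ?_ hz1.le)
  rw [abs_mul, abs_mul]
  exact add_le_add (mul_le_mul_of_nonneg_left b1 (abs_nonneg _))
    (mul_le_mul_of_nonneg_left b2 (abs_nonneg _))

/-- For a fixed plane the supremum over `ψ` varies continuously, by uniformity in `ψ`. An arbitrary
infimum of such functions is upper semicontinuous, so no countable family of planes is needed. The
ball mass, which may jump, has been made a separate variable. -/
theorem upperSemicontinuous_alphaAux {n : ℕ} (hn : n ≠ 0) (μ : Measure (E n))
    [IsLocallyFiniteMeasure μ] : UpperSemicontinuous (alphaAux μ) := by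
  intro z₀ u hu
  simp only [alphaAux, iInf_lt_iff] at hu
  obtain ⟨d, V, hV, hlt⟩ := hu
  obtain ⟨v, hv1, hv2⟩ := exists_between hlt
  have hvtop : v ≠ ∞ := (hv2.trans_le le_top).ne
  obtain ⟨e, he0, he⟩ : ∃ e : ℝ, 0 < e ∧ v + ENNReal.ofReal e < u := by
    obtain ⟨e, he, heu⟩ := ENNReal.lt_iff_exists_add_pos_lt.1 hv2
    exact ⟨e, he, by simpa using heu⟩
  filter_upwards [eventually_integral_close hn μ z₀ he0] with z hz
  refine lt_of_le_of_lt ?_ he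
  refine iInf_le_of_le d (iInf₂_le_of_le V hV ?_)
  refine iSup_le fun ψ => iSup₂_le fun hψ hs => ?_
  have h1 : ENNReal.ofReal |z₀.1 * (∫ y, ψ ((Real.exp z₀.2.2)⁻¹ • (y - z₀.2.1)) ∂μ) -
      ∫ y, ψ y ∂(flatMeasure d V)| ≤ v := by
    refine le_trans ?_ hv1.le
    refine (le_of_eq ?_).trans (le_iSup _ ψ)
    rw [iSup_pos hψ, iSup_pos hs]
  refine le_trans ?_ (add_le_add h1 le_rfl)
  rw [← ENNReal.ofReal_add (abs_nonneg _) he0.le]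
  refine ENNReal.ofReal_le_ofReal ?_
  have h2 := hz ψ hψ hs
  have h3 := abs_sub_abs_le_abs_sub
    (z.1 * (∫ y, ψ ((Real.exp z.2.2)⁻¹ • (y - z.2.1)) ∂μ) - ∫ y, ψ y ∂(flatMeasure d V))
    (z₀.1 * (∫ y, ψ ((Real.exp z₀.2.2)⁻¹ • (y - z₀.2.1)) ∂μ) - ∫ y, ψ y ∂(flatMeasure d V))
  rw [sub_sub_sub_cancel_right] at h3
  linarith

theorem measurableSet_goodSet {n : ℕ} (μ : Measure (E n)) [IsLocallyFiniteMeasure μ] :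
    MeasurableSet (goodSet μ) := by
  by_cases hn : n = 0
  · subst hn
    exact Set.Subsingleton.measurableSet (Set.subsingleton_of_subsingleton)
  have hq := (measurable_measure_ball μ).ennreal_toReal.inv
  have hα : Measurable fun z : E n × ℝ =>
      alphaAux μ ((μ.real (Metric.ball z.1 z.2))⁻¹, z.1, Real.log z.2) / ENNReal.ofReal z.2 :=
    ((upperSemicontinuous_alphaAux hn μ).measurable.comp
      (hq.prodMk (measurable_fst.prodMk (Real.measurable_log.comp measurable_snd)))).div
      (ENNReal.measurable_ofReal.comp measurable_snd)
  have hint := hα.lintegral_prod_right' (ν := volume.restrict (Set.Ioo (0 : ℝ) 1))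
  have : goodSet μ = μ.support ∩ {x | ∫⁻ r in Set.Ioo (0 : ℝ) 1,
      alphaAux μ ((μ.real (Metric.ball x r))⁻¹, x, Real.log r) / ENNReal.ofReal r < ∞} := by
    ext x
    have : ∫⁻ r in Set.Ioo (0 : ℝ) 1, alpha μ x r / ENNReal.ofReal r =
        ∫⁻ r in Set.Ioo (0 : ℝ) 1,
          alphaAux μ ((μ.real (Metric.ball x r))⁻¹, x, Real.log r) / ENNReal.ofReal r :=
      setLIntegral_congr_fun measurableSet_Ioo fun r hr => by
        simp only [alpha_eq_alphaAux μ x hr.1]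
    simp only [goodSet, Set.mem_ofPred_eq, Set.mem_inter_iff, this]
  rw [this]
  exact Measure.isClosed_support.measurableSet.inter (measurableSet_lt hint measurable_const)

/-! ### Atoms -/

section
variable {n : ℕ} {μ : Measure (E n)} [IsLocallyFiniteMeasure μ] {x : E n}

theorem tendsto_measure_ball_singleton (μ : Measure (E n)) [IsLocallyFiniteMeasure μ] (x : E n) :
    Tendsto (fun s : ℝ => μ (Metric.ball x s)) (𝓝[>] 0) (𝓝 (μ {x})) := by
  have h := tendsto_measure_biInter_gt (μ := μ) (s := fun s : ℝ => Metric.ball x s) (a := 0)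
    (fun s _ => Metric.isOpen_ball.measurableSet.nullMeasurableSet)
    (fun i j _ hij => Metric.ball_subset_ball hij) ⟨1, one_pos, measure_ball_lt_top.ne⟩
  have he : (⋂ s > (0 : ℝ), Metric.ball x s) = {x} := by
    ext y
    simp only [Set.mem_iInter, Metric.mem_ball, Set.mem_singleton_iff]
    constructor
    · intro hy
      by_contra hne
      exact lt_irrefl _ (hy (dist y x) (dist_pos.2 hne))
    · rintro rfl s hs
      simpa using hs
  rw [he] at h
  exact h

/-- A support point `y ≠ x` near `x` gives a ball `B(y, |x - y|)` that misses `x` but whose double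
contains it. Its mass is at least `μ {x} / C`, too much for a small ball around `x`. -/
theorem exists_isolated_of_atom (hμ : IsDoubling μ) (hx : x ∈ μ.support) (ha : 0 < μ {x}) :
    ∃ ε : ℝ, 0 < ε ∧ μ.support ∩ Metric.ball x ε = {x} := by
  obtain ⟨C, hC, hdoub⟩ := hμ
  have hatop : μ {x} ≠ ∞ := measure_singleton_lt_top.ne
  have hδ : 0 < μ {x} / C := ENNReal.div_pos ha.ne' ENNReal.coe_ne_top
  have hlt : μ {x} < μ {x} + μ {x} / C := ENNReal.lt_add_right hatop hδ.ne'
  obtain ⟨s, hs, hs0⟩ := (((tendsto_measure_ball_singleton μ x).eventually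
    (gt_mem_nhds hlt)).and eventually_mem_nhdsWithin).exists
  have hs0' : 0 < s := hs0
  refine ⟨s / 2, by linarith, ?_⟩
  ext y
  rw [Set.mem_singleton_iff]
  constructor
  · rintro ⟨hy, hyx⟩
    by_contra hne
    have hρ : 0 < dist y x := dist_pos.2 hne
    rw [Metric.mem_ball] at hyx
    have h1 : μ {x} ≤ C * μ (Metric.ball y (dist y x)) := by
      refine le_trans (measure_mono ?_) (hdoub y hy _ hρ)
      rw [Set.singleton_subset_iff, Metric.mem_ball, dist_comm]
      linarith
    have h2 : {x} ∪ Metric.ball y (dist y x) ⊆ Metric.ball x s := by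
      refine Set.union_subset ?_ (Metric.ball_subset_ball' (by linarith))
      rw [Set.singleton_subset_iff]
      exact Metric.mem_ball_self hs0'
    have h3 : Disjoint {x} (Metric.ball y (dist y x)) := by
      rw [Set.disjoint_singleton_left, Metric.mem_ball, dist_comm]
      exact lt_irrefl _
    have h4 := measure_mono (μ := μ) h2
    rw [measure_union h3 Metric.isOpen_ball.measurableSet] at h4
    have h5 := h4.trans_lt hs
    have h6 := (ENNReal.add_lt_add_iff_left hatop).1 h5
    have h7 : μ {x} / C ≤ μ (Metric.ball y (dist y x)) := by
      rw [ENNReal.div_le_iff (by simpa using hC.ne') ENNReal.coe_ne_top, mul_comm]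
      exact h1
    exact absurd h6 (not_lt.2 h7)
  · rintro rfl
    exact ⟨hx, Metric.mem_ball_self (by linarith)⟩

theorem exists_point_plane (n : ℕ) : ∃ V ∈ centralPlanes n 0, ∀ ψ : E n → ℝ,
    ∫ y, ψ y ∂(flatMeasure 0 V) = ψ 0 := by
  have hV : AffineSubspace.mk' (0 : E n) ⊥ ∈ centralPlanes n 0 := by
    refine ⟨by rw [AffineSubspace.direction_mk']; simp, 0, ?_⟩
    exact ⟨AffineSubspace.self_mem_mk' _ _, by simp⟩
  refine ⟨_, hV, fun ψ => ?_⟩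
  obtain ⟨p, L, c, -, hp, -, hc1, hc2, hint⟩ := exists_param_of_mem_centralPlanes hV
  have hc : c = 1 := le_antisymm (by simpa using hc2) (by simpa using hc1)
  have hp0 : p = 0 := by
    rw [AffineSubspace.mem_mk', vsub_eq_sub, sub_zero] at hp
    simpa using hp
  have h1 : ∀ s : E 0, ψ (p + L s) = ψ 0 := fun s => by
    rw [Subsingleton.elim s 0, map_zero, add_zero, hp0]
  have h2 : (hausd 0 0).real Set.univ = 1 := by
    have : (Set.univ : Set (E 0)) = Metric.ball 0 1 := by
      ext s; simp [Subsingleton.elim s 0]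
    rw [this, hausd_real_ball _ one_pos, one_pow]
  rw [hint, hc, one_mul]
  simp only [h1]
  rw [integral_const, h2, one_smul]

/-- At small scales the rescaled measure is a Dirac mass on the unit ball, so `α = 0`; at the
remaining scales a bounded `α` suffices. -/
theorem mem_goodSet_of_atom (hμ : IsDoubling μ) (hx : x ∈ μ.support) (ha : 0 < μ {x}) :
    x ∈ goodSet μ := by
  obtain ⟨ε, hε, hiso⟩ := exists_isolated_of_atom hμ hx ha
  obtain ⟨V, hV, hVint⟩ := exists_point_plane n
  have hle : ∀ r, alpha μ x r ≤ W1 (rescale μ x r) (flatMeasure 0 V) := fun r =>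
    iInf_le_of_le 0 (iInf₂_le_of_le V hV le_rfl)
  have hzero : ∀ r, 0 < r → μ.support ∩ Metric.ball x r = {x} → alpha μ x r = 0 := by
    intro r hr hsr
    refine le_antisymm ((hle r).trans ?_) bot_le
    refine iSup_le fun ψ => iSup₂_le fun hψ hs => ?_
    have hae : (fun y => ψ (r⁻¹ • (y - x))) =ᵐ[μ] ({x} : Set (E n)).indicator fun _ => ψ 0 := by
      filter_upwards [Measure.support_mem_ae (μ := μ)] with y hy
      by_cases hyx : y = x
      · subst hyx; simp
      · rw [Set.indicator_of_notMem (by simpa using hyx)]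
        refine Function.notMem_support.1 fun hc => hyx ?_
        have h1 := hs hc
        rw [mem_ball_zero_iff, norm_rescale_lt_iff hr, one_mul] at h1
        have h2 : y ∈ μ.support ∩ Metric.ball x r := ⟨hy, h1⟩
        rwa [hsr] at h2
    have hball : μ.real (Metric.ball x r) = μ.real {x} := by
      have h1 : μ (Metric.ball x r) = μ {x} := by
        refine measure_congr ?_
        filter_upwards [Measure.support_mem_ae (μ := μ)] with y hy
        refine propext ⟨fun h => ?_, fun h => ?_⟩
        · have h2 : y ∈ μ.support ∩ Metric.ball x r := ⟨hy, h⟩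
          rwa [hsr] at h2
        · have h2 : y = x := h
          subst h2; exact Metric.mem_ball_self hr
      rw [Measure.real, Measure.real, h1]
    have hpos : 0 < μ.real {x} := hball ▸ measureReal_ball_pos hx hr
    rw [integral_rescale' μ x hr, hVint, integral_congr_ae hae,
      integral_indicator_const _ (measurableSet_singleton x), hball, smul_eq_mul, ← mul_assoc,
      inv_mul_cancel₀ hpos.ne', one_mul, sub_self, abs_zero, ENNReal.ofReal_zero]
  refine ⟨hx, ?_⟩
  -- The bound by `4` below rests on `abs_le_two_of_lipschitz`; in dimension zero `α` vanishes at
  -- every radius instead.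
  by_cases hn : n = 0
  · subst hn
    have : ∫⁻ r in Set.Ioo (0 : ℝ) 1, alpha μ x r / ENNReal.ofReal r = 0 := by
      refine (setLIntegral_congr_fun measurableSet_Ioo fun r hr => ?_).trans lintegral_zero
      have h1 : μ.support ∩ Metric.ball x r = {x} := by
        ext y
        rw [Subsingleton.elim y x]
        exact ⟨fun _ => rfl, fun _ => ⟨hx, Metric.mem_ball_self hr.1⟩⟩
      simp only [hzero r hr.1 h1, ENNReal.zero_div]
    rw [this]
    exact ENNReal.zero_lt_top
  have hfour : ∀ r, 0 < r → alpha μ x r ≤ 4 := by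
    intro r hr
    refine (hle r).trans (iSup_le fun ψ => iSup₂_le fun hψ hs => ?_)
    rw [hVint, integral_rescale' μ x hr]
    have hpos : 0 < μ.real (Metric.ball x r) := measureReal_ball_pos hx hr
    have hcs := hasCompactSupport_of_support_subset_ball hs
    have hpt : ∀ y, |ψ (r⁻¹ • (y - x))| ≤ (Metric.ball x r).indicator (fun _ => (2 : ℝ)) y := by
      intro y
      by_cases hy : y ∈ Metric.ball x r
      · rw [Set.indicator_of_mem hy]; exact abs_le_two_of_lipschitz hn hψ hs _
      · have h0 : ψ (r⁻¹ • (y - x)) = 0 := Function.notMem_support.1 fun hc => hy (by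
          have h1 := hs hc
          rwa [mem_ball_zero_iff, norm_rescale_lt_iff hr, one_mul] at h1)
        rw [Set.indicator_of_notMem hy, h0, abs_zero]
    have h1 : |∫ y, ψ (r⁻¹ • (y - x)) ∂μ| ≤ μ.real (Metric.ball x r) * 2 := by
      refine abs_integral_le_integral_abs.trans ((integral_mono
        (integrable_rescaled μ x hr hψ.continuous hcs).abs
        (integrable_indicator_ball' μ x 2 r) hpt).trans (le_of_eq ?_))
      rw [integral_indicator_const _ Metric.isOpen_ball.measurableSet, smul_eq_mul]
    have h2 : |(μ.real (Metric.ball x r))⁻¹ * ∫ y, ψ (r⁻¹ • (y - x)) ∂μ| ≤ 2 := by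
      rw [abs_mul, abs_of_pos (inv_pos.2 hpos), inv_mul_le_iff₀ hpos]
      exact h1
    have h3 := abs_le_two_of_lipschitz hn hψ hs 0
    have h4 := abs_sub ((μ.real (Metric.ball x r))⁻¹ * ∫ y, ψ (r⁻¹ • (y - x)) ∂μ) (ψ 0)
    refine (ENNReal.ofReal_le_ofReal (h4.trans (add_le_add h2 h3))).trans ?_
    norm_num
  have hbound : ∀ r ∈ Set.Ioo (0 : ℝ) 1, alpha μ x r / ENNReal.ofReal r ≤
      4 / ENNReal.ofReal ε := by
    intro r hr
    by_cases hrε : r ≤ ε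
    · have h1 : μ.support ∩ Metric.ball x r = {x} := by
        refine Set.Subset.antisymm ?_ ?_
        · rw [← hiso]
          exact Set.inter_subset_inter_right _ (Metric.ball_subset_ball hrε)
        · rw [Set.singleton_subset_iff]
          exact ⟨hx, Metric.mem_ball_self hr.1⟩
      rw [hzero r hr.1 h1, ENNReal.zero_div]
      exact bot_le
    · exact ENNReal.div_le_div (hfour r hr.1) (ENNReal.ofReal_le_ofReal (not_le.1 hrε).le)
  refine (setLIntegral_mono' measurableSet_Ioo hbound).trans_lt ?_
  rw [setLIntegral_const]
  refine ENNReal.mul_lt_top (ENNReal.div_lt_top (by simp) (by simpa using hε)) ?_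
  simp

end

/-! ### The decomposition of the set of good points by dimension -/

/-- The upper `d`-density along dyadic radii. -/
noncomputable def dyadicDensity {n : ℕ} (μ : Measure (E n)) (d : ℕ) (x : E n) : ℝ≥0∞ :=
  limsup (fun k : ℕ => μ (Metric.ball x ((1 / 2) ^ k)) / ENNReal.ofReal ((1 / 2) ^ k) ^ d) atTop

/-- The good points at which the `d`-density is positive and finite. -/
def goodPart {n : ℕ} (μ : Measure (E n)) (d : ℕ) : Set (E n) :=
  {x | x ∈ goodSet μ ∧ 0 < dyadicDensity μ d x ∧ dyadicDensity μ d x < ∞}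

/-- Countably many radii keep the function Borel on the whole space, including points where the
density has no limit. -/
theorem measurable_dyadicDensity {n : ℕ} (μ : Measure (E n)) [SFinite μ] (d : ℕ) :
    Measurable (dyadicDensity μ d) :=
  Measurable.limsup fun _ => ((measurable_measure_ball μ).comp
    (measurable_id.prodMk measurable_const)).div measurable_const

theorem measurableSet_goodPart {n : ℕ} (μ : Measure (E n)) [IsLocallyFiniteMeasure μ] (d : ℕ) :
    MeasurableSet (goodPart μ d) :=
  (measurableSet_goodSet μ).inter
    ((measurableSet_lt measurable_const (measurable_dyadicDensity μ d)).inter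
      (measurableSet_lt (measurable_dyadicDensity μ d) measurable_const))

theorem tendsto_half_pow : Tendsto (fun k : ℕ => ((1 : ℝ) / 2) ^ k) atTop (𝓝[>] 0) :=
  tendsto_nhdsWithin_iff.2 ⟨tendsto_pow_atTop_nhds_zero_of_lt_one (by norm_num) (by norm_num),
    Eventually.of_forall fun k => by simp⟩

section
variable {n : ℕ} {μ : Measure (E n)} {x : E n}

theorem dyadicDensity_eq {d : ℕ} {θ : ℝ≥0∞}
    (h : Tendsto (fun s : ℝ => μ (Metric.ball x s) / ENNReal.ofReal s ^ d) (𝓝[>] 0) (𝓝 θ)) :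
    dyadicDensity μ d x = θ :=
  (h.comp tendsto_half_pow).limsup_eq

theorem tendsto_ofReal_pow_nhdsGT {m : ℕ} (hm : m ≠ 0) :
    Tendsto (fun s : ℝ => ENNReal.ofReal s ^ m) (𝓝[>] 0) (𝓝 0) := by
  have h : Continuous fun s : ℝ => ENNReal.ofReal s ^ m :=
    (ENNReal.continuous_pow m).comp ENNReal.continuous_ofReal
  simpa [hm] using (h.tendsto 0).mono_left nhdsWithin_le_nhds

theorem tendsto_density_zero {d e : ℕ} (hde : d < e) {θ : ℝ≥0∞} (hθ : θ ≠ ∞)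
    (h : Tendsto (fun s : ℝ => μ (Metric.ball x s) / ENNReal.ofReal s ^ e) (𝓝[>] 0) (𝓝 θ)) :
    Tendsto (fun s : ℝ => μ (Metric.ball x s) / ENNReal.ofReal s ^ d) (𝓝[>] 0) (𝓝 0) := by
  have h1 := ENNReal.Tendsto.mul h (Or.inr ENNReal.zero_ne_top)
    (tendsto_ofReal_pow_nhdsGT (Nat.sub_pos_of_lt hde).ne') (Or.inr hθ)
  rw [mul_zero] at h1
  refine h1.congr' ?_
  filter_upwards [(eventually_mem_nhdsWithin : ∀ᶠ s in 𝓝[>] (0 : ℝ), s ∈ Set.Ioi 0)] with s hs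
  have hs0 : ENNReal.ofReal s ≠ 0 := by simpa using hs
  have he : ENNReal.ofReal s ^ e = ENNReal.ofReal s ^ d * ENNReal.ofReal s ^ (e - d) := by
    rw [← pow_add]; congr 1; omega
  have h0 : ENNReal.ofReal s ^ (e - d) ≠ 0 := pow_ne_zero _ hs0
  have ht : ENNReal.ofReal s ^ (e - d) ≠ ∞ := ENNReal.pow_ne_top ENNReal.ofReal_ne_top
  rw [he, div_eq_mul_inv, div_eq_mul_inv,
    ENNReal.mul_inv (Or.inl (pow_ne_zero _ hs0)) (Or.inl (ENNReal.pow_ne_top ENNReal.ofReal_ne_top)),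
    mul_assoc, mul_assoc, ENNReal.inv_mul_cancel h0 ht, mul_one]

theorem tendsto_density_top {d e : ℕ} (hde : e < d) {θ : ℝ≥0∞} (hθ : θ ≠ 0)
    (h : Tendsto (fun s : ℝ => μ (Metric.ball x s) / ENNReal.ofReal s ^ e) (𝓝[>] 0) (𝓝 θ)) :
    Tendsto (fun s : ℝ => μ (Metric.ball x s) / ENNReal.ofReal s ^ d) (𝓝[>] 0) (𝓝 ∞) := by
  have h0 := (tendsto_inv_iff.2 (tendsto_ofReal_pow_nhdsGT (Nat.sub_pos_of_lt hde).ne'))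
  rw [ENNReal.inv_zero] at h0
  have h1 := ENNReal.Tendsto.mul h (Or.inl hθ) h0 (Or.inl ENNReal.top_ne_zero)
  rw [ENNReal.mul_top hθ] at h1
  refine h1.congr' ?_
  filter_upwards [(eventually_mem_nhdsWithin : ∀ᶠ s in 𝓝[>] (0 : ℝ), s ∈ Set.Ioi 0)] with s hs
  have hs0 : ENNReal.ofReal s ≠ 0 := by simpa using hs
  have he : ENNReal.ofReal s ^ d = ENNReal.ofReal s ^ e * ENNReal.ofReal s ^ (d - e) := by
    rw [← pow_add]; congr 1; omega
  rw [he, div_eq_mul_inv, div_eq_mul_inv,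
    ENNReal.mul_inv (Or.inl (pow_ne_zero _ hs0)) (Or.inl (ENNReal.pow_ne_top ENNReal.ofReal_ne_top)),
    mul_assoc]

variable [IsLocallyFiniteMeasure μ]

/-- A positive finite `d`-density forces the `e`-density to be zero for `e < d` and infinite for `e
> d`. -/
theorem FlatLimit.mem_goodPart_iff {d : ℕ} {r ε : ℕ → ℝ} {p : ℕ → E n}
    {L : ℕ → E d →ₗᵢ[ℝ] E n} {c : ℕ → ℝ} {M : E d →ₗᵢ[ℝ] E n} {θ : ℝ}
    (h : FlatLimit μ x d r ε p L c M θ) (hx : x ∈ goodSet μ) {e : ℕ} :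
    x ∈ goodPart μ e ↔ e = d := by
  have ht := h.tendsto_density_ennreal hx.1
  have hθ : 0 < ENNReal.ofReal θ := ENNReal.ofReal_pos.2 h.θ_pos
  constructor
  · rintro ⟨-, h1, h2⟩
    rcases lt_trichotomy e d with hlt | heq | hgt
    · rw [dyadicDensity_eq (tendsto_density_zero hlt ENNReal.ofReal_ne_top ht)] at h1
      exact absurd h1 (lt_irrefl _)
    · exact heq
    · rw [dyadicDensity_eq (tendsto_density_top hgt hθ.ne' ht)] at h2
      exact absurd h2 (lt_irrefl _)
  · rintro rfl
    refine ⟨hx, ?_, ?_⟩ <;> rw [dyadicDensity_eq ht]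
    · exact hθ
    · exact ENNReal.ofReal_lt_top

theorem exists_flatLimit_of_mem_goodPart {C : ℝ} (hC : DoublingWith μ C) {d : ℕ}
    (hx : x ∈ goodPart μ d) :
    ∃ (r ε : ℕ → ℝ) (p : ℕ → E n) (L : ℕ → E d →ₗᵢ[ℝ] E n) (c : ℕ → ℝ)
      (M : E d →ₗᵢ[ℝ] E n) (θ : ℝ), FlatLimit μ x d r ε p L c M θ := by
  obtain ⟨d', r, ε, p, L, c, M, θ, h⟩ := exists_flatLimit hC hx.1
  obtain rfl := (h.mem_goodPart_iff hx.1).1 hx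
  exact ⟨r, ε, p, L, c, M, θ, h⟩

theorem tendsto_dyadicDensity {C : ℝ} (hC : DoublingWith μ C) {d : ℕ}
    (hx : x ∈ goodPart μ d) :
    Tendsto (fun s : ℝ => μ (Metric.ball x s) / ENNReal.ofReal s ^ d) (𝓝[>] 0)
      (𝓝 (dyadicDensity μ d x)) := by
  obtain ⟨r, ε, p, L, c, M, θ, h⟩ := exists_flatLimit_of_mem_goodPart hC hx
  have ht := h.tendsto_density_ennreal hx.1.1
  rwa [dyadicDensity_eq ht]

theorem density_eq_dyadicDensity {C : ℝ} (hC : DoublingWith μ C) {d : ℕ}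
    (hx : x ∈ goodPart μ d) : density μ d x = dyadicDensity μ d x :=
  (tendsto_dyadicDensity hC hx).limUnder_eq

theorem disjoint_goodPart {C : ℝ} (hC : DoublingWith μ C) {d e : ℕ} (hde : d ≠ e) :
    Disjoint (goodPart μ d) (goodPart μ e) := by
  rw [Set.disjoint_left]
  intro x hx hx'
  obtain ⟨d', r, ε, p, L, c, M, θ, h⟩ := exists_flatLimit hC hx.1
  exact hde (((h.mem_goodPart_iff hx.1).1 hx).trans ((h.mem_goodPart_iff hx.1).1 hx').symm)

theorem goodSet_eq_iUnion {C : ℝ} (hC : DoublingWith μ C) :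
    goodSet μ = ⋃ d : Fin (n + 1), goodPart μ d := by
  ext x
  rw [Set.mem_iUnion]
  constructor
  · intro hx
    obtain ⟨d, r, ε, p, L, c, M, θ, h⟩ := exists_flatLimit hC hx
    exact ⟨⟨d, Nat.lt_succ_of_le h.le_n⟩, (h.mem_goodPart_iff hx).2 rfl⟩
  · rintro ⟨d, hx⟩
    exact hx.1

theorem goodPart_zero (hμ : IsDoubling μ) :
    goodPart μ 0 = {x | x ∈ μ.support ∧ 0 < μ {x}} := by
  have hsing : ∀ x, dyadicDensity μ 0 x = μ {x} := fun x =>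
    dyadicDensity_eq (by simpa using tendsto_measure_ball_singleton μ x)
  ext x
  constructor
  · rintro ⟨h1, h2, -⟩
    exact ⟨h1.1, hsing x ▸ h2⟩
  · rintro ⟨h1, h2⟩
    exact ⟨mem_goodSet_of_atom hμ h1 h2, (hsing x).symm ▸ h2,
      (hsing x).symm ▸ measure_singleton_lt_top⟩

theorem countable_atoms (μ : Measure (E n)) [IsLocallyFiniteMeasure μ] :
    {x | x ∈ μ.support ∧ 0 < μ {x}}.Countable := by
  refine (Measure.countable_meas_pos_of_disjoint_iUnion (μ := μ) (As := fun x : E n => {x})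
    (fun x => measurableSet_singleton x) fun x y hxy => ?_).mono fun x hx => hx.2
  exact Set.disjoint_singleton.2 hxy

end

/-! ### Comparison of `μ` and `ℋᵈ` on pieces of Lipschitz graphs -/

theorem hausd_image_le {n m d : ℕ} {K : ℝ≥0} {f : E n → E m} {A : Set (E n)}
    (h : LipschitzOnWith K f A) : hausd m d (f '' A) ≤ (K : ℝ≥0∞) ^ d * hausd n d A := by
  have h1 := h.hausdorffMeasure_image_le (d := (d : ℝ)) (by positivity)
  rw [ENNReal.rpow_natCast] at h1
  rw [hausd, hausd, Measure.smul_apply, Measure.smul_apply, smul_eq_mul, smul_eq_mul,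
    mul_left_comm]
  exact mul_le_mul_right h1 _

section
variable {n d : ℕ} {μ : Measure (E n)} [IsLocallyFiniteMeasure μ]

/-- Differentiation of measures in `ℝᵈ`: the ball around `x` is mapped into the closed ball of the
same radius around `T x`, so the push-forward of `μ` has lower density at least `a` along `T '' A`.
Restricting to an open `U ⊇ A` of nearly the same mass keeps the push-forward close to `μ A`, for
`A` not necessarily measurable. -/
theorem mul_hausd_image_le {T : E n → E d} (hT : LipschitzWith 1 T) {a : ℝ≥0∞} (ha : a ≠ ∞)
    {A : Set (E n)}
    (h : ∀ x ∈ A, ∀ᶠ s in 𝓝[>] (0 : ℝ), a * ENNReal.ofReal s ^ d ≤ μ (Metric.ball x s)) :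
    a * hausd d d (T '' A) ≤ μ A := by
  refine ENNReal.le_of_forall_pos_le_add fun δ hδ hA => ?_
  obtain ⟨U, hAU, hU, hUle⟩ := A.exists_isOpen_le_add μ (ENNReal.coe_pos.2 hδ).ne'
  have hUtop : μ U < ∞ := hUle.trans_lt (ENNReal.add_lt_top.2 ⟨hA, ENNReal.coe_lt_top⟩)
  have : IsFiniteMeasure (μ.restrict U) := ⟨by rwa [Measure.restrict_apply_univ]⟩
  set ν := (μ.restrict U).map T with hν
  have hνfin : IsFiniteMeasure ν := Measure.isFiniteMeasure_map _ _
  lift a to ℝ≥0 using ha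
  have hmain : ((a : ℝ≥0∞) • hausd d d) (T '' A) ≤ ν (T '' A) := by
    refine (Besicovitch.vitaliFamily ((a : ℝ≥0∞) • hausd d d)).measure_le_of_frequently_le ν
      Measure.AbsolutelyContinuous.rfl _ ?_
    rintro _ ⟨x, hx, rfl⟩
    refine (Besicovitch.tendsto_filterAt _ (T x)).frequently (Eventually.frequently ?_)
    obtain ⟨ρ, hρ, hρU⟩ := Metric.isOpen_iff.1 hU x (hAU hx)
    filter_upwards [h x hx, Ioo_mem_nhdsGT hρ] with s hs hsρ
    rw [Measure.smul_apply, hausd_closedBall _ hsρ.1, smul_eq_mul]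
    refine hs.trans ?_
    rw [hν, Measure.map_apply hT.continuous.measurable Metric.isClosed_closedBall.measurableSet,
      Measure.restrict_apply (hT.continuous.measurable Metric.isClosed_closedBall.measurableSet)]
    refine measure_mono fun y hy => ⟨?_, hρU (Metric.ball_subset_ball hsρ.2.le hy)⟩
    have h1 := hT.dist_le_mul y x
    rw [NNReal.coe_one, one_mul] at h1
    exact h1.trans (Metric.mem_ball.1 hy).le
  calc (a : ℝ≥0∞) * hausd d d (T '' A) = ((a : ℝ≥0∞) • hausd d d) (T '' A) := rfl
    _ ≤ ν (T '' A) := hmain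
    _ ≤ ν Set.univ := measure_mono (Set.subset_univ _)
    _ = μ U := by
      rw [hν, Measure.map_apply hT.continuous.measurable MeasurableSet.univ, Set.preimage_univ,
        Measure.restrict_apply_univ]
    _ ≤ μ A + δ := hUle

/-- The same covering argument for the push-forward of `μ.restrict A`: points of `A` over a closed
ball of radius `s` lie in an open ball of radius `κ' * s`. The gap `κ < κ'` absorbs the passage from
closed to open balls. -/
theorem measure_le_mul_hausd_image {T : E n → E d} (hT : Continuous T) {κ κ' : ℝ≥0}
    (hκ : κ < κ') {b : ℝ≥0∞} (hb : b ≠ ∞) {A : Set (E n)}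
    (hTA : ∀ x ∈ A, ∀ y ∈ A, dist x y ≤ κ * dist (T x) (T y))
    (h : ∀ x ∈ A, ∀ᶠ s in 𝓝[>] (0 : ℝ), μ (Metric.ball x s) ≤ b * ENNReal.ofReal s ^ d) :
    μ A ≤ b * κ' ^ d * hausd d d (T '' A) := by
  set ρ := (μ.restrict A).map T with hρ
  have hbtop : b * κ' ^ d ≠ ∞ := ENNReal.mul_ne_top hb (ENNReal.pow_ne_top ENNReal.coe_ne_top)
  obtain ⟨b', hb'⟩ := WithTop.ne_top_iff_exists.1 hbtop
  replace hb' : (b' : ℝ≥0∞) = b * κ' ^ d := hb'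
  have hmain : ρ (T '' A) ≤ (b' • hausd d d) (T '' A) := by
    refine (Besicovitch.vitaliFamily ρ).measure_le_of_frequently_le (b' • hausd d d)
      Measure.AbsolutelyContinuous.rfl _ ?_
    rintro _ ⟨x, hx, rfl⟩
    refine (Besicovitch.tendsto_filterAt _ (T x)).frequently (Eventually.frequently ?_)
    have h1 : Tendsto (fun s : ℝ => (κ' : ℝ) * s) (𝓝[>] 0) (𝓝[>] 0) := by
      refine tendsto_nhdsWithin_iff.2 ⟨?_, ?_⟩
      · have : Continuous fun s : ℝ => (κ' : ℝ) * s := by fun_prop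
        simpa using (this.tendsto 0).mono_left nhdsWithin_le_nhds
      · filter_upwards [(eventually_mem_nhdsWithin : ∀ᶠ s in 𝓝[>] (0 : ℝ), s ∈ Set.Ioi 0)]
          with s hs
        exact mul_pos (NNReal.coe_pos.2 (pos_of_gt hκ)) hs
    filter_upwards [h1.eventually (h x hx),
      (eventually_mem_nhdsWithin : ∀ᶠ s in 𝓝[>] (0 : ℝ), s ∈ Set.Ioi 0)] with s hs hs0
    have hs0' : 0 < s := hs0
    rw [Measure.smul_apply, ENNReal.smul_def, smul_eq_mul, hausd_closedBall _ hs0', hb', mul_assoc, ← mul_pow]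
    rw [ENNReal.ofReal_mul NNReal.zero_le_coe, ENNReal.ofReal_coe_nnreal] at hs
    refine le_trans ?_ hs
    rw [hρ, Measure.map_apply hT.measurable Metric.isClosed_closedBall.measurableSet,
      Measure.restrict_apply (hT.measurable Metric.isClosed_closedBall.measurableSet)]
    refine measure_mono fun y hy => ?_
    rw [Metric.mem_ball]
    refine (hTA y hy.2 x hx).trans_lt ?_
    have h2 : dist (T y) (T x) ≤ s := hy.1
    calc (κ : ℝ) * dist (T y) (T x) ≤ κ * s := mul_le_mul_of_nonneg_left h2 NNReal.zero_le_coe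
      _ < κ' * s := mul_lt_mul_of_pos_right (NNReal.coe_lt_coe.2 hκ) hs0'
  rw [← hb']
  refine le_trans ?_ hmain
  refine le_trans ?_ (Measure.le_map_apply_image hT.measurable.aemeasurable A)
  rw [Measure.restrict_apply_self]

end

/-! ### Pieces on which the support lies in a cone -/

/-- The coordinates of the orthogonal projection onto `range N`. -/
noncomputable def coord {n d : ℕ} (N : E d →ₗᵢ[ℝ] E n) : E n →L[ℝ] E d :=
  ContinuousLinearMap.adjoint N.toContinuousLinearMap

theorem map_coord {n d : ℕ} (N : E d →ₗᵢ[ℝ] E n) (z : E n) :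
    N (coord N z) = (dir N).starProjection z := by
  rw [starProjection_dir]; rfl

theorem lipschitzWith_coord {n d : ℕ} (N : E d →ₗᵢ[ℝ] E n) : LipschitzWith 1 (coord N) := by
  refine LipschitzWith.of_dist_le_mul fun z w => ?_
  rw [dist_eq_norm, dist_eq_norm, ← map_sub, ← N.norm_map, map_coord, NNReal.coe_one, one_mul]
  exact norm_starProjection_le _ _

/-- The points `x` of `F` near which `F` lies in the cone of aperture `e` around `x + range N`. -/
def conePiece {n d : ℕ} (F : Set (E n)) (N : E d →ₗᵢ[ℝ] E n) (e ρ : ℝ) : Set (E n) :=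
  {x | x ∈ F ∧ ∀ y ∈ F, dist y x < ρ → ‖(dir N)ᗮ.starProjection (y - x)‖ ≤ e * ‖y - x‖}

theorem isClosed_conePiece {n d : ℕ} {F : Set (E n)} (hF : IsClosed F) (N : E d →ₗᵢ[ℝ] E n)
    (e ρ : ℝ) : IsClosed (conePiece F N e ρ) := by
  refine isClosed_of_closure_subset fun x hx => ?_
  obtain ⟨u, hu, hux⟩ := mem_closure_iff_seq_limit.1 hx
  refine ⟨hF.mem_of_tendsto hux (Eventually.of_forall fun k => (hu k).1), fun y hy hyx => ?_⟩
  have h1 : ∀ᶠ k in atTop, dist y (u k) < ρ :=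
    (tendsto_const_nhds.dist hux).eventually (gt_mem_nhds hyx)
  have hc1 : Continuous fun z : E n => ‖(dir N)ᗮ.starProjection (y - z)‖ := by fun_prop
  have hc2 : Continuous fun z : E n => e * ‖y - z‖ := by fun_prop
  exact le_of_tendsto_of_tendsto ((hc1.tendsto x).comp hux) ((hc2.tendsto x).comp hux)
    (h1.mono fun k hk => (hu k).2 y hy hk)

/-- In a ball of radius `ρ / 2` any two points are within `ρ`, so the cone condition applies to all
pairs and makes the projection bi-Lipschitz. -/
theorem dist_le_of_conePiece {n d : ℕ} {F : Set (E n)} {N : E d →ₗᵢ[ℝ] E n} {e ρ : ℝ} {w : E n}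
    (he : e < 1) {x y : E n} (hx : x ∈ conePiece F N e ρ ∩ Metric.ball w (ρ / 2))
    (hy : y ∈ conePiece F N e ρ ∩ Metric.ball w (ρ / 2)) :
    ‖(dir N)ᗮ.starProjection (x - y)‖ ≤ e * dist x y ∧
      dist x y ≤ (1 - e)⁻¹ * dist (coord N x) (coord N y) := by
  have h1 : dist x y < ρ := by
    have := dist_triangle_right x y w
    have h2 := Metric.mem_ball.1 hx.2
    have h3 := Metric.mem_ball.1 hy.2
    linarith
  have h2 := hy.1.2 x hx.1.1 h1
  rw [dist_eq_norm]
  refine ⟨h2, ?_⟩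
  have h3 : x - y = (dir N).starProjection (x - y) + (dir N)ᗮ.starProjection (x - y) := by
    rw [starProjection_orthogonal_apply]; abel
  have h4 : ‖x - y‖ ≤ ‖(dir N).starProjection (x - y)‖ + e * ‖x - y‖ :=
    (congrArg norm h3).le.trans ((norm_add_le _ _).trans (add_le_add le_rfl h2))
  rw [← map_coord, N.norm_map, map_sub, ← dist_eq_norm (coord N x)] at h4
  have h5 : 0 < 1 - e := by linarith
  rw [← dist_eq_norm] at h4 ⊢
  rw [le_inv_mul_iff₀ h5]
  linarith

/-- Projection to `dir N` is injective on the piece; the orthogonal component, as a function of the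
projection, is Lipschitz and extends to all of `dir N`. -/
theorem exists_graph_of_conePiece {n d : ℕ} {F : Set (E n)} {N : E d →ₗᵢ[ℝ] E n} {e ρ : ℝ}
    {w : E n} (he0 : 0 ≤ e) (he : e < 1) :
    ∃ Γ, IsLipschitzGraph d Γ ∧ conePiece F N e ρ ∩ Metric.ball w (ρ / 2) ⊆ Γ := by
  set A := conePiece F N e ρ ∩ Metric.ball w (ρ / 2) with hA
  set P : E n → dir N := fun x => ⟨(dir N).starProjection x, Submodule.starProjection_apply_mem _ _⟩
    with hP
  set Q : E n → ((dir N)ᗮ : Submodule ℝ (E n)) := fun x =>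
    ⟨(dir N)ᗮ.starProjection x, Submodule.starProjection_apply_mem _ _⟩ with hQ
  have hPdist : ∀ x y, dist (P x) (P y) = dist (coord N x) (coord N y) := by
    intro x y
    rw [Subtype.dist_eq, ← N.dist_map, map_coord, map_coord]
  have hinj : Set.InjOn P A := by
    intro x hx y hy hxy
    have h1 := (dist_le_of_conePiece he hx hy).2
    rw [← hPdist, hxy, dist_self, mul_zero] at h1
    exact dist_le_zero.1 h1
  have hκ : 0 ≤ e * (1 - e)⁻¹ := mul_nonneg he0 (inv_nonneg.2 (by linarith))
  set g := Function.invFunOn P A with hg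
  have hgP : ∀ x ∈ A, g (P x) = x := fun x hx => hinj.leftInvOn_invFunOn hx
  have hlip : LipschitzOnWith (Real.toNNReal (e * (1 - e)⁻¹)) (Q ∘ g) (P '' A) := by
    refine LipschitzOnWith.of_dist_le_mul ?_
    rintro _ ⟨x, hx, rfl⟩ _ ⟨y, hy, rfl⟩
    obtain ⟨h1, h2⟩ := dist_le_of_conePiece he hx hy
    rw [Function.comp_apply, Function.comp_apply, hgP x hx, hgP y hy, Subtype.dist_eq,
      dist_eq_norm, ← map_sub, Real.coe_toNNReal _ hκ, hPdist, mul_assoc]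
    exact h1.trans (mul_le_mul_of_nonneg_left h2 he0)
  obtain ⟨f, hf, hfeq⟩ := hlip.extend_finite_dimension
  refine ⟨_, ⟨dir N, ?_, _, f, hf, rfl⟩, fun x hx => ⟨P x, ?_⟩⟩
  · rw [LinearMap.finrank_range_of_inj N.injective]; simp
  · have h1 : f (P x) = Q x := by
      rw [← hfeq ⟨x, hx, rfl⟩, Function.comp_apply, hgP x hx]
    change (dir N).starProjection x + (f (P x) : E n) = x
    rw [h1]
    change (dir N).starProjection x + (dir N)ᗮ.starProjection x = x
    rw [starProjection_orthogonal_apply, add_sub_cancel]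

theorem hausd_le_of_conePiece {n d : ℕ} {F : Set (E n)} {N : E d →ₗᵢ[ℝ] E n} {e ρ : ℝ}
    {w : E n} (he : e < 1) {B : Set (E n)}
    (hB : B ⊆ conePiece F N e ρ ∩ Metric.ball w (ρ / 2)) :
    hausd n d B ≤ (Real.toNNReal (1 - e)⁻¹ : ℝ≥0∞) ^ d * hausd d d (coord N '' B) := by
  have hκ : 0 ≤ (1 - e)⁻¹ := inv_nonneg.2 (by linarith)
  have hinj : Set.InjOn (coord N) B := by
    intro x hx y hy hxy
    have h1 := (dist_le_of_conePiece he (hB hx) (hB hy)).2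
    rw [hxy, dist_self, mul_zero] at h1
    exact dist_le_zero.1 h1
  set g := Function.invFunOn (coord N) B with hg
  have hgP : ∀ x ∈ B, g (coord N x) = x := fun x hx => hinj.leftInvOn_invFunOn hx
  have hlip : LipschitzOnWith (Real.toNNReal (1 - e)⁻¹) g (coord N '' B) := by
    refine LipschitzOnWith.of_dist_le_mul ?_
    rintro _ ⟨x, hx, rfl⟩ _ ⟨y, hy, rfl⟩
    rw [hgP x hx, hgP y hy, Real.coe_toNNReal _ hκ]
    exact (dist_le_of_conePiece he (hB hx) (hB hy)).2
  have h1 := hausd_image_le (d := d) hlip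
  rwa [Set.image_image, Set.image_congr hgP, Set.image_id'] at h1

section
variable {n d : ℕ} {μ : Measure (E n)} [IsLocallyFiniteMeasure μ]

/-- A subset of a separable metric space is separable; `d ≤ n` is what makes the set of projections
nonempty. -/
theorem exists_dense_directions (hd : d ≤ n) : ∃ N : ℕ → E d →ₗᵢ[ℝ] E n,
    ∀ (M : E d →ₗᵢ[ℝ] E n) (e : ℝ), 0 < e →
      ∃ j, ‖(dir (N j)).starProjection - (dir M).starProjection‖ < e := by
  have : ProperSpace (E n →L[ℝ] E n) := FiniteDimensional.proper ℝ _
  have hsec : SecondCountableTopology (E n →L[ℝ] E n) := secondCountable_of_proper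
  set T : Set (E n →L[ℝ] E n) :=
    Set.range fun M : E d →ₗᵢ[ℝ] E n => (dir M).starProjection with hT
  have hne : Nonempty T := by
    have hli : LinearIndependent ℝ fun i : Fin d =>
        EuclideanSpace.basisFun (Fin n) ℝ (Fin.castLE hd i) :=
      (EuclideanSpace.basisFun (Fin n) ℝ).orthonormal.linearIndependent.comp _
        (Fin.castLE_injective hd)
    obtain ⟨M, -⟩ := exists_linearIsometry_range _
      ((finrank_span_eq_card hli).trans (Fintype.card_fin d))
    exact ⟨⟨_, M, rfl⟩⟩
  choose N hN using fun k => (TopologicalSpace.denseSeq T k).2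
  refine ⟨N, fun M e he => ?_⟩
  obtain ⟨j, hj⟩ := (TopologicalSpace.denseRange_denseSeq T).exists_dist_lt ⟨_, M, rfl⟩ he
  refine ⟨j, ?_⟩
  rw [Subtype.dist_eq, dist_comm, dist_eq_norm] at hj
  simp only at hN
  rwa [hN j]

theorem mem_conePiece_of_goodPart {C : ℝ} (hC : DoublingWith μ C) {N : ℕ → E d →ₗᵢ[ℝ] E n}
    (hN : ∀ (M : E d →ₗᵢ[ℝ] E n) (e : ℝ), 0 < e →
      ∃ j, ‖(dir (N j)).starProjection - (dir M).starProjection‖ < e)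
    {x : E n} (hx : x ∈ goodPart μ d) {e : ℝ} (he : 0 < e) :
    ∃ j m : ℕ, x ∈ conePiece μ.support (N j) e (1 / ((m : ℝ) + 1)) := by
  obtain ⟨r, ε, p, L, c, M, θ, h⟩ := exists_flatLimit_of_mem_goodPart hC hx
  obtain ⟨j, hj⟩ := hN M (e / 2) (by linarith)
  have h1 := h.eventually_orthogonal_le hC hx.1.1 (e := e / 4) (by linarith)
  obtain ⟨ρ, hρ, hρs⟩ := (mem_nhdsGT_iff_exists_Ioo_subset).1 h1
  have hρ0 : (0 : ℝ) < ρ := hρ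
  obtain ⟨m, hm⟩ := exists_nat_one_div_lt (half_pos hρ0)
  refine ⟨j, m, hx.1.1, fun y hy hyx => ?_⟩
  by_cases hne : y = x
  · simp [hne]
  have hpos : 0 < dist y x := dist_pos.2 hne
  -- The radius exceeds `dist y x` because balls are open; the loss of `2` is paid by `e / 4`, and
  -- the change from `M` to `N j` by `e / 2`.
  have h2 := hρs (a := 2 * dist y x) ⟨by linarith, by linarith⟩ y
    ⟨hy, by rw [Metric.mem_ball]; linarith⟩
  have e1 : (dir (N j))ᗮ.starProjection (y - x) = (dir M)ᗮ.starProjection (y - x) -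
      ((dir (N j)).starProjection - (dir M).starProjection) (y - x) := by
    rw [starProjection_orthogonal_apply, starProjection_orthogonal_apply, sub_apply]
    abel
  have h3 := (ContinuousLinearMap.le_opNorm
    ((dir (N j)).starProjection - (dir M).starProjection) (y - x)).trans
    (mul_le_mul_of_nonneg_right hj.le (norm_nonneg _))
  rw [e1]
  refine (norm_sub_le _ _).trans ?_
  rw [dist_eq_norm] at h2
  linarith

theorem exists_mem_ball_denseSeq (x : E n) {ρ : ℝ} (hρ : 0 < ρ) :
    ∃ i, x ∈ Metric.ball (TopologicalSpace.denseSeq (E n) i) ρ :=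
  (TopologicalSpace.denseRange_denseSeq (E n)).exists_dist_lt x hρ

theorem isRectifiableSet_goodPart {C : ℝ} (hC : DoublingWith μ C) (hd : d ≤ n) {A : Set (E n)}
    (hA : A ⊆ goodPart μ d) : IsRectifiableSet d A := by
  obtain ⟨N, hN⟩ := exists_dense_directions hd
  choose Γ hΓ hsub using fun q : ℕ × ℕ × ℕ =>
    exists_graph_of_conePiece (F := μ.support) (N := N q.1) (e := 1 / 2)
      (ρ := 1 / ((q.2.1 : ℝ) + 1)) (w := TopologicalSpace.denseSeq (E n) q.2.2)
      (by norm_num) (by norm_num)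
  obtain ⟨φ, hφ⟩ := exists_surjective_nat (ℕ × ℕ × ℕ)
  refine ⟨fun i => Γ (φ i), fun i => hΓ _, ?_⟩
  have : A \ ⋃ i, Γ (φ i) = ∅ := by
    rw [Set.sdiff_eq_empty]
    intro x hx
    obtain ⟨j, m, hjm⟩ := mem_conePiece_of_goodPart hC hN (hA hx) (e := 1 / 2) (by norm_num)
    obtain ⟨i, hi⟩ := exists_mem_ball_denseSeq x (ρ := 1 / ((m : ℝ) + 1) / 2) (by positivity)
    obtain ⟨k, hk⟩ := hφ (j, m, i)
    refine Set.mem_iUnion.2 ⟨k, ?_⟩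
    rw [hk]
    exact hsub (j, m, i) ⟨hjm, hi⟩
  rw [this, measure_empty]

theorem measure_le_of_forall_piece {α ι : Type*} [MeasurableSpace α] [Countable ι]
    {ρ₁ ρ₂ : Measure α} {Q : ℝ≥0∞} {P : ι → Set α} (hP : ∀ i, MeasurableSet (P i))
    {G : Set α} (hG : G ⊆ ⋃ i, P i)
    (h : ∀ i, ∀ B ⊆ P i ∩ G, MeasurableSet B → ρ₁ B ≤ Q * ρ₂ B) {B : Set α} (hB : B ⊆ G)
    (hBm : MeasurableSet B) : ρ₁ B ≤ Q * ρ₂ B := by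
  cases isEmpty_or_nonempty ι
  · have : B = ∅ := by
      rw [Set.eq_empty_iff_forall_notMem]
      intro x hx
      simpa using hG (hB hx)
    simp [this]
  obtain ⟨φ, hφ⟩ := exists_surjective_nat ι
  set D : ℕ → Set α := fun k => B ∩ disjointed (fun k => P (φ k)) k with hD
  have hDm : ∀ k, MeasurableSet (D k) := fun k =>
    hBm.inter (MeasurableSet.disjointed (fun k => hP _) k)
  have hDd : Pairwise (Function.onFun Disjoint D) := fun i j hij =>
    ((disjoint_disjointed _) hij).mono Set.inter_subset_right Set.inter_subset_right
  have hDB : ⋃ k, D k = B := by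
    rw [hD, ← Set.inter_iUnion, iUnion_disjointed]
    refine Set.inter_eq_left.2 fun x hx => ?_
    obtain ⟨i, hi⟩ := Set.mem_iUnion.1 (hG (hB hx))
    obtain ⟨k, rfl⟩ := hφ i
    exact Set.mem_iUnion.2 ⟨k, hi⟩
  rw [← hDB, measure_iUnion hDd hDm, measure_iUnion hDd hDm, ← ENNReal.tsum_mul_left]
  exact ENNReal.tsum_le_tsum fun k =>
    h (φ k) _ (fun x hx => ⟨disjointed_subset (fun k => P (φ k)) k hx.2, hB hx.1⟩) (hDm k)

end

/-! ### The formula `μ = θ ℋᵈ` on the set of good points of dimension `d` -/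

theorem le_of_forall_one_lt_pow_mul_le {X Y : ℝ≥0∞} {m : ℕ}
    (h : ∀ q : ℝ≥0, 1 < q → X ≤ (q : ℝ≥0∞) ^ m * Y) : X ≤ Y := by
  have hc : Continuous fun q : ℝ≥0 => (q : ℝ≥0∞) ^ m :=
    (ENNReal.continuous_pow m).comp ENNReal.continuous_coe
  have h1 : Tendsto (fun q : ℝ≥0 => (q : ℝ≥0∞) ^ m) (𝓝[>] 1) (𝓝 1) := by
    simpa using (hc.tendsto 1).mono_left nhdsWithin_le_nhds
  have h2 := ENNReal.Tendsto.mul_const h1 (b := Y) (Or.inl one_ne_zero)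
  rw [one_mul] at h2
  exact ge_of_tendsto h2 (eventually_mem_nhdsWithin.mono fun q hq => h q hq)

section
variable {n d : ℕ} {μ : Measure (E n)} [IsLocallyFiniteMeasure μ] {C : ℝ}

theorem eventually_measure_ball_le (hC : DoublingWith μ C) {x : E n} (hx : x ∈ goodPart μ d)
    {b : ℝ≥0∞} (hb : dyadicDensity μ d x < b) :
    ∀ᶠ s in 𝓝[>] (0 : ℝ), μ (Metric.ball x s) ≤ b * ENNReal.ofReal s ^ d := by
  filter_upwards [(tendsto_dyadicDensity hC hx).eventually (gt_mem_nhds hb),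
    (eventually_mem_nhdsWithin : ∀ᶠ s in 𝓝[>] (0 : ℝ), s ∈ Set.Ioi 0)] with s hs hs0
  exact (ENNReal.div_le_iff (pow_ne_zero _ (by simpa using hs0))
    (ENNReal.pow_ne_top ENNReal.ofReal_ne_top)).1 hs.le

theorem eventually_le_measure_ball (hC : DoublingWith μ C) {x : E n} (hx : x ∈ goodPart μ d)
    {a : ℝ≥0∞} (ha : a < dyadicDensity μ d x) :
    ∀ᶠ s in 𝓝[>] (0 : ℝ), a * ENNReal.ofReal s ^ d ≤ μ (Metric.ball x s) := by
  filter_upwards [(tendsto_dyadicDensity hC hx).eventually (lt_mem_nhds ha)] with s hs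
  exact ENNReal.mul_le_of_le_div hs.le

/-- On a piece where the support lies in a narrow cone and the density is almost constant, `μ` is
almost equal to `θ ℋᵈ`. -/
theorem measure_compare_of_piece (hC : DoublingWith μ C) {q : ℝ≥0} (hq : 1 < q)
    {N : E d →ₗᵢ[ℝ] E n} {ρ : ℝ} {w : E n} {z : ℤ} {B : Set (E n)} (hBm : MeasurableSet B)
    (hBG : B ⊆ goodPart μ d)
    (hB : B ⊆ conePiece μ.support N (1 - (q : ℝ)⁻¹) ρ ∩ Metric.ball w (ρ / 2))
    (hBz : ∀ x ∈ B, (q : ℝ≥0∞) ^ z ≤ dyadicDensity μ d x ∧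
      dyadicDensity μ d x < (q : ℝ≥0∞) ^ (z + 1)) :
    μ B ≤ (q : ℝ≥0∞) ^ (2 * d + 2) * (hausd n d).withDensity (dyadicDensity μ d) B ∧
    (hausd n d).withDensity (dyadicDensity μ d) B ≤ (q : ℝ≥0∞) ^ (2 * d + 2) * μ B := by
  have hq0 : (q : ℝ≥0∞) ≠ 0 := ENNReal.coe_ne_zero.2 (zero_lt_one.trans hq).ne'
  have hqt : (q : ℝ≥0∞) ≠ ∞ := ENNReal.coe_ne_top
  have hq1 : 1 ≤ (q : ℝ≥0∞) := ENNReal.one_le_coe_iff.2 hq.le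
  have hqr : (0 : ℝ) < q := NNReal.coe_pos.2 (zero_lt_one.trans hq)
  have he : 1 - (q : ℝ)⁻¹ < 1 := by have := inv_pos.2 hqr; linarith
  have hinv : (1 - (1 - (q : ℝ)⁻¹))⁻¹ = q := by rw [sub_sub_cancel, inv_inv]
  have hlt : ∀ u : ℤ, (q : ℝ≥0∞) ^ u < (q : ℝ≥0∞) ^ (u + 1) := fun u => by
    rw [ENNReal.zpow_add hq0 hqt, zpow_one]
    calc (q : ℝ≥0∞) ^ u = (q : ℝ≥0∞) ^ u * 1 := (mul_one _).symm
      _ < _ := (ENNReal.mul_lt_mul_iff_right (ENNReal.zpow_pos hq0 hqt u).ne'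
        (ENNReal.zpow_lt_top hq0 hqt u).ne).2 (ENNReal.one_lt_coe_iff.2 hq)
  have hT : hausd d d (coord N '' B) ≤ hausd n d B := by
    simpa using hausd_image_le (d := d) ((lipschitzWith_coord N).lipschitzOnWith (s := B))
  have hH := hausd_le_of_conePiece he hB
  rw [hinv, Real.toNNReal_coe] at hH
  set Θ := dyadicDensity μ d with hΘ
  rw [withDensity_apply _ hBm]
  have hlow : (q : ℝ≥0∞) ^ z * hausd n d B ≤ ∫⁻ x in B, Θ x ∂(hausd n d) := by
    rw [← setLIntegral_const]
    exact setLIntegral_mono' hBm fun x hx => (hBz x hx).1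
  have hup : ∫⁻ x in B, Θ x ∂(hausd n d) ≤ (q : ℝ≥0∞) ^ (z + 1) * hausd n d B := by
    rw [← setLIntegral_const]
    exact setLIntegral_mono' hBm fun x hx => (hBz x hx).2.le
  constructor
  -- Aperture `1 - 1/q` makes the inverse of the projection `q`-Lipschitz; `q ^ 2` is a convenient
  -- larger constant.
  · have h1 := measure_le_mul_hausd_image (μ := μ) (coord N).continuous (κ := q) (κ' := q ^ 2)
      (by rw [sq]; exact lt_mul_of_one_lt_right (zero_lt_one.trans hq) hq)
      (ENNReal.zpow_lt_top hq0 hqt (z + 1)).ne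
      (fun x hx y hy => by
        have := (dist_le_of_conePiece he (hB hx) (hB hy)).2
        rwa [hinv] at this)
      (fun x hx => eventually_measure_ball_le hC (hBG hx) (hBz x hx).2)
    calc μ B ≤ (q : ℝ≥0∞) ^ (z + 1) * ((q ^ 2 : ℝ≥0) : ℝ≥0∞) ^ d *
          hausd d d (coord N '' B) := h1
      _ ≤ (q : ℝ≥0∞) ^ (z + 1) * ((q ^ 2 : ℝ≥0) : ℝ≥0∞) ^ d * hausd n d B :=
          mul_le_mul_right hT _
      _ = (q : ℝ≥0∞) ^ (2 * d + 1) * ((q : ℝ≥0∞) ^ z * hausd n d B) := by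
          rw [ENNReal.zpow_add hq0 hqt, zpow_one, ENNReal.coe_pow, ← pow_mul, pow_succ]
          ring
      _ ≤ (q : ℝ≥0∞) ^ (2 * d + 2) * ∫⁻ x in B, Θ x ∂(hausd n d) :=
          mul_le_mul' (pow_le_pow_right₀ hq1 (by omega)) hlow
  -- The level `q ^ (z - 1)` is used since the lower density bound requires a strict inequality.
  · have h1 := mul_hausd_image_le (μ := μ) (lipschitzWith_coord N)
      (ENNReal.zpow_lt_top hq0 hqt (z - 1)).ne (A := B)
      (fun x hx => eventually_le_measure_ball hC (hBG hx)
        (lt_of_lt_of_le (by simpa using hlt (z - 1)) (hBz x hx).1))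
    have hz : (q : ℝ≥0∞) ^ (z + 1) = (q : ℝ≥0∞) ^ 2 * (q : ℝ≥0∞) ^ (z - 1) := by
      rw [show z + 1 = 2 + (z - 1) by ring, ENNReal.zpow_add hq0 hqt]
      norm_cast
    calc ∫⁻ x in B, Θ x ∂(hausd n d) ≤ (q : ℝ≥0∞) ^ (z + 1) * hausd n d B := hup
      _ ≤ (q : ℝ≥0∞) ^ (z + 1) * ((q : ℝ≥0∞) ^ d * hausd d d (coord N '' B)) :=
          mul_le_mul_right hH _
      _ = (q : ℝ≥0∞) ^ (d + 2) * ((q : ℝ≥0∞) ^ (z - 1) * hausd d d (coord N '' B)) := by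
          rw [hz, pow_add]; ring
      _ ≤ (q : ℝ≥0∞) ^ (2 * d + 2) * μ B :=
          mul_le_mul' (pow_le_pow_right₀ hq1 (by omega)) h1

/-- For each `q > 1` the good points are cut into countably many pieces, indexed by direction,
scale, centre and density level; then `q → 1`. -/
theorem measure_eq_withDensity (hC : DoublingWith μ C) (hd : d ≤ n) {B : Set (E n)}
    (hBm : MeasurableSet B) (hBG : B ⊆ goodPart μ d) :
    μ B = (hausd n d).withDensity (dyadicDensity μ d) B := by
  obtain ⟨N, hN⟩ := exists_dense_directions hd
  set Θ := dyadicDensity μ d with hΘ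
  have hboth : ∀ q : ℝ≥0, 1 < q →
      μ B ≤ (q : ℝ≥0∞) ^ (2 * d + 2) * (hausd n d).withDensity Θ B ∧
      (hausd n d).withDensity Θ B ≤ (q : ℝ≥0∞) ^ (2 * d + 2) * μ B := by
    intro q hq
    have he : 0 < 1 - (q : ℝ)⁻¹ := sub_pos.2 (inv_lt_one_of_one_lt₀ (by exact_mod_cast hq))
    set P : ℕ × ℕ × ℕ × ℤ → Set (E n) := fun t =>
      (conePiece μ.support (N t.1) (1 - (q : ℝ)⁻¹) (1 / ((t.2.1 : ℝ) + 1)) ∩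
        Metric.ball (TopologicalSpace.denseSeq (E n) t.2.2.1) (1 / ((t.2.1 : ℝ) + 1) / 2)) ∩
      {x | (q : ℝ≥0∞) ^ t.2.2.2 ≤ Θ x ∧ Θ x < (q : ℝ≥0∞) ^ (t.2.2.2 + 1)} with hP
    have hΘm := measurable_dyadicDensity μ d
    have hPm : ∀ t, MeasurableSet (P t) := fun t =>
      ((isClosed_conePiece Measure.isClosed_support _ _ _).measurableSet.inter
        Metric.isOpen_ball.measurableSet).inter
        ((measurableSet_le measurable_const hΘm).inter (measurableSet_lt hΘm measurable_const))
    have hcover : goodPart μ d ⊆ ⋃ t, P t := by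
      intro x hx
      obtain ⟨j, m, hjm⟩ := mem_conePiece_of_goodPart hC hN hx he
      obtain ⟨i, hi⟩ := exists_mem_ball_denseSeq x (ρ := 1 / ((m : ℝ) + 1) / 2) (by positivity)
      obtain ⟨z, hz⟩ := ENNReal.exists_mem_Ico_zpow hx.2.1.ne' hx.2.2.ne
        (ENNReal.one_lt_coe_iff.2 hq) ENNReal.coe_ne_top
      exact Set.mem_iUnion.2 ⟨(j, m, i, z), ⟨hjm, hi⟩, hz⟩
    have hpiece : ∀ t, ∀ B' ⊆ P t ∩ goodPart μ d, MeasurableSet B' →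
        μ B' ≤ (q : ℝ≥0∞) ^ (2 * d + 2) * (hausd n d).withDensity Θ B' ∧
        (hausd n d).withDensity Θ B' ≤ (q : ℝ≥0∞) ^ (2 * d + 2) * μ B' := fun t B' hB' hm =>
      measure_compare_of_piece hC hq hm (fun x hx => (hB' hx).2) (fun x hx => (hB' hx).1.1)
        fun x hx => (hB' hx).1.2
    exact ⟨measure_le_of_forall_piece hPm hcover (fun t B' hB' hm => (hpiece t B' hB' hm).1)
      hBG hBm, measure_le_of_forall_piece hPm hcover
      (fun t B' hB' hm => (hpiece t B' hB' hm).2) hBG hBm⟩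
  exact le_antisymm (le_of_forall_one_lt_pow_mul_le fun q hq => (hboth q hq).1)
    (le_of_forall_one_lt_pow_mul_le fun q hq => (hboth q hq).2)

theorem densityLayer_eq (hC : DoublingWith μ C) (k : ℤ) :
    densityLayer μ d (goodPart μ d) k = goodPart μ d ∩
      {x | (2 : ℝ≥0∞) ^ k ≤ dyadicDensity μ d x ∧ dyadicDensity μ d x < (2 : ℝ≥0∞) ^ (k + 1)} := by
  ext x
  constructor
  · rintro ⟨hx, h1, h2⟩
    rw [density_eq_dyadicDensity hC hx] at h1 h2
    exact ⟨hx, h1, h2⟩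
  · rintro ⟨hx, h1, h2⟩
    rw [← density_eq_dyadicDensity hC hx] at h1 h2
    exact ⟨hx, h1, h2⟩

theorem measurableSet_densityLayer (hC : DoublingWith μ C) (k : ℤ) :
    MeasurableSet (densityLayer μ d (goodPart μ d) k) := by
  rw [densityLayer_eq hC]
  have hΘm := measurable_dyadicDensity μ d
  exact (measurableSet_goodPart μ d).inter
    ((measurableSet_le measurable_const hΘm).inter (measurableSet_lt hΘm measurable_const))

/-- The lower bound on the density makes `ℋᵈ` locally finite on a layer and absolutely continuous
with respect to `μ` there. -/
theorem hausd_le_of_subset_densityLayer (hC : DoublingWith μ C) (hd : d ≤ n) {k : ℤ}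
    {B : Set (E n)} (hBm : MeasurableSet B) (hB : B ⊆ densityLayer μ d (goodPart μ d) k) :
    (2 : ℝ≥0∞) ^ k * hausd n d B ≤ μ B := by
  rw [measure_eq_withDensity hC hd hBm fun x hx => (hB hx).1, withDensity_apply _ hBm,
    ← setLIntegral_const]
  refine setLIntegral_mono' hBm fun x hx => ?_
  rw [← density_eq_dyadicDensity hC (hB hx).1]
  exact (hB hx).2.1

theorem restrict_densityLayer_eq (hC : DoublingWith μ C) (hd : d ≤ n) (k : ℤ) :
    μ.restrict (densityLayer μ d (goodPart μ d) k) =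
      ((hausd n d).restrict (densityLayer μ d (goodPart μ d) k)).withDensity
        (density μ d) := by
  have hm := measurableSet_densityLayer (d := d) hC k
  ext B hB
  rw [Measure.restrict_apply hB, withDensity_apply _ hB, Measure.restrict_restrict hB,
    measure_eq_withDensity hC hd (hB.inter hm) fun x hx => hx.2.1,
    withDensity_apply _ (hB.inter hm)]
  exact setLIntegral_congr_fun (hB.inter hm) fun x hx =>
    (density_eq_dyadicDensity hC hx.2.1).symm

theorem hausd_densityLayer_inter_ball_lt_top (hC : DoublingWith μ C) (hd : d ≤ n) (k : ℤ)
    (R : ℝ) : hausd n d (densityLayer μ d (goodPart μ d) k ∩ Metric.ball 0 R) < ∞ := by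
  have h1 := hausd_le_of_subset_densityLayer hC hd (k := k)
    ((measurableSet_densityLayer hC k).inter Metric.isOpen_ball.measurableSet)
    (Set.inter_subset_left (t := Metric.ball (0 : E n) R))
  have h2 : μ (densityLayer μ d (goodPart μ d) k ∩ Metric.ball 0 R) < ∞ :=
    (measure_mono Set.inter_subset_right).trans_lt measure_ball_lt_top
  exact ENNReal.lt_top_of_mul_ne_top_right (h1.trans_lt h2).ne
    (ENNReal.zpow_pos two_ne_zero ENNReal.ofNat_ne_top k).ne'

theorem hausd_restrict_densityLayer_absolutelyContinuous (hC : DoublingWith μ C) (hd : d ≤ n)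
    (k : ℤ) : (hausd n d).restrict (densityLayer μ d (goodPart μ d) k) ≪
      μ.restrict (densityLayer μ d (goodPart μ d) k) := by
  have hm := measurableSet_densityLayer (d := d) hC k
  refine Measure.AbsolutelyContinuous.mk fun B hB h0 => ?_
  rw [Measure.restrict_apply hB] at h0 ⊢
  have h1 := hausd_le_of_subset_densityLayer hC hd (hB.inter hm) Set.inter_subset_right
  rw [h0, nonpos_iff_eq_zero, mul_eq_zero] at h1
  exact h1.resolve_left (ENNReal.zpow_pos two_ne_zero ENNReal.ofNat_ne_top k).ne'

end

end DoublingRect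

/-! ### Assembly of the decomposition -/

theorem theorem1p5 (n : ℕ) (μ : Measure (E n)) [IsLocallyFiniteMeasure μ] (hμ : IsDoubling μ) :
    ∃ S : Fin (n + 1) → Set (E n),
      -- a partition of `Σ₀` into Borel sets
      (∀ d, MeasurableSet (S d)) ∧
      (∀ d e, d ≠ e → Disjoint (S d) (S e)) ∧
      goodSet μ = ⋃ d, S d ∧
      -- dimension zero: the atoms
      S 0 = {x | x ∈ μ.support ∧ 0 < μ {x}} ∧
      (S 0).Countable ∧
      (∀ x ∈ S 0, ∃ ε : ℝ, 0 < ε ∧ μ.support ∩ Metric.ball x ε = {x}) ∧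
      -- the density exists and is positive and finite
      (∀ d : Fin (n + 1), 1 ≤ (d : ℕ) → ∀ x ∈ S d,
        Tendsto (fun r : ℝ => μ (Metric.ball x r) / ENNReal.ofReal r ^ (d : ℕ)) (𝓝[>] 0)
          (𝓝 (density μ d x)) ∧
        0 < density μ d x ∧ density μ d x < ∞) ∧
      -- tangent planes, tangent measures and weak convergence of the rescaled measures
      (∀ d : Fin (n + 1), 1 ≤ (d : ℕ) → ∀ x ∈ S d,
        ∃ W : AffineSubspace ℝ (E n), IsTangentPlane μ.support x d W ∧
          tangentMeasures μ x =
            {ν | ∃ c : ℝ≥0, ν = c • (hausd n d).restrict (W.direction : Set (E n))} ∧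
          WeakLim (𝓝[>] (0 : ℝ)) (fun r => rescale μ x r)
            ((hausd n d).restrict (W.direction : Set (E n)))) ∧
      -- rectifiability of the density layers, and `μ = θ_d ℋᵈ` there
      (∀ d : Fin (n + 1), 1 ≤ (d : ℕ) → ∀ k : ℤ,
        IsRectifiableSet d (densityLayer μ d (S d) k) ∧
        (∀ R : ℝ, 0 < R → hausd n d (densityLayer μ d (S d) k ∩ Metric.ball 0 R) < ∞) ∧
        μ.restrict (densityLayer μ d (S d) k) ≪ (hausd n d).restrict (densityLayer μ d (S d) k) ∧
        (hausd n d).restrict (densityLayer μ d (S d) k) ≪ μ.restrict (densityLayer μ d (S d) k) ∧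
        μ.restrict (densityLayer μ d (S d) k) =
          ((hausd n d).restrict (densityLayer μ d (S d) k)).withDensity (density μ d)) := by
  obtain ⟨C, hC⟩ := hμ.exists_doublingWith
  refine ⟨fun d => goodPart μ d, fun d => measurableSet_goodPart μ d,
    fun d e hde => disjoint_goodPart hC fun h => hde (Fin.ext h), goodSet_eq_iUnion hC,
    goodPart_zero hμ, ?_, ?_, ?_, ?_, ?_⟩
  · have h0 : goodPart μ ((0 : Fin (n + 1)) : ℕ) = {x | x ∈ μ.support ∧ 0 < μ {x}} :=
      goodPart_zero hμ
    change (goodPart μ ((0 : Fin (n + 1)) : ℕ)).Countable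
    rw [h0]
    exact countable_atoms μ
  · intro x hx
    have h0 : x ∈ {x | x ∈ μ.support ∧ 0 < μ {x}} := goodPart_zero hμ ▸ hx
    exact exists_isolated_of_atom hμ h0.1 h0.2
  · intro d _ x hx
    rw [density_eq_dyadicDensity hC hx]
    exact ⟨tendsto_dyadicDensity hC hx, hx.2⟩
  · intro d _ x hx
    obtain ⟨r, ε, p, L, c, M, θ, h⟩ := exists_flatLimit_of_mem_goodPart hC hx
    refine ⟨AffineSubspace.mk' x (dir M), h.isTangentPlane hC hx.1.1, ?_, ?_⟩
    · rw [AffineSubspace.direction_mk']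
      exact h.tangentMeasures_eq hx.1.1
    · rw [AffineSubspace.direction_mk']
      exact h.weakLim_rescale hx.1.1
  · intro d _ k
    have hd : (d : ℕ) ≤ n := Nat.lt_succ_iff.1 d.2
    refine ⟨isRectifiableSet_goodPart hC hd fun x hx => hx.1,
      fun R _ => hausd_densityLayer_inter_ball_lt_top hC hd k R, ?_,
      hausd_restrict_densityLayer_absolutelyContinuous hC hd k,
      restrict_densityLayer_eq hC hd k⟩
    rw [restrict_densityLayer_eq hC hd k]
    exact withDensity_absolutelyContinuous _ _
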